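/- \textbf{Setting.} Let $M$ and $E$ be smooth Hausdorff $\sigma$-compact manifolds without boundary, $\dim M=m\ge 1$, $\dim E=m+N$, let $\pi:E\to M$ be a smooth submersion (for instance the projection of a smooth fibre bundle), $\pi^1:J^1E\to E$ its first jet bundle, $\bar\pi^1=\pi\circ\pi^1:J^1E\to M$, and let $J^1J^1E$ be the first jet bundle of $\bar\pi^1$. Charts of $E$ and $M$ in which $\pi$ reads $(x^\mu,y^A)\mapsto (x^\mu)$ induce natural charts $(x^\mu,y^A,v^A_\mu)$ of $J^1E$. Let $\omega$ be a volume form on $M$ and $\pounds\in C^\infty(J^1E)$, put $\mathcal L=\pounds\,\bar\pi^{1*}\omega$, and let $\Theta_{\mathcal L}=i(\mathcal V)\mathcal L+\mathcal L$ and $\Omega_{\mathcal L}=-d\Theta_{\mathcal L}$ be the Poincaré--Cartan forms, where $\mathcal V=(dy^A-v^A_\mu dx^\mu)\otimes\partial/\partial v^A_\nu\otimes\partial/\partial x^\nu$ is the vertical endomorphism. Suppose that $\mathcal L$ is regular: $\Omega_{\mathcal L}$ is $1$-nondegenerate, or $\det\big(\partial^2\pounds/\partial v^A_\mu\partial v^B_\nu\big)\neq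 0$ everywhere in natural charts (for $m\ge 2$, $N\ge 1$ these are the same condition). \textbf{Notions.} Let $U\subseteq J^1E$ be open. An $m$-multivector field $X$ on $U$ is \emph{locally decomposable} if locally $X=X_1\wedge\dots\wedge X_m$ with smooth vector fields $X_i$; it is \emph{$\bar\pi^1$-transverse} if $i(X_z)(\bar\pi^{1*}\alpha)\ne 0$ for all $z\in U$ and all nonzero $m$-covectors $\alpha$ at $\bar\pi^1(z)$; its class $\{X\}$ consists of the $fX$ with $f\in C^\infty(U)$ nowhere zero. A transverse $X$ is \emph{SOPDE} if $\Lambda^m\kappa\circ X=\Lambda^m T\pi^1\circ X$, where $\kappa(z,u)=T\phi(T\bar\pi^1 u)$ for any section $\phi$ representing $z$. A \emph{jet field} on $U$ is a smooth section $\mathcal Y$ of $J^1J^1E\to J^1E$ over $U$; its horizontal subbundle $H$ has at $z$ the fibre $T\psi(T_{\bar\pi^1(z)}M)$, where $\psi$ represents $\mathcal Y(z)$, and its connection form $\nabla$ is the projection of $TJ^1E$ onto $H$ along $\ker T\bar\pi^1$. $\mathcal Y$ is \emph{SOPDE} if $j^1\pi^1\circ\mathcal Y=\mathrm{id}$, where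 $j^1\pi^1$ sends the jet of $\psi$ to the jet of $\pi^1\circ\psi$. $X$ and $\mathcal Y$ are \emph{associated} if $X$ is a nowhere zero section of $\Lambda^mH$. The equation $i(\mathcal Y)\Omega_{\mathcal L}=0$ means that $\Omega_{\mathcal L}(h_1,\dots,h_m,\cdot)=0$ for all $h_1,\dots,h_m\in H$, and $(i(\nabla)\Omega_{\mathcal L})(u_0,\dots,u_m)=\sum_i\Omega_{\mathcal L}(u_0,\dots,\nabla u_i,\dots,u_m)$. \textbf{Theorem.} \begin{enumerate} \item There exist a class $\{X_{\mathcal L}\}$ of locally decomposable, $\bar\pi^1$-transverse $m$-multivector fields on $J^1E$ and an associated jet field $\mathcal Y_{\mathcal L}:J^1E\to J^1J^1E$, with connection form $\nabla_{\mathcal L}$, such that $$i(X_{\mathcal L})\Omega_{\mathcal L}=0,\qquad i(\mathcal Y_{\mathcal L})\Omega_{\mathcal L}=0,\qquad i(\nabla_{\mathcal L})\Omega_{\mathcal L}=(m-1)\Omega_{\mathcal L},$$ and all members of $\{X_{\mathcal L}\}$, as well as $\mathcal Y_{\mathcal L}$, are SOPDE. \item On every open $U\subseteq J^1E$, association is a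 bijection between classes of locally decomposable, $\bar\pi^1$-transverse multivector fields and jet fields. For associated $X$, $\mathcal Y$, $\nabla$ the three equations $i(X)\Omega_{\mathcal L}=0$, $i(\mathcal Y)\Omega_{\mathcal L}=0$, $i(\nabla)\Omega_{\mathcal L}=(m-1)\Omega_{\mathcal L}$ are equivalent, and if they hold, then $X$ and $\mathcal Y$ are automatically SOPDE. \item Locally the solutions depend on $N(m^2-1)$ arbitrary functions: every point of the domain of a natural chart has an open neighbourhood $U$ in that domain for which there is a set $S$ of $N(m^2-1)$ triples $(A,\mu,\rho)$ such that, for all smooth functions $g_s$ $(s\in S)$ on $U$, there is exactly one class $\{X\}$ on $U$ of locally decomposable, $\bar\pi^1$-transverse solutions of $i(X)\Omega_{\mathcal L}=0$ (equivalently, exactly one jet field solution) whose associated horizontal subbundle is spanned by $\partial/\partial x^\mu+F^A_\mu\,\partial/\partial y^A+G^A_{\mu\rho}\,\partial/\partial v^A_\rho$ with $G_s=g_s$ for all $s\in S$. \end{enumerate} -/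

import Mathlib

open Set
open scoped Manifold ContDiff Topology

noncomputable section

namespace FieldTheory

section Jets

variable (B F : Type*) [NormedAddCommGroup B] [NormedSpace ℝ B]
  [NormedAddCommGroup F] [NormedSpace ℝ F]
  {M E : Type*} [TopologicalSpace M] [ChartedSpace B M]
  [TopologicalSpace E] [ChartedSpace (B × F) E]

/-- A pair of smooth charts, of `E` and of `M`, in which `π` reads `(x, y) ↦ x`. -/
structure AdaptedChart (π : E → M) where
  tot : OpenPartialHomeomorph E (B × F)
  base : OpenPartialHomeomorph M B
  tot_mem : tot ∈ IsManifold.maximalAtlas 𝓘(ℝ, B × F) ∞ E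
  base_mem : base ∈ IsManifold.maximalAtlas 𝓘(ℝ, B) ∞ M
  mapsTo : ∀ y ∈ tot.source, π y ∈ base.source
  fst_tot : ∀ y ∈ tot.source, (tot y).1 = base (π y)

/-- `π` is a smooth submersion, in local normal form: every point of `E` lies in the domain of
an adapted chart. Projections of smooth fibre bundles with typical fibre modelled on `F` have this
property. -/
class FibredManifold (π : E → M) : Prop where
  exists_adapted : ∀ y : E, ∃ c : AdaptedChart B F π, y ∈ c.tot.source

/-- The tangent map `T_y π : T_y E → T_{π y} M`. Here and below, a tangent space of a manifold
modelled on a normed space `V` is written as `V`, which is what `TangentSpace 𝓘(ℝ, V) p` unfolds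
to. -/
def dproj (π : E → M) (y : E) : B × F →L[ℝ] B := mfderiv 𝓘(ℝ, B × F) 𝓘(ℝ, B) π y

/-- The fibre over `y ∈ E` of the first jet bundle. A first order jet at `x = π y` of local
sections `φ` with `φ x = y` is recorded by its differential `T_x φ : T_x M → T_y E`, and the
linear maps arising in this way are the linear sections of `T_y π`. -/
@[ext]
structure JetAt (π : E → M) (y : E) where
  lin : B →L[ℝ] B × F
  dproj_comp : (dproj B F π y).comp lin = ContinuousLinearMap.id ℝ B

/-- The first jet bundle of `π`. -/
structure J1 (π : E → M) where
  pt : E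
  jet : JetAt B F π pt

/-- Model space of the jet bundle: coordinates `(x, (y, v))`. -/
abbrev JetModel : Type _ := B × (F × (B →L[ℝ] F))

variable {B F}

/-- The projection of the jet bundle to the base `M`. -/
def J1.base {π : E → M} (z : J1 B F π) : M := π z.pt

/-- The differential `T_x φ` of any section `φ` representing the jet. -/
def J1.lin {π : E → M} (z : J1 B F π) : B →L[ℝ] B × F := z.jet.lin

theorem J1.ext' {π : E → M} {z w : J1 B F π} (h : z.pt = w.pt) (h' : z.lin = w.lin) : z = w := by
  obtain ⟨y, A, hA⟩ := z
  obtain ⟨y', A', hA'⟩ := w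
  change y = y' at h
  change A = A' at h'
  subst h; subst h'; rfl

namespace AdaptedChart

variable {π : E → M} (c c' : AdaptedChart B F π)

def dtot (y : E) : B × F →L[ℝ] B × F := mfderiv 𝓘(ℝ, B × F) 𝓘(ℝ, B × F) c.tot y

def dtotSymm (q : B × F) : B × F →L[ℝ] B × F := mfderiv 𝓘(ℝ, B × F) 𝓘(ℝ, B × F) c.tot.symm q

def dbase (x : M) : B →L[ℝ] B := mfderiv 𝓘(ℝ, B) 𝓘(ℝ, B) c.base x

def dbaseSymm (q : B) : B →L[ℝ] B := mfderiv 𝓘(ℝ, B) 𝓘(ℝ, B) c.base.symm q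

theorem mdiff_tot {y : E} (hy : y ∈ c.tot.source) :
    MDifferentiableAt 𝓘(ℝ, B × F) 𝓘(ℝ, B × F) c.tot y :=
  (contMDiffAt_of_mem_maximalAtlas c.tot_mem hy).mdifferentiableAt (by simp)

theorem mdiff_tot_symm {q : B × F} (hq : q ∈ c.tot.target) :
    MDifferentiableAt 𝓘(ℝ, B × F) 𝓘(ℝ, B × F) c.tot.symm q :=
  (contMDiffAt_symm_of_mem_maximalAtlas c.tot_mem hq).mdifferentiableAt (by simp)

theorem mdiff_base {x : M} (hx : x ∈ c.base.source) :
    MDifferentiableAt 𝓘(ℝ, B) 𝓘(ℝ, B) c.base x :=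
  (contMDiffAt_of_mem_maximalAtlas c.base_mem hx).mdifferentiableAt (by simp)

theorem mdiff_base_symm {q : B} (hq : q ∈ c.base.target) :
    MDifferentiableAt 𝓘(ℝ, B) 𝓘(ℝ, B) c.base.symm q :=
  (contMDiffAt_symm_of_mem_maximalAtlas c.base_mem hq).mdifferentiableAt (by simp)

theorem proj_eq {y : E} (hy : y ∈ c.tot.source) : π y = c.base.symm (c.tot y).1 := by
  rw [c.fst_tot y hy, c.base.left_inv (c.mapsTo y hy)]

theorem fst_mem {y : E} (hy : y ∈ c.tot.source) : (c.tot y).1 ∈ c.base.target := by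
  rw [c.fst_tot y hy]; exact c.base.map_source (c.mapsTo y hy)

theorem contMDiffOn_proj : ContMDiffOn 𝓘(ℝ, B × F) 𝓘(ℝ, B) ∞ π c.tot.source := by
  have h1 : ContMDiffOn 𝓘(ℝ, B × F) 𝓘(ℝ, B) ∞ (fun y => (c.tot y).1) c.tot.source :=
    (contDiff_fst.contMDiff).comp_contMDiffOn (contMDiffOn_of_mem_maximalAtlas c.tot_mem)
  have h2 := (contMDiffOn_symm_of_mem_maximalAtlas c.base_mem).comp h1
    (fun y hy => c.fst_mem hy)
  exact h2.congr (fun y hy => c.proj_eq hy)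

theorem mdiff_proj {y : E} (hy : y ∈ c.tot.source) :
    MDifferentiableAt 𝓘(ℝ, B × F) 𝓘(ℝ, B) π y :=
  ((c.contMDiffOn_proj).contMDiffAt (c.tot.open_source.mem_nhds hy)).mdifferentiableAt (by simp)

theorem dbase_comp_dproj {y : E} (hy : y ∈ c.tot.source) :
    (c.dbase (π y)).comp (dproj B F π y) = (ContinuousLinearMap.fst ℝ B F).comp (c.dtot y) := by
  have h1 := mfderiv_comp y (c.mdiff_base (c.mapsTo y hy)) (c.mdiff_proj hy)
  have h2 := mfderiv_comp (I := 𝓘(ℝ, B × F)) (I' := 𝓘(ℝ, B × F)) (I'' := 𝓘(ℝ, B)) y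
    (g := (Prod.fst : B × F → B)) (f := c.tot)
    (differentiableAt_fst.mdifferentiableAt) (c.mdiff_tot hy)
  have h3 : mfderiv 𝓘(ℝ, B × F) 𝓘(ℝ, B) (Prod.fst : B × F → B) (c.tot y) =
      ContinuousLinearMap.fst ℝ B F := by
    rw [mfderiv_eq_fderiv]; exact fderiv_fst
  have h4 : mfderiv 𝓘(ℝ, B × F) 𝓘(ℝ, B) (c.base ∘ π) y =
      mfderiv 𝓘(ℝ, B × F) 𝓘(ℝ, B) (Prod.fst ∘ c.tot) y := by
    apply Filter.EventuallyEq.mfderiv_eq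
    filter_upwards [c.tot.open_source.mem_nhds hy] with w hw
    exact (c.fst_tot w hw).symm
  rw [h3] at h2
  exact h1.symm.trans (h4.trans h2)

theorem dtot_dtotSymm {q : B × F} (hq : q ∈ c.tot.target) :
    (c.dtot (c.tot.symm q)).comp (c.dtotSymm q) = ContinuousLinearMap.id ℝ (B × F) := by
  have h1 := mfderiv_comp q (c.mdiff_tot (c.tot.map_target hq)) (c.mdiff_tot_symm hq)
  have h2 : (c.tot ∘ c.tot.symm) =ᶠ[𝓝 q] id := by
    filter_upwards [c.tot.open_target.mem_nhds hq] with w hw using c.tot.right_inv hw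
  exact h1.symm.trans (h2.mfderiv_eq.trans mfderiv_id)

theorem dtotSymm_dtot {y : E} (hy : y ∈ c.tot.source) :
    (c.dtotSymm (c.tot y)).comp (c.dtot y) = ContinuousLinearMap.id ℝ (B × F) := by
  have h1 := mfderiv_comp y (c.mdiff_tot_symm (c.tot.map_source hy)) (c.mdiff_tot hy)
  have h2 : (c.tot.symm ∘ c.tot) =ᶠ[𝓝 y] id := by
    filter_upwards [c.tot.open_source.mem_nhds hy] with w hw using c.tot.left_inv hw
  exact h1.symm.trans (h2.mfderiv_eq.trans mfderiv_id)

theorem dbase_dbaseSymm {q : B} (hq : q ∈ c.base.target) :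
    (c.dbase (c.base.symm q)).comp (c.dbaseSymm q) = ContinuousLinearMap.id ℝ B := by
  have h1 := mfderiv_comp q (c.mdiff_base (c.base.map_target hq)) (c.mdiff_base_symm hq)
  have h2 : (c.base ∘ c.base.symm) =ᶠ[𝓝 q] id := by
    filter_upwards [c.base.open_target.mem_nhds hq] with w hw using c.base.right_inv hw
  exact h1.symm.trans (h2.mfderiv_eq.trans mfderiv_id)

theorem dbaseSymm_dbase {x : M} (hx : x ∈ c.base.source) :
    (c.dbaseSymm (c.base x)).comp (c.dbase x) = ContinuousLinearMap.id ℝ B := by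
  have h1 := mfderiv_comp x (c.mdiff_base_symm (c.base.map_source hx)) (c.mdiff_base hx)
  have h2 : (c.base.symm ∘ c.base) =ᶠ[𝓝 x] id := by
    filter_upwards [c.base.open_source.mem_nhds hx] with w hw using c.base.left_inv hw
  exact h1.symm.trans (h2.mfderiv_eq.trans mfderiv_id)

/-- The linear map `T_x M → T_y E` with slope `v` in an adapted chart. -/
def slope (y : E) (v : B →L[ℝ] F) : B →L[ℝ] B × F :=
  (c.dtotSymm (c.tot y)).comp
    (((ContinuousLinearMap.id ℝ B).prod v).comp (c.dbase (π y)))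

theorem dproj_slope {y : E} (hy : y ∈ c.tot.source) (v : B →L[ℝ] F) :
    (dproj B F π y).comp (c.slope y v) = ContinuousLinearMap.id ℝ B := by
  have hb := c.dbaseSymm_dbase (c.mapsTo y hy)
  have h1 := c.dbase_comp_dproj hy
  have h2 := c.dtot_dtotSymm (c.tot.map_source hy)
  rw [c.tot.left_inv hy] at h2
  ext u
  have e1 := fun w => DFunLike.congr_fun hb w
  have e2 := fun w => DFunLike.congr_fun h1 w
  have e3 := fun w => DFunLike.congr_fun h2 w
  simp only [ContinuousLinearMap.comp_apply, ContinuousLinearMap.id_apply,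
    ContinuousLinearMap.coe_fst'] at e1 e2 e3 ⊢
  rw [← e1 (dproj B F π y _), e2, slope]
  simp only [ContinuousLinearMap.comp_apply]
  rw [e3]
  simp [e1]

/-- The slope coordinates `v^A_μ` of a jet in an adapted chart. -/
def coordV (z : J1 B F π) : B →L[ℝ] F :=
  (ContinuousLinearMap.snd ℝ B F).comp
    ((c.dtot z.pt).comp (z.lin.comp (c.dbaseSymm (c.base (π z.pt)))))

theorem slope_coordV {z : J1 B F π} (hz : z.pt ∈ c.tot.source) :
    c.slope z.pt (c.coordV z) = z.lin := by
  have hb := c.dbaseSymm_dbase (c.mapsTo _ hz)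
  have h1 := c.dbase_comp_dproj hz
  have h2 := c.dtotSymm_dtot hz
  have h3 : (dproj B F π z.pt).comp z.lin = ContinuousLinearMap.id ℝ B := z.jet.dproj_comp
  ext1 u
  have e1 := fun w => DFunLike.congr_fun hb w
  have e2 := fun w => DFunLike.congr_fun h1 w
  have e3 := fun w => DFunLike.congr_fun h2 w
  have e4 := fun w => DFunLike.congr_fun h3 w
  simp only [ContinuousLinearMap.comp_apply, ContinuousLinearMap.id_apply,
    ContinuousLinearMap.coe_fst'] at e1 e2 e3 e4
  have : (c.dtot z.pt (z.lin u)) = (c.dbase (π z.pt) u, (c.dtot z.pt (z.lin u)).2) := by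
    refine Prod.ext ?_ rfl
    change (c.dtot z.pt (z.lin u)).1 = c.dbase (π z.pt) u
    rw [← e2, e4]
  rw [← e3 (z.lin u), this]
  simp [slope, coordV, e1]

theorem coordV_slope {y : E} (hy : y ∈ c.tot.source) (v : B →L[ℝ] F) (j : JetAt B F π y)
    (hj : j.lin = c.slope y v) : c.coordV ⟨y, j⟩ = v := by
  have hb := c.dbase_dbaseSymm (c.base.map_source (c.mapsTo y hy))
  rw [c.base.left_inv (c.mapsTo y hy)] at hb
  have h2 := c.dtot_dtotSymm (c.tot.map_source hy)
  rw [c.tot.left_inv hy] at h2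
  have e1 := fun w => DFunLike.congr_fun hb w
  have e3 := fun w => DFunLike.congr_fun h2 w
  simp only [ContinuousLinearMap.comp_apply, ContinuousLinearMap.id_apply] at e1 e3
  ext1 u
  simp [coordV, J1.lin, hj, slope, e1, e3]

end AdaptedChart

theorem contMDiff_proj (π : E → M) [FibredManifold B F π] :
    ContMDiff 𝓘(ℝ, B × F) 𝓘(ℝ, B) ∞ π := by
  intro y
  obtain ⟨c, hc⟩ := FibredManifold.exists_adapted (B := B) (F := F) (π := π) y
  exact (c.contMDiffOn_proj).contMDiffAt (c.tot.open_source.mem_nhds hc)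

theorem JetAt.nonempty (π : E → M) [FibredManifold B F π] (y : E) : Nonempty (JetAt B F π y) := by
  obtain ⟨c, hc⟩ := FibredManifold.exists_adapted (B := B) (F := F) (π := π) y
  exact ⟨⟨c.slope y 0, c.dproj_slope hc 0⟩⟩

section NaturalCharts

variable {π : E → M} [FibredManifold B F π]

open Classical in
/-- The jet at `y` with slope `v` in an adapted chart around `y` (some jet, if `y` lies outside). -/
def AdaptedChart.jetOfSlope (c : AdaptedChart B F π) (y : E) (v : B →L[ℝ] F) : JetAt B F π y :=
  if h : y ∈ c.tot.source then ⟨c.slope y v, c.dproj_slope h v⟩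
  else Classical.choice (JetAt.nonempty π y)

theorem AdaptedChart.jetOfSlope_lin (c : AdaptedChart B F π) {y : E} (hy : y ∈ c.tot.source)
    (v : B →L[ℝ] F) : (c.jetOfSlope y v).lin = c.slope y v := by
  unfold AdaptedChart.jetOfSlope
  rw [dif_pos hy]

/-- The natural chart `(x, y, v)` of the jet bundle induced by an adapted chart. -/
def AdaptedChart.natPre (c : AdaptedChart B F π) : PartialEquiv (J1 B F π) (JetModel B F) where
  toFun z := ((c.tot z.pt).1, (c.tot z.pt).2, c.coordV z)
  invFun p := ⟨c.tot.symm (p.1, p.2.1), c.jetOfSlope (c.tot.symm (p.1, p.2.1)) p.2.2⟩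
  source := {z | z.pt ∈ c.tot.source}
  target := {p | (p.1, p.2.1) ∈ c.tot.target}
  map_source' z hz := c.tot.map_source hz
  map_target' p hp := c.tot.map_target hp
  left_inv' z hz := by
    have hz' : z.pt ∈ c.tot.source := hz
    have e : c.tot.symm ((c.tot z.pt).1, (c.tot z.pt).2) = z.pt := c.tot.left_inv hz'
    refine J1.ext' e ?_
    change (c.jetOfSlope (c.tot.symm ((c.tot z.pt).1, (c.tot z.pt).2)) (c.coordV z)).lin = z.lin
    rw [e, c.jetOfSlope_lin hz']
    exact c.slope_coordV hz'
  right_inv' p hp := by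
    have hp' : (p.1, p.2.1) ∈ c.tot.target := hp
    have e := c.tot.right_inv hp'
    have hm : c.tot.symm (p.1, p.2.1) ∈ c.tot.source := c.tot.map_target hp'
    have e1 : (c.tot (c.tot.symm (p.1, p.2.1))).1 = p.1 := by rw [e]
    have e2 : (c.tot (c.tot.symm (p.1, p.2.1))).2 = p.2.1 := by rw [e]
    exact Prod.ext e1 (Prod.ext e2 (c.coordV_slope hm _ _ (c.jetOfSlope_lin hm _)))

/-- The change of adapted charts on the total space. -/
def AdaptedChart.totChange (c c' : AdaptedChart B F π) : B × F → B × F := c'.tot ∘ c.tot.symm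

/-- The change of natural charts of the jet bundle. -/
def natChange (c c' : AdaptedChart B F π) (p : JetModel B F) : JetModel B F :=
  ((c.totChange c' (p.1, p.2.1)).1, (c.totChange c' (p.1, p.2.1)).2,
    (ContinuousLinearMap.snd ℝ B F).comp
      ((fderiv ℝ (c.totChange c') (p.1, p.2.1)).comp
        (((ContinuousLinearMap.id ℝ B).prod p.2.2).comp
          (fderiv ℝ (c.base ∘ c'.base.symm) (c.totChange c' (p.1, p.2.1)).1))))

theorem natPre_source (c c' : AdaptedChart B F π) :
    (c.natPre.symm.trans c'.natPre).source =
      (fun p : JetModel B F => (p.1, p.2.1)) ⁻¹' (c.tot.symm.trans c'.tot).source := by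
  ext p; rfl

theorem isOpen_natPre_source (c c' : AdaptedChart B F π) :
    IsOpen (c.natPre.symm.trans c'.natPre).source := by
  rw [natPre_source]
  exact (c.tot.symm.trans c'.tot).open_source.preimage (by fun_prop)

theorem natPre_change (c c' : AdaptedChart B F π) :
    EqOn (c.natPre.symm.trans c'.natPre) (natChange c c') (c.natPre.symm.trans c'.natPre).source := by
  intro p hp
  rw [natPre_source] at hp
  have hq : (p.1, p.2.1) ∈ c.tot.target := by
    have := hp; simp only [mem_preimage, OpenPartialHomeomorph.trans_source] at this
    exact this.1
  have hq' : c.tot.symm (p.1, p.2.1) ∈ c'.tot.source := by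
    have := hp; simp only [mem_preimage, OpenPartialHomeomorph.trans_source] at this
    exact this.2
  have hm : c.tot.symm (p.1, p.2.1) ∈ c.tot.source := c.tot.map_target hq
  refine Prod.ext rfl (Prod.ext rfl ?_)
  change c'.coordV (c.natPre.symm p) = _
  set y := c.tot.symm (p.1, p.2.1) with hy
  have hlin : (c.natPre.symm p).lin = c.slope y p.2.2 := by
    exact c.jetOfSlope_lin hm _
  have hpt : (c.natPre.symm p).pt = y := rfl
  have htot : fderiv ℝ (c.totChange c') (p.1, p.2.1) =
      (c'.dtot y).comp (c.dtotSymm (p.1, p.2.1)) := by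
    rw [← mfderiv_eq_fderiv]
    exact mfderiv_comp (p.1, p.2.1) (c'.mdiff_tot hq') (c.mdiff_tot_symm hq)
  have hfst : (c.totChange c' (p.1, p.2.1)).1 = c'.base (π y) := c'.fst_tot y hq'
  have hb : fderiv ℝ (c.base ∘ c'.base.symm) (c'.base (π y)) =
      (c.dbase (π y)).comp (c'.dbaseSymm (c'.base (π y))) := by
    have h0 := c'.base.left_inv (c'.mapsTo y hq')
    rw [← mfderiv_eq_fderiv]
    have := mfderiv_comp (I := 𝓘(ℝ, B)) (I' := 𝓘(ℝ, B)) (I'' := 𝓘(ℝ, B)) (c'.base (π y))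
      (g := c.base) (f := c'.base.symm)
      (c.mdiff_base (by rw [h0]; exact c.mapsTo y hm))
      (c'.mdiff_base_symm (c'.base.map_source (c'.mapsTo y hq')))
    rw [h0] at this
    exact this
  change _ = (ContinuousLinearMap.snd ℝ B F).comp _
  rw [htot, hfst, hb]
  unfold AdaptedChart.coordV
  rw [hlin, hpt, AdaptedChart.slope, hy, c.tot.right_inv hq]
  rfl

theorem contDiffOn_natChange (c c' : AdaptedChart B F π) :
    ContDiffOn ℝ ∞ (natChange c c') (c.natPre.symm.trans c'.natPre).source := by
  rw [natPre_source]
  have h1 : ContDiffOn ℝ ∞ (c.totChange c') (c.tot.symm.trans c'.tot).source := by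
    rw [← contMDiffOn_iff_contDiffOn]
    refine (contMDiffOn_of_mem_maximalAtlas c'.tot_mem).comp
      ((contMDiffOn_symm_of_mem_maximalAtlas c.tot_mem).mono ?_) ?_
    · intro q hq; rw [OpenPartialHomeomorph.trans_source] at hq; exact hq.1
    · intro q hq; rw [OpenPartialHomeomorph.trans_source] at hq; exact hq.2
  have hO := (c.tot.symm.trans c'.tot).open_source
  have h1' : ContDiffOn ℝ ∞ (fderiv ℝ (c.totChange c')) (c.tot.symm.trans c'.tot).source :=
    h1.fderiv_of_isOpen hO (by simp)
  have h2 : ContDiffOn ℝ ∞ (c.base ∘ c'.base.symm) (c'.base.symm.trans c.base).source := by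
    rw [← contMDiffOn_iff_contDiffOn]
    refine (contMDiffOn_of_mem_maximalAtlas c.base_mem).comp
      ((contMDiffOn_symm_of_mem_maximalAtlas c'.base_mem).mono ?_) ?_
    · intro q hq; rw [OpenPartialHomeomorph.trans_source] at hq; exact hq.1
    · intro q hq; rw [OpenPartialHomeomorph.trans_source] at hq; exact hq.2
  have h2' : ContDiffOn ℝ ∞ (fderiv ℝ (c.base ∘ c'.base.symm)) (c'.base.symm.trans c.base).source :=
    h2.fderiv_of_isOpen (c'.base.symm.trans c.base).open_source (by simp)
  have hpr : ContDiff ℝ ∞ (fun p : JetModel B F => (p.1, p.2.1)) := by fun_prop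
  set S := (fun p : JetModel B F => (p.1, p.2.1)) ⁻¹' (c.tot.symm.trans c'.tot).source with hS
  have k1 : ContDiffOn ℝ ∞ (fun p : JetModel B F => c.totChange c' (p.1, p.2.1)) S :=
    h1.comp hpr.contDiffOn (fun p hp => hp)
  have k1' : ContDiffOn ℝ ∞ (fun p : JetModel B F => fderiv ℝ (c.totChange c') (p.1, p.2.1)) S :=
    h1'.comp hpr.contDiffOn (fun p hp => hp)
  have k2 : ContDiffOn ℝ ∞ (fun p : JetModel B F =>
      fderiv ℝ (c.base ∘ c'.base.symm) (c.totChange c' (p.1, p.2.1)).1) S := by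
    refine h2'.comp k1.fst ?_
    intro p hp
    have hp' := hp
    simp only [hS, mem_preimage, OpenPartialHomeomorph.trans_source] at hp'
    have hy' : c.tot.symm (p.1, p.2.1) ∈ c'.tot.source := hp'.2
    have hy : c.tot.symm (p.1, p.2.1) ∈ c.tot.source := c.tot.map_target hp'.1
    rw [OpenPartialHomeomorph.trans_source]
    refine ⟨c'.fst_mem hy', ?_⟩
    change c'.base.symm (c'.tot (c.tot.symm (p.1, p.2.1))).1 ∈ c.base.source
    rw [← c'.proj_eq hy']
    exact c.mapsTo _ hy
  have k3 : ContDiff ℝ ∞ (fun p : JetModel B F => (ContinuousLinearMap.id ℝ B).prod p.2.2) := by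
    have : (fun p : JetModel B F => (ContinuousLinearMap.id ℝ B).prod p.2.2) =
      fun p => (ContinuousLinearMap.inl ℝ B F) + (ContinuousLinearMap.inr ℝ B F).comp p.2.2 := by
      ext p u <;> simp
    rw [this]
    exact contDiff_const.add (contDiff_const.clm_comp (contDiff_snd.comp contDiff_snd))
  exact k1.fst.prodMk (k1.snd.prodMk
    (contDiffOn_const.clm_comp (k1'.clm_comp (k3.contDiffOn.clm_comp k2))))

variable (B F π) in
/-- The charted space structure on the jet bundle given by the natural charts. -/
def jetCore : ChartedSpaceCore (JetModel B F) (J1 B F π) where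
  atlas := Set.range AdaptedChart.natPre
  chartAt z := (FibredManifold.exists_adapted (B := B) (F := F) (π := π) z.pt).choose.natPre
  mem_chart_source z :=
    (FibredManifold.exists_adapted (B := B) (F := F) (π := π) z.pt).choose_spec
  chart_mem_atlas z := ⟨_, rfl⟩
  open_source := by
    rintro _ _ ⟨c, rfl⟩ ⟨c', rfl⟩
    exact isOpen_natPre_source c c'
  continuousOn_toFun := by
    rintro _ _ ⟨c, rfl⟩ ⟨c', rfl⟩
    exact (contDiffOn_natChange c c').continuousOn.congr (natPre_change c c')

instance : TopologicalSpace (J1 B F π) := (jetCore B F π).toTopologicalSpace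

instance : ChartedSpace (JetModel B F) (J1 B F π) := (jetCore B F π).toChartedSpace

/-- The natural chart of the jet bundle, as an open partial homeomorphism. -/
def AdaptedChart.nat (c : AdaptedChart B F π) :
    OpenPartialHomeomorph (J1 B F π) (JetModel B F) :=
  (jetCore B F π).openPartialHomeomorph c.natPre ⟨c, rfl⟩

instance : IsManifold 𝓘(ℝ, JetModel B F) ∞ (J1 B F π) := by
  apply isManifold_of_contDiffOn
  intro e e' he he'
  obtain ⟨_, ⟨c, rfl⟩, he⟩ : ∃ f, ∃ h : f ∈ (jetCore B F π).atlas,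
      e = (jetCore B F π).openPartialHomeomorph f h := by
    have h0 : e ∈ ⋃ (f : PartialEquiv (J1 B F π) (JetModel B F)) (h : f ∈ (jetCore B F π).atlas),
        {(jetCore B F π).openPartialHomeomorph f h} := he
    simpa only [mem_iUnion, mem_singleton_iff] using h0
  obtain ⟨_, ⟨c', rfl⟩, he'⟩ : ∃ f, ∃ h : f ∈ (jetCore B F π).atlas,
      e' = (jetCore B F π).openPartialHomeomorph f h := by
    have h0 : e' ∈ ⋃ (f : PartialEquiv (J1 B F π) (JetModel B F)) (h : f ∈ (jetCore B F π).atlas),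
        {(jetCore B F π).openPartialHomeomorph f h} := he'
    simpa only [mem_iUnion, mem_singleton_iff] using h0
  subst he; subst he'
  have h := (contDiffOn_natChange c c').congr (natPre_change c c')
  refine h.mono ?_
  intro p hp
  exact hp.1

theorem AdaptedChart.nat_mem (c : AdaptedChart B F π) :
    c.nat ∈ IsManifold.maximalAtlas 𝓘(ℝ, JetModel B F) ∞ (J1 B F π) := by
  apply IsManifold.subset_maximalAtlas
  change c.nat ∈ ⋃ (f : PartialEquiv (J1 B F π) (JetModel B F)) (h : f ∈ (jetCore B F π).atlas),
        {(jetCore B F π).openPartialHomeomorph f h}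
  simp only [mem_iUnion, mem_singleton_iff]
  exact ⟨c.natPre, ⟨c, rfl⟩, rfl⟩

/-- The natural chart is adapted to the projection of the jet bundle to `M`. -/
def AdaptedChart.prolong (c : AdaptedChart B F π) :
    AdaptedChart B (F × (B →L[ℝ] F)) (J1.base : J1 B F π → M) where
  tot := c.nat
  base := c.base
  tot_mem := c.nat_mem
  base_mem := c.base_mem
  mapsTo z hz := c.mapsTo z.pt hz
  fst_tot z hz := c.fst_tot z.pt hz

/-- The jet bundle is fibred over `M`, so that it has itself a first jet bundle over `M`. -/
instance : FibredManifold B (F × (B →L[ℝ] F)) (J1.base : J1 B F π → M) where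
  exists_adapted z := by
    obtain ⟨c, hc⟩ := FibredManifold.exists_adapted (B := B) (F := F) (π := π) z.pt
    exact ⟨c.prolong, hc⟩

theorem contMDiff_pt : ContMDiff 𝓘(ℝ, JetModel B F) 𝓘(ℝ, B × F) ∞ (J1.pt : J1 B F π → E) := by
  intro z
  obtain ⟨c, hc⟩ := FibredManifold.exists_adapted (B := B) (F := F) (π := π) z.pt
  have hz : z ∈ c.nat.source := hc
  have h0 : ContMDiffOn 𝓘(ℝ, JetModel B F) 𝓘(ℝ, B × F) ∞
      (fun w : J1 B F π => ((c.nat w).1, (c.nat w).2.1)) c.nat.source :=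
    (show ContDiff ℝ ∞ (fun p : JetModel B F => (p.1, p.2.1)) by fun_prop).contMDiff.comp_contMDiffOn
      (contMDiffOn_of_mem_maximalAtlas c.nat_mem)
  have h1 : ContMDiffOn 𝓘(ℝ, JetModel B F) 𝓘(ℝ, B × F) ∞ (J1.pt : J1 B F π → E) c.nat.source :=
    ((contMDiffOn_symm_of_mem_maximalAtlas c.tot_mem).comp h0
      (fun w hw => c.tot.map_source hw)).congr (fun w hw => (c.tot.left_inv hw).symm)
  exact h1.contMDiffAt (c.nat.open_source.mem_nhds hz)

end NaturalCharts
end Jets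

section Forms

variable {V : Type*} [NormedAddCommGroup V] [NormedSpace ℝ V]
  {W : Type*} [NormedAddCommGroup W] [NormedSpace ℝ W]
  {X : Type*} [TopologicalSpace X] [ChartedSpace V X]

/-- The expression of a differential form on `X` in the preferred chart at `p`. -/
def formInChart {n : ℕ} (η : X → V [⋀^Fin n]→L[ℝ] ℝ) (p : X) (q : V) : V [⋀^Fin n]→L[ℝ] ℝ :=
  (η ((chartAt V p).symm q)).compContinuousLinearMap
    (show V →L[ℝ] V from mfderiv 𝓘(ℝ, V) 𝓘(ℝ, V) (chartAt V p).symm q)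

/-- Smoothness of a differential form. -/
def SmoothForm {n : ℕ} (η : X → V [⋀^Fin n]→L[ℝ] ℝ) : Prop :=
  ∀ p : X, ContDiffOn ℝ ∞ (formInChart η p) (chartAt V p).target

/-- The exterior derivative of a differential form. -/
def extD {n : ℕ} (η : X → V [⋀^Fin n]→L[ℝ] ℝ) (p : X) : V [⋀^Fin (n + 1)]→L[ℝ] ℝ :=
  (extDeriv (formInChart η p) (chartAt V p p)).compContinuousLinearMap
    (show V →L[ℝ] V from mfderiv 𝓘(ℝ, V) 𝓘(ℝ, V) (chartAt V p) p)

/-- The alternating form `(u₁, …, uₙ) ↦ ∑ᵢ η(b u₁, …, D uᵢ, …, b uₙ)`, where `b` is applied to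
all entries but the `i`-th one. -/
def insertOne {n : ℕ} (η : W [⋀^Fin n]→L[ℝ] ℝ) (b D : V →L[ℝ] W) : V [⋀^Fin n]→L[ℝ] ℝ :=
  { ∑ i : Fin n, η.toContinuousMultilinearMap.compContinuousLinearMap
      (fun j => if j = i then D else b) with
    map_eq_zero_of_eq' := by
      intro u i j huv hij
      have key : ∀ k : Fin n, k ≠ i → k ≠ j →
          η (fun l => (if l = k then D else b) (u l)) = 0 := by
        intro k hki hkj
        refine η.map_eq_zero_of_eq _ (i := i) (j := j) ?_ hij
        simp [hki.symm, hkj.symm, huv]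
      have hsw : η (fun l => (if l = j then D else b) (u l)) =
          - η (fun l => (if l = i then D else b) (u l)) := by
        refine Eq.trans ?_ (η.toAlternatingMap.map_swap _ hij)
        change _ = η _
        congr 1
        funext l
        simp only [Function.comp]
        rcases eq_or_ne l i with rfl | hli
        · simp [hij, hij.symm, huv]
        · rcases eq_or_ne l j with rfl | hlj
          · simp [huv]
          · simp [Equiv.swap_apply_of_ne_of_ne hli hlj, hli, hlj]
      change (∑ k : Fin n, η.toContinuousMultilinearMap.compContinuousLinearMap
        (fun l => if l = k then D else b)) u = 0
      rw [_root_.sum_apply]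
      change ∑ k : Fin n, η (fun l => (if l = k then D else b) (u l)) = 0
      rw [← Finset.sum_subset (Finset.subset_univ {i, j})]
      · rw [Finset.sum_pair hij, hsw]; simp
      · intro k _ hk
        simp only [Finset.mem_insert, Finset.mem_singleton, not_or] at hk
        exact key k hk.1 hk.2 }

/-- `i(Y) η` for an `m`-vector `Y` and an `m`-form `η`, with
`i(Y₁ ∧ … ∧ Yₘ) η = i(Y₁) ⋯ i(Yₘ) η = η(Yₘ, …, Y₁)`. -/
def contractTop {m : ℕ} (η : V [⋀^Fin m]→L[ℝ] ℝ) (Y : ⋀[ℝ]^m V) : ℝ :=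
  (-1) ^ (m * (m - 1) / 2) * exteriorPower.alternatingMapLinearEquiv η.toAlternatingMap Y

/-- `i(Y) η` for an `m`-vector `Y` and an `(m + 1)`-form `η`, with
`i(Y₁ ∧ … ∧ Yₘ) η = i(Y₁) ⋯ i(Yₘ) η = η(Yₘ, …, Y₁, ·)`. -/
def contract {m : ℕ} (η : V [⋀^Fin (m + 1)]→L[ℝ] ℝ) (Y : ⋀[ℝ]^m V) (u : V) : ℝ :=
  (-1) ^ (m * (m + 1) / 2) *
    exteriorPower.alternatingMapLinearEquiv (η.toAlternatingMap.curryLeft u) Y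

end Forms

section Lagrangian

/-- Model space of the base manifold. -/
abbrev Base (m : ℕ) : Type := Fin m → ℝ

/-- Model space of the fibres. -/
abbrev Fib (N : ℕ) : Type := Fin N → ℝ

/-- Model space of the jet bundle, written for its tangent spaces. -/
abbrev TJ (m N : ℕ) : Type := JetModel (Base m) (Fib N)

variable {m N : ℕ} {M E : Type*} [TopologicalSpace M] [ChartedSpace (Base m) M]
  [TopologicalSpace E] [ChartedSpace (Base m × Fib N) E]
  {π : E → M} [FibredManifold (Base m) (Fib N) π]

/-- `T_z π¹ : T_z J¹E → T_y E`. -/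
def dpt (z : J1 (Base m) (Fib N) π) : TJ m N →L[ℝ] Base m × Fib N :=
  mfderiv 𝓘(ℝ, TJ m N) 𝓘(ℝ, Base m × Fib N) (J1.pt : J1 (Base m) (Fib N) π → E) z

/-- `T_z π̄¹ : T_z J¹E → T_x M`. -/
def dbar (z : J1 (Base m) (Fib N) π) : TJ m N →L[ℝ] Base m :=
  dproj (Base m) (Fib N × (Base m →L[ℝ] Fib N)) (J1.base : J1 (Base m) (Fib N) π → M) z

theorem dproj_comp_dpt (z : J1 (Base m) (Fib N) π) :
    (dproj (Base m) (Fib N) π z.pt).comp (dpt z) = dbar z := by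
  have h1 : MDifferentiableAt 𝓘(ℝ, Base m × Fib N) 𝓘(ℝ, Base m) π z.pt :=
    (contMDiff_proj (B := Base m) (F := Fib N) π).mdifferentiable (by simp) z.pt
  have h2 : MDifferentiableAt 𝓘(ℝ, TJ m N) 𝓘(ℝ, Base m × Fib N)
      (J1.pt : J1 (Base m) (Fib N) π → E) z :=
    contMDiff_pt.mdifferentiable (by simp) z
  exact (mfderiv_comp z h1 h2).symm

/-- `κ_z : T_z J¹E → T_y E`, `κ_z u = T_x φ (T_z π̄¹ u)` for `φ` representing `z`. -/
def kappa (z : J1 (Base m) (Fib N) π) : TJ m N →L[ℝ] Base m × Fib N := z.lin.comp (dbar z)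

/-- The structure canonical form `θ = T π¹ - κ`. -/
def theta (z : J1 (Base m) (Fib N) π) : TJ m N →L[ℝ] Base m × Fib N := dpt z - kappa z

theorem dproj_theta (z : J1 (Base m) (Fib N) π) (u : TJ m N) :
    dproj (Base m) (Fib N) π z.pt (theta z u) = 0 := by
  have h1 : (dproj (Base m) (Fib N) π z.pt) (dpt z u) = dbar z u :=
    DFunLike.congr_fun (dproj_comp_dpt z) u
  have h2 : (dproj (Base m) (Fib N) π z.pt) (z.lin (dbar z u)) = dbar z u :=
    DFunLike.congr_fun z.jet.dproj_comp (dbar z u)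
  simp [theta, kappa, h1, h2]

variable (m N π) in
/-- The vertical space `V_y(π) = ker T_y π`. -/
def Vert (y : E) : Type :=
  LinearMap.ker (dproj (Base m) (Fib N) π y : Base m × Fib N →ₗ[ℝ] Base m)

instance (y : E) : NormedAddCommGroup (Vert m N π y) :=
  inferInstanceAs (NormedAddCommGroup
    (LinearMap.ker (dproj (Base m) (Fib N) π y : Base m × Fib N →ₗ[ℝ] Base m)))

instance (y : E) : NormedSpace ℝ (Vert m N π y) :=
  inferInstanceAs (NormedSpace ℝ
    (LinearMap.ker (dproj (Base m) (Fib N) π y : Base m × Fib N →ₗ[ℝ] Base m)))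

/-- The inclusion `V_y(π) → T_y E`. -/
def Vert.incl (y : E) : Vert m N π y →L[ℝ] Base m × Fib N :=
  (LinearMap.ker (dproj (Base m) (Fib N) π y : Base m × Fib N →ₗ[ℝ] Base m)).subtypeL

theorem Vert.dproj_incl (y : E) (w : Vert m N π y) :
    dproj (Base m) (Fib N) π y (Vert.incl y w) = 0 := w.2

variable (m N π) in
/-- `T*_x M ⊗ V_y(π)`, as the space of linear maps from `T_x M` to `V_y(π)`. This is the vector
space on which the fibre of the jet bundle over `y` is modelled. -/
abbrev VertHom (y : E) : Type := Base m →L[ℝ] Vert m N π y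

/-- The translation action of `T*_x M ⊗ V_y(π)` on the fibre of the jet bundle. -/
def translate (z : J1 (Base m) (Fib N) π) (t : VertHom m N π z.pt) :
    J1 (Base m) (Fib N) π where
  pt := z.pt
  jet := ⟨z.lin + (Vert.incl z.pt).comp t, by
    ext1 a
    have h1 : (dproj (Base m) (Fib N) π z.pt) (z.lin a) = a :=
      DFunLike.congr_fun z.jet.dproj_comp a
    have h2 := Vert.dproj_incl z.pt (t a)
    simp [h1, h2]⟩

/-- The derivative of the Lagrangian function at `z` along the fibre of the jet bundle,
`t ↦ d/ds L(z + s t)`; in coordinates it has the components `∂L/∂v^A_μ`. -/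
def fibreDeriv (L : J1 (Base m) (Fib N) π → ℝ) (z : J1 (Base m) (Fib N) π) :
    VertHom m N π z.pt →L[ℝ] ℝ :=
  fderiv ℝ (fun t => L (translate z t)) 0

/-- The second derivative of the Lagrangian function at `z` along the fibre of the jet bundle; in
coordinates it has the components `∂²L/∂v^A_μ∂v^B_ν`. -/
def fibreHessian (L : J1 (Base m) (Fib N) π → ℝ) (z : J1 (Base m) (Fib N) π) :
    VertHom m N π z.pt →L[ℝ] VertHom m N π z.pt →L[ℝ] ℝ :=
  fderiv ℝ (fderiv ℝ (fun t => L (translate z t))) 0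

/-- `θ` as a map to the vertical space. -/
def thetaVert (z : J1 (Base m) (Fib N) π) : TJ m N →L[ℝ] Vert m N π z.pt :=
  (theta z).codRestrict (LinearMap.ker (dproj (Base m) (Fib N) π z.pt :
    Base m × Fib N →ₗ[ℝ] Base m)) (fun u => dproj_theta z u)

/-- `u ↦ dx^ν ⊗ θ(u)`, where `dx^ν` is the `ν`-th coordinate on `T_x M`. -/
def thetaTensor (z : J1 (Base m) (Fib N) π) (ν : Fin m) :
    TJ m N →L[ℝ] VertHom m N π z.pt :=
  (ContinuousLinearMap.smulRightL ℝ (Base m) (Vert m N π z.pt)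
    (ContinuousLinearMap.proj ν)).comp (thetaVert z)

/-- The contraction of the vertical endomorphism `𝒱 = (dy^A - v^A_μ dx^μ) ⊗ ∂/∂v^A_ν ⊗ ∂/∂x^ν` with
`dL` in the factor `∂/∂v^A_ν`: the map `T_z J¹E → T_x M` that sends `u` to the vector `P` with
`α(P) = d/ds L(z + s α ⊗ θ(u))` for all covectors `α`. -/
def vertEndL (L : J1 (Base m) (Fib N) π → ℝ) (z : J1 (Base m) (Fib N) π) :
    TJ m N →L[ℝ] Base m :=
  ContinuousLinearMap.pi (fun ν => (fibreDeriv L z).comp (thetaTensor z ν))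

/-- The Poincaré-Cartan `m`-form `Θ = i(𝒱)ℒ + ℒ` of the Lagrangian density `ℒ = L π̄¹*vol`. -/
def poincareCartan (vol : M → Base m [⋀^Fin m]→L[ℝ] ℝ) (L : J1 (Base m) (Fib N) π → ℝ)
    (z : J1 (Base m) (Fib N) π) : TJ m N [⋀^Fin m]→L[ℝ] ℝ :=
  insertOne (vol z.base) (dbar z) (vertEndL L z) + L z • (vol z.base).compContinuousLinearMap (dbar z)

/-- The Poincaré-Cartan `(m + 1)`-form `Ω = - dΘ`. -/
def Omega (vol : M → Base m [⋀^Fin m]→L[ℝ] ℝ) (L : J1 (Base m) (Fib N) π → ℝ)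
    (z : J1 (Base m) (Fib N) π) : TJ m N [⋀^Fin (m + 1)]→L[ℝ] ℝ :=
  - extD (poincareCartan vol L) z

/-- A volume form on the base: smooth and nowhere zero. -/
def IsVolumeForm (vol : M → Base m [⋀^Fin m]→L[ℝ] ℝ) : Prop :=
  SmoothForm vol ∧ ∀ x, vol x ≠ 0

/-- `1`-nondegeneracy of an `(m + 1)`-form on the jet bundle. -/
def OneNondegenerate (η : J1 (Base m) (Fib N) π → TJ m N [⋀^Fin (m + 1)]→L[ℝ] ℝ) : Prop :=
  ∀ z, ∀ u : TJ m N, (∀ w : Fin m → TJ m N, η z (Fin.cons u w) = 0) → u = 0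

/-- Nondegeneracy of the fibre Hessian, that is `det (∂²L/∂v^A_μ∂v^B_ν) ≠ 0` everywhere. -/
def HessianNondegenerate (L : J1 (Base m) (Fib N) π → ℝ) : Prop :=
  ∀ z, ∀ t, fibreHessian L z t = 0 → t = 0

/-- Regularity. For `m ≥ 2` and `N ≥ 1` both alternatives say the same. For `m = 1` the form `Ω` is
never `1`-nondegenerate, for it is a `2`-form in odd dimension; regularity of a mechanical system
is the second alternative. -/
def IsRegular (vol : M → Base m [⋀^Fin m]→L[ℝ] ℝ) (L : J1 (Base m) (Fib N) π → ℝ) : Prop :=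
  OneNondegenerate (Omega vol L) ∨ HessianNondegenerate L

end Lagrangian

section Fields

variable {m N : ℕ} {M E : Type*} [TopologicalSpace M] [ChartedSpace (Base m) M]
  [TopologicalSpace E] [ChartedSpace (Base m × Fib N) E]
  (π : E → M) [FibredManifold (Base m) (Fib N) π]

variable (m N) in
/-- `m`-vector fields on the jet bundle, without any smoothness. -/
abbrev MultiField : Type _ := J1 (Base m) (Fib N) π → ⋀[ℝ]^m (TJ m N)

variable (m N) in
/-- Sections of `J¹J¹E → J¹E`, without any smoothness; here `J¹J¹E` is the jet bundle of
`π̄¹ : J¹E → M`. -/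
abbrev JetSection : Type _ := (z : J1 (Base m) (Fib N) π) →
  JetAt (Base m) (Fib N × (Base m →L[ℝ] Fib N)) (J1.base : J1 (Base m) (Fib N) π → M) z

variable {π} (U : Set (J1 (Base m) (Fib N) π))

/-- On the open set `U`, the multivector field is locally of the form `Y₁ ∧ … ∧ Yₘ` with smooth
vector fields `Yᵢ`. -/
def LocallyDecomposableOn (X : MultiField m N π) : Prop :=
  ∀ z ∈ U, ∃ V ⊆ U, IsOpen V ∧ z ∈ V ∧
    ∃ Y : Fin m → J1 (Base m) (Fib N) π → TJ m N,
      (∀ i, ContMDiffOn 𝓘(ℝ, TJ m N) 𝓘(ℝ, TJ m N).tangent ∞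
        (fun w => (⟨w, Y i w⟩ : TangentBundle 𝓘(ℝ, TJ m N) (J1 (Base m) (Fib N) π))) V) ∧
      ∀ w ∈ V, X w = exteriorPower.ιMulti ℝ m (fun i => Y i w)

/-- `π̄¹`-transversality on `U`. -/
def TransverseOn (X : MultiField m N π) : Prop :=
  ∀ z ∈ U, ∀ α : Base m [⋀^Fin m]→L[ℝ] ℝ, α ≠ 0 →
    contractTop (α.compContinuousLinearMap (dbar z)) (X z) ≠ 0

/-- Smooth jet fields on `U`. -/
def IsJetFieldOn (Ψ : JetSection m N π) : Prop :=
  ContMDiffOn 𝓘(ℝ, TJ m N) 𝓘(ℝ, JetModel (Base m) (Fib N × (Base m →L[ℝ] Fib N))) ∞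
    (fun z => (⟨z, Ψ z⟩ : J1 (Base m) (Fib N × (Base m →L[ℝ] Fib N))
      (J1.base : J1 (Base m) (Fib N) π → M))) U

/-- Two multivector fields on `U` belong to the same class: `X' = f X` on `U` with a smooth
nowhere zero function `f`. -/
def SameClassOn (X X' : MultiField m N π) : Prop :=
  ∃ f : J1 (Base m) (Fib N) π → ℝ, ContMDiffOn 𝓘(ℝ, TJ m N) 𝓘(ℝ, ℝ) ∞ f U ∧
    ∀ z ∈ U, f z ≠ 0 ∧ X' z = f z • X z

/-- The horizontal subbundle `H(J¹E)` of a jet field. -/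
def horizontal (Ψ : JetSection m N π) (z : J1 (Base m) (Fib N) π) : Submodule ℝ (TJ m N) :=
  LinearMap.range ((Ψ z).lin : Base m →ₗ[ℝ] TJ m N)

/-- The connection form `∇ : T J¹E → T J¹E` of a jet field. -/
def connForm (Ψ : JetSection m N π) (z : J1 (Base m) (Fib N) π) : TJ m N →L[ℝ] TJ m N :=
  (Ψ z).lin.comp (dbar z)

/-- The distribution of the multivector field is the one of the jet field: on `U`, the multivector
field is a nowhere zero section of `Λᵐ H(J¹E)`. -/
def AssociatedOn (X : MultiField m N π) (Ψ : JetSection m N π) : Prop :=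
  ∀ z ∈ U, X z ≠ 0 ∧
    X z ∈ LinearMap.range (exteriorPower.map m (horizontal Ψ z).subtype)

/-- The SOPDE condition `Λᵐκ ∘ X = Λᵐ(T π¹) ∘ X` on `U`. -/
def SopdeOn (X : MultiField m N π) : Prop :=
  ∀ z ∈ U, exteriorPower.map m (kappa z : TJ m N →ₗ[ℝ] Base m × Fib N) (X z) =
    exteriorPower.map m (dpt z : TJ m N →ₗ[ℝ] Base m × Fib N) (X z)

/-- The projection `j¹π¹ : J¹J¹E → J¹E`, which sends the jet of `ψ` to the jet of `π¹ ∘ ψ`. -/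
def j1pt (w : J1 (Base m) (Fib N × (Base m →L[ℝ] Fib N))
    (J1.base : J1 (Base m) (Fib N) π → M)) : J1 (Base m) (Fib N) π where
  pt := w.pt.pt
  jet := ⟨(dpt w.pt).comp w.lin, by
    rw [← ContinuousLinearMap.comp_assoc, dproj_comp_dpt]
    exact w.jet.dproj_comp⟩

/-- The SOPDE condition `j¹π¹ ∘ Ψ = id` on `U`. -/
def JetSopdeOn (Ψ : JetSection m N π) : Prop := ∀ z ∈ U, j1pt ⟨z, Ψ z⟩ = z

variable (vol : M → Base m [⋀^Fin m]→L[ℝ] ℝ) (L : J1 (Base m) (Fib N) π → ℝ)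

/-- `i(X)Ω = 0` on `U`. -/
def MultiEqOn (X : MultiField m N π) : Prop :=
  ∀ z ∈ U, ∀ u, contract (Omega vol L z) (X z) u = 0

/-- `i(Ψ)Ω = 0` on `U`. -/
def JetEqOn (Ψ : JetSection m N π) : Prop :=
  ∀ z ∈ U, ∀ (Z : Fin m → Base m) (u : TJ m N),
    Omega vol L z (Fin.snoc (α := fun _ => TJ m N) (fun i => (Ψ z).lin (Z i)) u) = 0

/-- `i(∇)Ω = (m - 1)Ω` on `U`, where `(i(∇)Ω)(u₀, …, uₘ) = ∑ᵢ Ω(u₀, …, ∇uᵢ, …, uₘ)`. -/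
def ConnEqOn (Ψ : JetSection m N π) : Prop :=
  ∀ z ∈ U, insertOne (Omega vol L z) (ContinuousLinearMap.id ℝ (TJ m N)) (connForm Ψ z) =
    ((m : ℝ) - 1) • Omega vol L z

/-- The coefficient `G^A_{μρ}` of `∂/∂v^A_ρ` in the horizontal lift
`∂/∂x^μ + F^A_μ ∂/∂y^A + G^A_{μρ} ∂/∂v^A_ρ` of `∂/∂x^μ` by a jet field, in the natural chart induced
by an adapted chart. The index `s` is `(A, μ, ρ)`. -/
def coefG (c : AdaptedChart (Base m) (Fib N) π) (Ψ : JetSection m N π)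
    (s : Fin N × Fin m × Fin m) (z : J1 (Base m) (Fib N) π) : ℝ :=
  (c.prolong.coordV ⟨z, Ψ z⟩ (Pi.single s.2.1 1)).2 (Pi.single s.2.2 1) s.1

end Fields

end FieldTheory

end

noncomputable section

namespace FieldTheory

set_option linter.unusedSectionVars false

/-! ### Multilinear algebra: top forms on the model base, `m`-vectors of sections, horizontal and
vertical arguments. -/

section Multilinear

variable {V : Type*} [NormedAddCommGroup V] [NormedSpace ℝ V]
  {W : Type*} [NormedAddCommGroup W] [NormedSpace ℝ W] {m n : ℕ}

/-! In natural coordinates the Poincaré–Cartan form is the standard one, `modelTheta`, of the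
function `lagr`, the Lagrangian times the density of the volume form (`poincareCartan_eq`,
`Omega_apply`). Let a horizontal subbundle be spanned by the lifts with coefficients F and G.
Contracting Ω with these lifts automatically kills horizontal vectors, because `m + 1` vectors of an
`m`-dimensional space are dependent, so only vertical directions (b, w) have to be tested. There an
explicit computation (`extDeriv_modelTheta_horizontal`) applies: the w-directions pair F - v with
the fibre Hessian, and once F = v the b-directions give the Euler–Lagrange equations. Regularity, in
either form, makes the Hessian nondegenerate (`hessNondeg_lagr`). Hence F = v, which is the SOPDE
property, and N affine equations for the Nm² coefficients G remain (`jetEq_iff`,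
`eulerLagrange_iff_coef`).

The rows of this linear system are independent (`elMatrix_rows`), again by nondegeneracy of the
Hessian. Some N × N minor is therefore nonzero near a given point, and Cramer's rule solves smoothly
for N of the coefficients in terms of the other N(m² - 1), which are arbitrary. This gives the local
statement. The pointwise solutions form a convex set (`convex_solutions`), so local solutions are
glued by a partition of unity on the jet bundle (`exists_jetEqOn_univ`).

A horizontal subbundle H and the line of `m`-vectors on H determine each other: a section of the
projection is recovered from its `m`-vector by pairing with suitable `m`-forms
(`section_ext_of_mem_range`), and a transverse decomposable `m`-vector spans the image of a unique
section. In coordinates the slope is a quotient of smooth matrices, so smoothness carries over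
(`exists_jetField`, `sameClassOn_of_associatedOn`).

For the connection equation (`connection_eq_iff`), the operator i(∇) multiplies the component of Ω
with k horizontal entries by k. Components with three or more vertical entries vanish, and so does
the one with none. The equation with factor m - 1 thus says exactly that the component with one
vertical entry vanishes. -/

theorem insertOne_apply (η : W [⋀^Fin n]→L[ℝ] ℝ) (b D : V →L[ℝ] W) (u : Fin n → V) :
    insertOne η b D u = ∑ i, η (Function.update (fun j => b (u j)) i (D (u i))) := by
  change (∑ k : Fin n, η.toContinuousMultilinearMap.compContinuousLinearMap
        (fun l => if l = k then D else b)) u = _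
  rw [_root_.sum_apply]
  refine Finset.sum_congr rfl fun k _ => ?_
  change η (fun l => (if l = k then D else b) (u l)) = _
  congr 1
  funext l
  rcases eq_or_ne l k with rfl | h
  · simp
  · simp [h]

theorem insertOne_add (η : W [⋀^Fin n]→L[ℝ] ℝ) (b D D' : V →L[ℝ] W) :
    insertOne η b (D + D') = insertOne η b D + insertOne η b D' := by
  ext u
  simp [insertOne_apply, Finset.sum_add_distrib, ContinuousAlternatingMap.map_update_add]

theorem insertOne_smul (η : W [⋀^Fin n]→L[ℝ] ℝ) (b D : V →L[ℝ] W) (r : ℝ) :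
    insertOne η b (r • D) = r • insertOne η b D := by
  ext u
  simp [insertOne_apply, Finset.mul_sum, ContinuousAlternatingMap.map_update_smul]

variable (m) in
/-- The standard frame of the model space of the base. -/
def stdFrame : Fin m → Base m := fun i => Pi.single i 1

variable (m) in
/-- The standard volume form of the model space of the base. -/
def stdVol : Base m [⋀^Fin m]→L[ℝ] ℝ :=
  { (Matrix.detRowAlternating : Base m [⋀^Fin m]→ₗ[ℝ] ℝ) with
    cont := Continuous.matrix_det continuous_id }

theorem stdVol_apply (u : Fin m → Base m) : stdVol m u = Matrix.det (Matrix.of u) := rfl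

theorem stdVol_frame : stdVol m (stdFrame m) = 1 := by
  rw [stdVol_apply]
  convert Matrix.det_one (R := ℝ) (n := Fin m)
  ext i j
  simp [stdFrame, Matrix.one_apply, Pi.single_apply, eq_comm]

/-- An alternating map is determined by its values on injective families of basis vectors. Such a
family is a permutation of the standard frame, and both sides acquire its sign. General values are
allowed because the lemma is also applied to maps into exterior powers. -/
theorem alternating_base_eq {G : Type*} [AddCommGroup G] [Module ℝ G]
    (f : Base m [⋀^Fin m]→ₗ[ℝ] G) (Z : Fin m → Base m) : f Z = stdVol m Z • f (stdFrame m) := by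
  have h : f = (LinearMap.toSpanSingleton ℝ G (f (stdFrame m))).compAlternatingMap
      (stdVol m).toAlternatingMap := by
    refine Module.Basis.ext_alternating (Pi.basisFun ℝ (Fin m)) fun i hi => ?_
    let σ : Equiv.Perm (Fin m) := Equiv.ofBijective i (Finite.injective_iff_bijective.1 hi)
    have hb : (fun j => (Pi.basisFun ℝ (Fin m)) (i j)) = stdFrame m ∘ σ := by
      funext j; simp [stdFrame, σ]
    rw [hb, AlternatingMap.map_perm, AlternatingMap.map_perm]
    congr 1
    simp [stdVol_frame]
  exact DFunLike.congr_fun h Z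

theorem eq_smul_stdVol (η : Base m [⋀^Fin m]→L[ℝ] ℝ) : η = η (stdFrame m) • stdVol m := by
  ext Z
  have := alternating_base_eq η.toAlternatingMap Z
  simpa [mul_comm] using this

theorem apply_stdFrame_ne_zero {η : Base m [⋀^Fin m]→L[ℝ] ℝ} (h : η ≠ 0) :
    η (stdFrame m) ≠ 0 := by
  intro h0
  apply h
  rw [eq_smul_stdVol η, h0, zero_smul]

theorem base_eq_sum (a : Base m) : a = ∑ i, a i • stdFrame m i := by
  ext j
  simp [stdFrame, Finset.sum_apply, Pi.single_apply]

theorem clm_base_ext {A A' : Base m →L[ℝ] V} (h : ∀ i, A (stdFrame m i) = A' (stdFrame m i)) :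
    A = A' := by
  ext a
  rw [base_eq_sum a]
  simp [h]

/-- Cofactor expansion: replacing one vector of the standard frame. -/
theorem stdVol_update (i : Fin m) (a : Base m) :
    stdVol m (Function.update (stdFrame m) i a) = a i := by
  conv_lhs => rw [base_eq_sum a]
  refine ((stdVol m).toAlternatingMap.toMultilinearMap.map_update_sum Finset.univ i _ _).trans ?_
  change ∑ j, stdVol m (Function.update (stdFrame m) i (a j • stdFrame m j)) = a i
  rw [Finset.sum_eq_single i]
  · rw [ContinuousAlternatingMap.map_update_smul, Function.update_eq_self, stdVol_frame]
    simp
  · intro j _ hj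
    rw [ContinuousAlternatingMap.map_update_smul]
    rw [(stdVol m).map_eq_zero_of_eq _ (i := i) (j := j) _ hj.symm, smul_zero]
    simp [Function.update_of_ne hj]
  · simp

/-- The `m`-th exterior power of `Base m` is a line, and it maps onto that of the range of `A`. No
injectivity of `A` is needed. -/
theorem mem_range_map_iff (A : Base m →ₗ[ℝ] V) (X : ⋀[ℝ]^m V) :
    X ∈ LinearMap.range (exteriorPower.map m (LinearMap.range A).subtype) ↔
      ∃ c : ℝ, X = c • exteriorPower.ιMulti ℝ m (fun i => A (stdFrame m i)) := by
  have key : ∀ Z : Fin m → Base m, exteriorPower.ιMulti ℝ m (fun i => A (Z i)) =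
      stdVol m Z • exteriorPower.ιMulti ℝ m (fun i => A (stdFrame m i)) := fun Z =>
    alternating_base_eq ((exteriorPower.ιMulti ℝ m).compLinearMap A) Z
  constructor
  · rintro ⟨Y, rfl⟩
    obtain ⟨Y', rfl⟩ := exteriorPower.map_surjective (n := m) A.surjective_rangeRestrict Y
    rw [← LinearMap.comp_apply, ← exteriorPower.map_comp]
    have hA : (LinearMap.range A).subtype ∘ₗ A.rangeRestrict = A := by ext; simp
    rw [hA]
    have hY : Y' ∈ Submodule.span ℝ (Set.range (exteriorPower.ιMulti ℝ m (M := Base m))) := by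
      rw [exteriorPower.ιMulti_span]; trivial
    induction hY using Submodule.span_induction with
    | mem x hx =>
      obtain ⟨Z, rfl⟩ := hx
      exact ⟨stdVol m Z, by rw [exteriorPower.map_apply_ιMulti]; exact key Z⟩
    | zero => exact ⟨0, by simp⟩
    | add x y _ _ hx hy =>
      obtain ⟨c, hc⟩ := hx; obtain ⟨d, hd⟩ := hy
      exact ⟨c + d, by rw [map_add, hc, hd, add_smul]⟩
    | smul r x _ hx =>
      obtain ⟨c, hc⟩ := hx
      exact ⟨r * c, by rw [map_smul, hc, smul_smul]⟩
  · rintro ⟨c, rfl⟩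
    refine Submodule.smul_mem _ _ ⟨exteriorPower.ιMulti ℝ m
      (fun i => A.rangeRestrict (stdFrame m i)), ?_⟩
    rw [exteriorPower.map_apply_ιMulti]; rfl

/-- The value of an `m`-form on an `m`-vector. -/
def pair (η : V [⋀^Fin m]→L[ℝ] ℝ) : ⋀[ℝ]^m V →ₗ[ℝ] ℝ :=
  exteriorPower.alternatingMapLinearEquiv η.toAlternatingMap

theorem pair_ιMulti (η : V [⋀^Fin m]→L[ℝ] ℝ) (u : Fin m → V) :
    pair η (exteriorPower.ιMulti ℝ m u) = η u :=
  exteriorPower.alternatingMapLinearEquiv_apply_ιMulti _ _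

theorem contractTop_ne_zero_iff (η : V [⋀^Fin m]→L[ℝ] ℝ) (Y : ⋀[ℝ]^m V) :
    contractTop η Y ≠ 0 ↔ pair η Y ≠ 0 := by
  change (-1 : ℝ) ^ _ * pair η Y ≠ 0 ↔ _
  simp

/-- The sign in `contract` and the factor `c` are both nonzero, so the multivector equation only
depends on the horizontal frame. -/
theorem contract_eq_zero_iff (η : V [⋀^Fin (m + 1)]→L[ℝ] ℝ) (A : Base m →L[ℝ] V) {c : ℝ}
    (hc : c ≠ 0) (u : V) :
    contract η (c • exteriorPower.ιMulti ℝ m (fun i => A (stdFrame m i))) u = 0 ↔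
      η (Fin.cons u fun i => A (stdFrame m i)) = 0 := by
  unfold contract
  rw [map_smul, exteriorPower.alternatingMapLinearEquiv_apply_ιMulti]
  simp only [mul_eq_zero, smul_eq_mul, hc, false_or]
  have : ((-1 : ℝ) ^ (m * (m + 1) / 2)) ≠ 0 := by simp
  simp only [this, false_or]
  rfl

/-- A section is recovered from a nonzero multiple of the wedge of its frame by pairing with
`m`-forms: the pulled back volume form reads off the multiple, and the volume form with one factor
replaced by a functional `f` reads off `f` on one frame vector. Functionals separate points. -/
theorem section_ext_of_mem_range {A A' : Base m →L[ℝ] V} {b : V →L[ℝ] Base m}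
    (hA : b.comp A = ContinuousLinearMap.id ℝ _) (hA' : b.comp A' = ContinuousLinearMap.id ℝ _)
    {X : ⋀[ℝ]^m V} (hX : X ≠ 0)
    (h : X ∈ LinearMap.range (exteriorPower.map m (LinearMap.range (A : Base m →ₗ[ℝ] V)).subtype))
    (h' : X ∈ LinearMap.range
      (exteriorPower.map m (LinearMap.range (A' : Base m →ₗ[ℝ] V)).subtype)) : A = A' := by
  obtain ⟨c, hc⟩ := (mem_range_map_iff _ _).1 h
  obtain ⟨c', hc'⟩ := (mem_range_map_iff _ _).1 h'
  have e1 : ∀ a, b (A a) = a := fun a => DFunLike.congr_fun hA a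
  have e2 : ∀ a, b (A' a) = a := fun a => DFunLike.congr_fun hA' a
  -- The pulled back volume form takes the value 1 on the frame of every section, so it sees the
  -- scale only.
  have hcc : c = c' := by
    have h1 := congrArg (pair ((stdVol m).compContinuousLinearMap b)) (hc.symm.trans hc')
    rw [map_smul, map_smul, pair_ιMulti, pair_ιMulti] at h1
    simpa [Function.comp_def, e1, e2, stdVol_frame] using h1
  have hc0 : c ≠ 0 := by rintro rfl; exact hX (by rw [hc, zero_smul])
  subst hcc
  refine clm_base_ext fun j => ?_
  have key : ∀ f : V →L[ℝ] ℝ, f (A (stdFrame m j)) = f (A' (stdFrame m j)) := by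
    intro f
    -- This is the volume form with its `j`-th factor replaced by `f`: inserting a multiple of the
    -- `j`-th frame vector in slot `i` contributes only for `i = j`.
    have h1 := congrArg (pair (insertOne (stdVol m) b
      (f.smulRight (stdFrame m j)))) (hc.symm.trans hc')
    rw [map_smul, map_smul, pair_ιMulti, pair_ιMulti, insertOne_apply, insertOne_apply] at h1
    have e3 : ∀ B : Base m →L[ℝ] V, (∀ a, b (B a) = a) →
        ∑ i, stdVol m (Function.update (fun k => b (B (stdFrame m k))) i
          (f.smulRight (stdFrame m j) (B (stdFrame m i)))) = f (B (stdFrame m j)) := by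
      intro B hB
      simp only [hB]
      simp only [show (fun k => stdFrame m k) = stdFrame m from rfl, stdVol_update]
      simp [stdFrame, Pi.single_apply]
    have h2 : c * f (A (stdFrame m j)) = c * f (A' (stdFrame m j)) := by
      rw [← e3 A e1, ← e3 A' e2]; exact h1
    exact (mul_right_inj' hc0).1 h2
  by_contra hne
  obtain ⟨f, hf⟩ := SeparatingDual.exists_separating_of_ne (R := ℝ) hne
  exact hf (key f)

theorem map_insertNth_eq_zero_iff (η : V [⋀^Fin (m + 1)]→L[ℝ] ℝ) (p : Fin (m + 1)) (x : V)
    (w : Fin m → V) :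
    η (p.insertNth (α := fun _ => V) x w) = 0 ↔ η (Fin.cons x w) = 0 := by
  have h := η.neg_one_pow_smul_map_insertNth p x w
  change _ = η (Fin.cons x w) at h
  rw [← h, smul_eq_zero]
  simp

theorem map_snoc_eq_zero_iff (η : V [⋀^Fin (m + 1)]→L[ℝ] ℝ) (x : V) (w : Fin m → V) :
    η (Fin.snoc (α := fun _ => V) w x) = 0 ↔ η (Fin.cons x w) = 0 := by
  rw [← map_insertNth_eq_zero_iff η (Fin.last m) x w, Fin.insertNth_last']

/-! ### The jet field and connection equations at a point, for a single form and a single section.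
-/

section Horizontal

variable {η : V [⋀^Fin (m + 1)]→L[ℝ] ℝ} {A : Base m →L[ℝ] V} {b : V →L[ℝ] Base m}

theorem map_cons_horizontal (η : V [⋀^Fin (m + 1)]→L[ℝ] ℝ) (A : Base m →L[ℝ] V) (u : V)
    (Z : Fin m → Base m) :
    η (Fin.cons u fun i => A (Z i)) = stdVol m Z * η (Fin.cons u fun i => A (stdFrame m i)) :=
  alternating_base_eq ((η.toAlternatingMap.curryLeft u).compLinearMap (A : Base m →ₗ[ℝ] V)) Z

/-- All `m + 1` arguments are images of vectors of an `m`-dimensional space, hence the form sees a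
dependent family. -/
theorem map_cons_horizontal_self (η : V [⋀^Fin (m + 1)]→L[ℝ] ℝ) (A : Base m →L[ℝ] V)
    (a : Base m) : η (Fin.cons (A a) fun i => A (stdFrame m i)) = 0 := by
  have : ¬ LinearIndependent ℝ (Fin.cons a (stdFrame m) : Fin (m + 1) → Base m) := by
    intro h
    have := h.fintype_card_le_finrank
    simp at this
  have h2 := (η.toAlternatingMap.compLinearMap (A : Base m →ₗ[ℝ] V)).map_linearDependent _ this
  refine Eq.trans ?_ h2
  change _ = η _
  congr 1
  funext i
  refine Fin.cases rfl (fun j => rfl) i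

/-- Subtracting the horizontal vector `A (b u)` makes `u` vertical without changing the value of the
form. -/
theorem horizontal_eq_iff (hA : b.comp A = ContinuousLinearMap.id ℝ _) :
    (∀ (Z : Fin m → Base m) (u : V),
      η (Fin.snoc (α := fun _ => V) (fun i => A (Z i)) u) = 0) ↔
      ∀ u, b u = 0 → η (Fin.cons u fun i => A (stdFrame m i)) = 0 := by
  have e1 : ∀ a, b (A a) = a := fun a => DFunLike.congr_fun hA a
  constructor
  · intro h u _
    exact (map_snoc_eq_zero_iff _ _ _).1 (h (stdFrame m) u)
  · intro h Z u
    rw [map_snoc_eq_zero_iff, map_cons_horizontal]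
    have hu := h (u - A (b u)) (by simp [e1])
    have : η (Fin.cons u fun i => A (stdFrame m i)) =
        η (Fin.cons (u - A (b u)) fun i => A (stdFrame m i)) +
        η (Fin.cons (A (b u)) fun i => A (stdFrame m i)) := by
      have := η.toAlternatingMap.toMultilinearMap.cons_add (fun i => A (stdFrame m i))
        (u - A (b u)) (A (b u))
      rw [sub_add_cancel] at this
      exact this
    rw [this, hu, map_cons_horizontal_self, add_zero, mul_zero]

theorem horizontal_eq_iff_all (hA : b.comp A = ContinuousLinearMap.id ℝ _) :
    (∀ (Z : Fin m → Base m) (u : V),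
      η (Fin.snoc (α := fun _ => V) (fun i => A (Z i)) u) = 0) ↔
      ∀ u, η (Fin.cons u fun i => A (stdFrame m i)) = 0 := by
  constructor
  · intro h u
    exact (map_snoc_eq_zero_iff _ _ _).1 (h (stdFrame m) u)
  · intro h
    exact (horizontal_eq_iff hA).2 fun u _ => h u

/-- Split every argument into its horizontal and vertical part. Inserting the horizontal projection
acts on the component with `k` horizontal entries as multiplication by `k`. By `h3` and the
dimension of the base only `k = m - 1` and `k = m` can survive, and the equation on the left says
that `k = m` does not. -/
theorem connection_eq_iff (hA : b.comp A = ContinuousLinearMap.id ℝ _)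
    (h3 : ∀ w : Fin (m + 1) → V, ∀ i j k, i ≠ j → i ≠ k → j ≠ k → b (w i) = 0 → b (w j) = 0 →
      b (w k) = 0 → η w = 0) :
    (∀ (Z : Fin m → Base m) (u : V),
      η (Fin.snoc (α := fun _ => V) (fun i => A (Z i)) u) = 0) ↔
    insertOne η (ContinuousLinearMap.id ℝ V) (A.comp b) = ((m : ℝ) - 1) • η := by
  have e1 : ∀ a, b (A a) = a := fun a => DFunLike.congr_fun hA a
  rw [horizontal_eq_iff_all hA]
  constructor
  · intro h
    ext u
    set P : Fin (m + 1) → V := fun i => A (b (u i)) with hP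
    set Q : Fin (m + 1) → V := fun i => u i - A (b (u i)) with hQ
    have hu : u = P + Q := by funext i; simp [hP, hQ]
    -- Here `s` is the set of horizontal places. Either `s.card = m - 1` and the factors agree, or
    -- the component is zero.
    have hT : ∀ s : Finset (Fin (m + 1)), (s.card : ℝ) * η (s.piecewise P Q) =
        ((m : ℝ) - 1) * η (s.piecewise P Q) := by
      intro s
      by_cases hs : s.card + 1 = m
      · have hs' : (m : ℝ) = s.card + 1 := by exact_mod_cast hs.symm
        rw [hs']; ring
      have hc := s.card_compl
      have hle := s.card_le_univ
      rw [Fintype.card_fin] at hc hle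
      suffices h0 : η (s.piecewise P Q) = 0 by simp [h0]
      -- With fewer than `m - 1` horizontal places there are three vertical ones and `h3` applies.
      -- With more, at most one place `p` is vertical, and the remaining entries are horizontal, so
      -- `h` applies.
      rcases lt_or_ge (s.card + 1) m with hlt | hge
      · obtain ⟨i, j, k, hi, hj, hk, hij, hik, hjk⟩ :=
          Finset.two_lt_card_iff.1 (show 2 < (sᶜ).card by omega)
        rw [Finset.mem_compl] at hi hj hk
        refine h3 _ i j k hij hik hjk ?_ ?_ ?_ <;>
          simp [Finset.piecewise_eq_of_notMem, hi, hj, hk, hQ, e1]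
      · have h1 : (sᶜ).card ≤ 1 := by omega
        obtain ⟨p, hp⟩ : ∃ p : Fin (m + 1), sᶜ ⊆ {p} := by
          rw [Finset.card_le_one_iff_subset_singleton] at h1; exact h1
        have hmem : ∀ i, i ≠ p → i ∈ s := by
          intro i hi
          by_contra hi'
          exact hi (Finset.mem_singleton.1 (hp (Finset.mem_compl.2 hi')))
        rw [← Fin.insertNth_self_removeNth p (s.piecewise P Q), map_insertNth_eq_zero_iff]
        have : p.removeNth (s.piecewise P Q) = fun i => A (b (u (p.succAbove i))) := by
          funext i
          change s.piecewise P Q (p.succAbove i) = _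
          rw [Finset.piecewise_eq_of_mem _ _ _ (hmem _ (Fin.succAbove_ne p i))]
        rw [this, map_cons_horizontal, h, mul_zero]
    -- Projecting the `i`-th argument deletes exactly the components in which place `i` is vertical.
    have hi : ∀ i, η (Function.update u i (A (b (u i)))) =
        ∑ s : Finset (Fin (m + 1)), if i ∈ s then η (s.piecewise P Q) else 0 := by
      intro i
      have : Function.update u i (A (b (u i))) = P + Function.update Q i 0 := by
        funext j
        rcases eq_or_ne j i with rfl | hj
        · simp [hP]
        · simp [hj, hP, hQ]
      rw [this]
      refine (η.toAlternatingMap.toMultilinearMap.map_add_univ P _).trans ?_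
      refine Finset.sum_congr rfl fun s _ => ?_
      change η _ = _
      split_ifs with his
      · congr 1
        funext j
        by_cases hj : j ∈ s
        · simp [hj]
        · have : j ≠ i := by rintro rfl; exact hj his
          simp [hj, this]
      · exact η.map_coord_zero i (by simp [his])
    have h1 : insertOne η (ContinuousLinearMap.id ℝ V) (A.comp b) u =
        ∑ i, η (Function.update u i (A (b (u i)))) := by
      rw [insertOne_apply]; rfl
    rw [h1]
    simp only [hi]
    rw [Finset.sum_comm]
    have h2 : η u = ∑ s : Finset (Fin (m + 1)), η (s.piecewise P Q) := by
      rw [hu]; exact η.toAlternatingMap.toMultilinearMap.map_add_univ P Q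
    rw [ContinuousAlternatingMap.smul_apply, h2, smul_eq_mul, Finset.mul_sum]
    refine Finset.sum_congr rfl fun s _ => ?_
    rw [← hT s]
    simp [Finset.sum_ite_mem]
  · intro h u
    -- On `u` followed by the horizontal frame, each of the last `m` slots reproduces the value and
    -- the first slot gives zero, so the equation reads m·η = (m - 1)·η.
    have h1 := DFunLike.congr_fun h (Fin.cons u fun i => A (stdFrame m i))
    rw [insertOne_apply, Fin.sum_univ_succ] at h1
    simp only [ContinuousLinearMap.id_apply, Fin.cons_zero, Fin.cons_succ,
      ContinuousLinearMap.comp_apply, e1, ContinuousAlternatingMap.smul_apply] at h1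
    have h2 : ∀ i : Fin m, Function.update (fun j : Fin (m + 1) =>
        (Fin.cons u (fun i => A (stdFrame m i)) : Fin (m + 1) → V) j) i.succ (A (stdFrame m i)) =
        Fin.cons u fun i => A (stdFrame m i) := by
      intro i
      rw [Function.update_eq_self_iff]; rfl
    have h0 : Function.update (fun j : Fin (m + 1) =>
        (Fin.cons u (fun i => A (stdFrame m i)) : Fin (m + 1) → V) j) 0 (A (b u)) =
        Fin.cons (A (b u)) fun i => A (stdFrame m i) := by
      exact Fin.update_cons_zero _ _ _
    simp only [h2] at h1
    rw [h0, map_cons_horizontal_self] at h1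
    simp only [Finset.sum_const, Finset.card_univ, Fintype.card_fin, nsmul_eq_mul, zero_add,
      smul_eq_mul] at h1
    linarith

end Horizontal

end Multilinear

/-! ### The Poincaré–Cartan form in natural coordinates and its exterior derivative. -/

section Model

variable {m N : ℕ}

variable (m N) in
/-- The inclusion of the jet coordinates `v`. -/
def vertInj : (Base m →L[ℝ] Fib N) →L[ℝ] TJ m N :=
  (ContinuousLinearMap.inr ℝ (Base m) (Fib N × (Base m →L[ℝ] Fib N))).comp
    (ContinuousLinearMap.inr ℝ (Fib N) (Base m →L[ℝ] Fib N))

theorem vertInj_apply (w : Base m →L[ℝ] Fib N) : vertInj m N w = (0, 0, w) := rfl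

/-- `dx^ν ⊗ b`. -/
def slot {G : Type*} [NormedAddCommGroup G] [NormedSpace ℝ G] (ν : Fin m) :
    G →L[ℝ] (Base m →L[ℝ] G) :=
  ContinuousLinearMap.smulRightL ℝ (Base m) G (ContinuousLinearMap.proj ν)

theorem slot_apply {G : Type*} [NormedAddCommGroup G] [NormedSpace ℝ G] (ν : Fin m) (b : G)
    (a : Base m) : slot ν b a = a ν • b := rfl

theorem sum_slot {G : Type*} [NormedAddCommGroup G] [NormedSpace ℝ G] (T : Base m →L[ℝ] G) :
    ∑ ν, slot ν (T (stdFrame m ν)) = T := by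
  ext1 a
  conv_rhs => rw [base_eq_sum a]
  rw [_root_.sum_apply, map_sum]
  exact Finset.sum_congr rfl fun i _ => by rw [slot_apply, map_smul]

/-- The contact forms `dy - v dx` at `q`. -/
def contactForm (q : TJ m N) : TJ m N →L[ℝ] Fib N :=
  (ContinuousLinearMap.fst ℝ (Fib N) (Base m →L[ℝ] Fib N)).comp
      (ContinuousLinearMap.snd ℝ (Base m) (Fib N × (Base m →L[ℝ] Fib N))) -
    q.2.2.comp (ContinuousLinearMap.fst ℝ (Base m) (Fib N × (Base m →L[ℝ] Fib N)))

theorem contactForm_apply (q u : TJ m N) : contactForm q u = u.2.1 - q.2.2 u.1 := rfl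

/-- `u ↦ (∂ℓ/∂v^A_ν (dy^A - v^A_μ dx^μ)(u))_ν`. -/
def modelVert (ℓ : TJ m N → ℝ) (q : TJ m N) : TJ m N →L[ℝ] Base m :=
  ∑ ν, (ContinuousLinearMap.toSpanSingleton ℝ (stdFrame m ν)).comp
    (((fderiv ℝ ℓ q).comp (vertInj m N)).comp ((slot ν).comp (contactForm q)))

theorem modelVert_apply (ℓ : TJ m N → ℝ) (q u : TJ m N) (ν : Fin m) :
    modelVert ℓ q u ν = fderiv ℝ ℓ q (vertInj m N (slot ν (contactForm q u))) := by
  simp [modelVert, _root_.sum_apply, Finset.sum_apply, stdFrame, Pi.single_apply]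

/-- The Poincaré-Cartan form of the Lagrangian `ℓ dx¹ ∧ … ∧ dxᵐ` in natural coordinates. -/
def modelTheta (ℓ : TJ m N → ℝ) (q : TJ m N) : TJ m N [⋀^Fin m]→L[ℝ] ℝ :=
  insertOne (stdVol m) (ContinuousLinearMap.fst ℝ _ _) (modelVert ℓ q) +
    ℓ q • (stdVol m).compContinuousLinearMap (ContinuousLinearMap.fst ℝ _ _)

theorem modelTheta_apply (ℓ : TJ m N → ℝ) (q : TJ m N) (w : Fin m → TJ m N) :
    modelTheta ℓ q w = ∑ i, stdVol m (Function.update (fun j => (w j).1) i (modelVert ℓ q (w i))) +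
      ℓ q * stdVol m (fun j => (w j).1) := by
  change insertOne _ _ _ w + _ = _
  rw [insertOne_apply]
  rfl

variable {ℓ : TJ m N → ℝ} {q : TJ m N}

theorem differentiableAt_contactForm : DifferentiableAt ℝ (contactForm (m := m) (N := N)) q := by
  have h : DifferentiableAt ℝ (fun q : TJ m N => q.2.2) q := by fun_prop
  exact (differentiableAt_const _).sub (h.clm_comp (differentiableAt_const _))

theorem differentiableAt_modelVert (hℓ : ContDiffAt ℝ 2 ℓ q) :
    DifferentiableAt ℝ (modelVert ℓ) q := by
  have h1 : DifferentiableAt ℝ (fderiv ℝ ℓ) q :=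
    (hℓ.fderiv_right (m := 1) (by norm_num)).differentiableAt one_ne_zero
  have h2 := differentiableAt_contactForm (m := m) (N := N) (q := q)
  have h3 : ∀ ν : Fin m, DifferentiableAt ℝ (fun q =>
      (ContinuousLinearMap.toSpanSingleton ℝ (stdFrame m ν)).comp
        (((fderiv ℝ ℓ q).comp (vertInj m N)).comp ((slot ν).comp (contactForm q)))) q := fun ν =>
    (differentiableAt_const _).clm_comp ((h1.clm_comp (differentiableAt_const _)).clm_comp
      ((differentiableAt_const _).clm_comp h2))
  exact DifferentiableAt.fun_sum (𝕜 := ℝ) (E := TJ m N) (F := TJ m N →L[ℝ] Base m)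
    fun ν _ => h3 ν

theorem differentiableAt_modelTheta (hℓ : ContDiffAt ℝ 2 ℓ q) :
    DifferentiableAt ℝ (modelTheta ℓ) q := by
  have h1 := differentiableAt_modelVert hℓ
  -- `insertOne` is linear in the inserted map, and in finite dimension this already gives
  -- continuity, so differentiability passes through it.
  let I : (TJ m N →L[ℝ] Base m) →ₗ[ℝ] (TJ m N [⋀^Fin m]→L[ℝ] ℝ) :=
    { toFun := insertOne (stdVol m) (ContinuousLinearMap.fst ℝ _ _)
      map_add' := insertOne_add _ _
      map_smul' := fun r D => insertOne_smul _ _ D r }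
  have h2 : DifferentiableAt ℝ (fun q => I.toContinuousLinearMap (modelVert ℓ q)) q :=
    DifferentiableAt.comp (𝕜 := ℝ) (E := TJ m N) (F := TJ m N →L[ℝ] Base m)
      (G := TJ m N [⋀^Fin m]→L[ℝ] ℝ) (f := modelVert ℓ) (g := I.toContinuousLinearMap) q
      I.toContinuousLinearMap.differentiableAt h1
  have h3 : DifferentiableAt ℝ (fun q => ℓ q • (stdVol m).compContinuousLinearMap
      (ContinuousLinearMap.fst ℝ (Base m) (Fib N × (Base m →L[ℝ] Fib N)))) q :=
    DifferentiableAt.comp (𝕜 := ℝ) (E := TJ m N) (F := ℝ)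
      (G := TJ m N [⋀^Fin m]→L[ℝ] ℝ) (f := ℓ)
      (g := (LinearMap.toSpanSingleton ℝ _ _).toContinuousLinearMap) q
      (LinearMap.toSpanSingleton ℝ _ _).toContinuousLinearMap.differentiableAt
      (hℓ.differentiableAt (by norm_num))
  exact DifferentiableAt.fun_add (𝕜 := ℝ) (E := TJ m N) (F := TJ m N [⋀^Fin m]→L[ℝ] ℝ) h2 h3

/-- The derivative of `modelVert`. -/
def dModelVert (ℓ : TJ m N → ℝ) (q U w : TJ m N) : Base m := fun ν =>
  fderiv ℝ (fderiv ℝ ℓ) q U (vertInj m N (slot ν (contactForm q w))) -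
    fderiv ℝ ℓ q (vertInj m N (slot ν (U.2.2 w.1)))

/-- Product rule: one term differentiates ∂ℓ/∂v, the other differentiates the coefficient v in the
contact form dy - v dx. Only the value of the derivative at `U` is needed, hence the existential
form. -/
theorem hasFDerivAt_modelVert_apply (hℓ : ContDiffAt ℝ 2 ℓ q) (w U : TJ m N) :
    ∃ D : TJ m N →L[ℝ] Base m, HasFDerivAt (fun q => modelVert ℓ q w) D q ∧
      D U = dModelVert ℓ q U w := by
  have h1 : DifferentiableAt ℝ (fderiv ℝ ℓ) q :=
    (hℓ.fderiv_right (m := 1) (by norm_num)).differentiableAt one_ne_zero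
  let C : TJ m N →L[ℝ] Fib N := - (ContinuousLinearMap.apply ℝ (Fib N) w.1).comp
      ((ContinuousLinearMap.snd ℝ _ _).comp (ContinuousLinearMap.snd ℝ _ _))
  have h2 : HasFDerivAt (fun q : TJ m N => contactForm q w) C q := by
    have : (fun q : TJ m N => contactForm q w) = fun q => w.2.1 + C q := by
      funext q'
      rw [contactForm_apply, sub_eq_add_neg]; rfl
    rw [this]
    exact C.hasFDerivAt.const_add _
  refine ⟨ContinuousLinearMap.pi fun ν => ((fderiv ℝ (fderiv ℝ ℓ) q).flip
      (vertInj m N (slot ν (contactForm q w)))) + (fderiv ℝ ℓ q).comp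
      ((vertInj m N).comp ((slot ν).comp C)), ?_, ?_⟩
  · rw [hasFDerivAt_pi']
    intro ν
    have h3 : HasFDerivAt (fun q : TJ m N => vertInj m N (slot ν (contactForm q w)))
        ((vertInj m N).comp ((slot ν).comp C)) q :=
      ((vertInj m N).comp (slot ν)).hasFDerivAt.comp q h2
    have h4 := h1.hasFDerivAt.clm_apply h3
    have h5 : (fun x => modelVert ℓ x w ν) =
        fun x => fderiv ℝ ℓ x (vertInj m N (slot ν (contactForm x w))) := by
      funext x; exact modelVert_apply _ _ _ _
    rw [h5]
    refine h4.congr_fderiv (ContinuousLinearMap.ext fun u => ?_)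
    exact add_comm _ _
  · funext ν
    simp [dModelVert, C, sub_eq_add_neg]

theorem extDeriv_modelTheta_apply (hℓ : ContDiffAt ℝ 2 ℓ q) (w : Fin (m + 1) → TJ m N) :
    extDeriv (modelTheta ℓ) q w = ∑ k : Fin (m + 1), (-1) ^ (k : ℕ) *
      (∑ i, stdVol m (Function.update (fun j => (k.removeNth w j).1) i
          (dModelVert ℓ q (w k) (k.removeNth w i))) +
        fderiv ℝ ℓ q (w k) * stdVol m (fun j => (k.removeNth w j).1)) := by
  rw [extDeriv_apply (differentiableAt_modelTheta hℓ)]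
  refine Finset.sum_congr rfl fun k _ => ?_
  simp only [zsmul_eq_mul, Int.cast_pow, Int.cast_neg, Int.cast_one]
  congr 1
  set r := k.removeNth w
  simp only [modelTheta_apply]
  have key : ∀ i : Fin m, ∃ D : TJ m N →L[ℝ] ℝ, HasFDerivAt (fun q =>
      stdVol m (Function.update (fun j => (r j).1) i (modelVert ℓ q (r i)))) D q ∧
      D (w k) = stdVol m (Function.update (fun j => (r j).1) i (dModelVert ℓ q (w k) (r i))) := by
    intro i
    obtain ⟨D, hD, hDU⟩ := hasFDerivAt_modelVert_apply hℓ (r i) (w k)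
    -- The form is linear in the `i`-th slot alone, so the derivative can be taken inside that slot.
    let T := (stdVol m).toContinuousMultilinearMap.toContinuousLinearMap (fun j => (r j).1) i
    refine ⟨T.comp D, T.hasFDerivAt.comp q hD, ?_⟩
    change T (D (w k)) = _
    rw [hDU]; rfl
  choose D hD hDw using key
  have h1 : HasFDerivAt ℓ (fderiv ℝ ℓ q) q := (hℓ.differentiableAt (by norm_num)).hasFDerivAt
  rw [((HasFDerivAt.fun_sum fun i _ => hD i).fun_add (h1.mul_const _)).fderiv]
  simp [_root_.sum_apply, hDw, mul_comm]

theorem stdVol_update_eq_zero {u : Fin m → Base m} {i j : Fin m} (hij : j ≠ i) (hj : u j = 0)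
    (x : Base m) : stdVol m (Function.update u i x) = 0 :=
  (stdVol m).map_coord_zero j (by simp [hij, hj])

/-- Each term differentiates along one argument and alters one slot. Of three vertical arguments at
least one is left in an unaltered slot of `stdVol`, where its base component is zero. -/
theorem extDeriv_modelTheta_three_vertical (hℓ : ContDiffAt ℝ 2 ℓ q) (w : Fin (m + 1) → TJ m N)
    {i j k : Fin (m + 1)} (hij : i ≠ j) (hik : i ≠ k) (hjk : j ≠ k)
    (hi : (w i).1 = 0) (hj : (w j).1 = 0) (hk : (w k).1 = 0) :
    extDeriv (modelTheta ℓ) q w = 0 := by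
  rw [extDeriv_modelTheta_apply hℓ]
  refine Finset.sum_eq_zero fun p _ => ?_
  obtain ⟨a, b, hab, ha, hb⟩ : ∃ a b : Fin m, a ≠ b ∧ (p.removeNth w a).1 = 0 ∧
      (p.removeNth w b).1 = 0 := by
    have key : ∀ s t : Fin (m + 1), s ≠ t → s ≠ p → t ≠ p → (w s).1 = 0 → (w t).1 = 0 →
        ∃ a b : Fin m, a ≠ b ∧ (p.removeNth w a).1 = 0 ∧ (p.removeNth w b).1 = 0 := by
      intro s t hst hs ht h1 h2
      obtain ⟨a, rfl⟩ := Fin.exists_succAbove_eq hs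
      obtain ⟨b, rfl⟩ := Fin.exists_succAbove_eq ht
      exact ⟨a, b, fun h => hst (by rw [h]), h1, h2⟩
    by_cases h1 : i = p
    · subst h1; exact key j k hjk hij.symm hik.symm hj hk
    · by_cases h2 : j = p
      · subst h2; exact key i k hik hij hjk.symm hi hk
      · exact key i j hij h1 h2 hi hj
  have h0 : stdVol m (fun j => (p.removeNth w j).1) = 0 := (stdVol m).map_coord_zero a ha
  rw [h0, mul_zero, add_zero, Finset.sum_eq_zero, mul_zero]
  intro l _
  by_cases hl : a = l
  · subst hl; exact stdVol_update_eq_zero hab.symm hb _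
  · exact stdVol_update_eq_zero hl ha _

/-- In the terms that differentiate along some `w j`, the vertical `u` stays among the arguments of
`stdVol` and makes them vanish unless `u` occupies the altered slot. This leaves one insertion for
each `j`. -/
theorem extDeriv_modelTheta_cons (hℓ : ContDiffAt ℝ 2 ℓ q) (u : TJ m N) (hu : u.1 = 0)
    (w : Fin m → TJ m N) :
    extDeriv (modelTheta ℓ) q (Fin.cons u w) =
      ∑ i, stdVol m (Function.update (fun j => (w j).1) i (dModelVert ℓ q u (w i))) +
        fderiv ℝ ℓ q u * stdVol m (fun j => (w j).1) -
      ∑ j, stdVol m (Function.update (fun j => (w j).1) j (dModelVert ℓ q (w j) u)) := by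
  rw [extDeriv_modelTheta_apply hℓ, Fin.sum_univ_succ, sub_eq_add_neg, ← Finset.sum_neg_distrib]
  congr 1
  · simp
  refine Finset.sum_congr rfl fun j _ => ?_
  obtain ⟨n, rfl⟩ : ∃ n, m = n + 1 := ⟨m - 1, by have := j.pos; omega⟩
  have h0 : (j.succ.removeNth (Fin.cons u w : Fin (n + 2) → TJ (n + 1) N) 0) = u := by
    simp [Fin.removeNth]
  have hz : stdVol (n + 1) (fun i => (j.succ.removeNth
      (Fin.cons u w : Fin (n + 2) → TJ (n + 1) N) i).1) = 0 :=
    (stdVol (n + 1)).map_coord_zero 0 (by simp only [h0, hu])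
  rw [hz, mul_zero, add_zero, Finset.sum_eq_single 0]
  · rw [h0]
    simp only [Fin.cons_succ]
    set x := dModelVert ℓ q (w j) u
    -- Moving the first entry to place `j` costs the sign of exponent `j`. Together with the
    -- exponent `j + 1` from the exterior derivative it leaves the minus sign of the statement.
    have h2 := (stdVol (n + 1)).neg_one_pow_smul_map_insertNth j x
      (j.removeNth fun i => (w i).1)
    rw [Fin.insertNth_removeNth] at h2
    have h3 : Function.update (fun i => (j.succ.removeNth
      (Fin.cons u w : Fin (n + 2) → TJ (n + 1) N) i).1) 0 x =
        Matrix.vecCons x (j.removeNth fun i => (w i).1) := by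
      funext i
      refine Fin.cases ?_ (fun i => ?_) i
      · simp
      · simp [Fin.removeNth]
    rw [h3, ← h2]
    simp only [zsmul_eq_mul, Int.cast_pow, Int.cast_neg, Int.cast_one]
    rw [← mul_assoc, ← pow_add]
    rw [Fin.val_succ, show (j : ℕ) + 1 + j = 2 * j + 1 by ring, pow_succ, pow_mul]
    simp
  · intro l _ hl
    exact stdVol_update_eq_zero hl.symm (by simp only [h0, hu]) _
  · simp

/-- On the standard frame every determinant with one altered slot reduces to one component, and the
components reassemble through `sum_slot`. The contact form of a lift is F - v, and the two
occurrences of ∂ℓ/∂v in direction `w` cancel, so `w` survives only in the Hessian term. -/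
theorem extDeriv_modelTheta_horizontal (hℓ : ContDiffAt ℝ 2 ℓ q) (K : Base m →L[ℝ]
      Fib N × (Base m →L[ℝ] Fib N)) (b : Fib N) (w : Base m →L[ℝ] Fib N) :
    extDeriv (modelTheta ℓ) q (Fin.cons (0, b, w) fun i => (stdFrame m i, K (stdFrame m i))) =
      fderiv ℝ (fderiv ℝ ℓ) q (0, b, w) (vertInj m N
        ((ContinuousLinearMap.fst ℝ _ _).comp K - q.2.2)) + fderiv ℝ ℓ q (0, b, 0) -
      ∑ μ, fderiv ℝ (fderiv ℝ ℓ) q (stdFrame m μ, K (stdFrame m μ)) (vertInj m N (slot μ b)) := by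
  rw [extDeriv_modelTheta_cons hℓ _ rfl]
  congr 1
  · change ∑ i, stdVol m (Function.update (stdFrame m) i _) + _ * stdVol m (stdFrame m) = _
    simp only [stdVol_update, stdVol_frame, mul_one, dModelVert, contactForm_apply,
      Finset.sum_sub_distrib]
    rw [← map_sum, ← map_sum, ← map_sum, ← map_sum]
    rw [sum_slot w]
    have := sum_slot ((ContinuousLinearMap.fst ℝ _ _).comp K - q.2.2)
    simp only [_root_.sub_apply, ContinuousLinearMap.comp_apply,
      ContinuousLinearMap.coe_fst'] at this
    rw [this]
    have h2 : ((0, b, w) : TJ m N) = (0, b, 0) + vertInj m N w := by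
      simp [vertInj_apply]
    have h3 : fderiv ℝ ℓ q (0, b, w) = fderiv ℝ ℓ q (0, b, 0) + fderiv ℝ ℓ q (vertInj m N w) := by
      rw [← map_add, ← h2]
    rw [h3]; ring
  · refine Finset.sum_congr rfl fun μ _ => ?_
    change stdVol m (Function.update (stdFrame m) μ _) = _
    rw [stdVol_update]
    simp [dModelVert, contactForm_apply]

/-- The Euler-Lagrange equations for the slopes `K` of a jet of sections of `J¹E → M`, together
with the holonomy condition. -/
def EulerLagrange (ℓ : TJ m N → ℝ) (q : TJ m N)
    (K : Base m →L[ℝ] Fib N × (Base m →L[ℝ] Fib N)) : Prop :=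
  (ContinuousLinearMap.fst ℝ _ _).comp K = q.2.2 ∧
  ∀ b, ∑ μ, fderiv ℝ (fderiv ℝ ℓ) q (stdFrame m μ, K (stdFrame m μ)) (vertInj m N (slot μ b)) =
    fderiv ℝ ℓ q (0, b, 0)

/-- Nondegeneracy of the Hessian with respect to `v`. -/
def HessNondeg (ℓ : TJ m N → ℝ) (q : TJ m N) : Prop :=
  ∀ t, (∀ w, fderiv ℝ (fderiv ℝ ℓ) q (vertInj m N t) (vertInj m N w) = 0) → t = 0

theorem hess_symm (hℓ : ContDiffAt ℝ 2 ℓ q) (u w : TJ m N) :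
    fderiv ℝ (fderiv ℝ ℓ) q u w = fderiv ℝ (fderiv ℝ ℓ) q w u :=
  (hℓ.isSymmSndFDerivAt (by simp)) u w

/-- The directions `w` pair F - v with the Hessian, and nondegeneracy forces F = v. The term with F
- v then disappears for all `b`, and what is left are the Euler–Lagrange equations. -/
theorem eulerLagrange_iff (hℓ : ContDiffAt ℝ 2 ℓ q) (hn : HessNondeg ℓ q)
    (K : Base m →L[ℝ] Fib N × (Base m →L[ℝ] Fib N)) :
    (∀ u : TJ m N, u.1 = 0 → extDeriv (modelTheta ℓ) q
      (Fin.cons u fun i => (stdFrame m i, K (stdFrame m i))) = 0) ↔ EulerLagrange ℓ q K := by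
  constructor
  · intro h
    have hF : (ContinuousLinearMap.fst ℝ _ _).comp K = q.2.2 := by
      rw [← sub_eq_zero]
      refine hn _ fun w => ?_
      have := h (0, 0, w) rfl
      rw [extDeriv_modelTheta_horizontal hℓ] at this
      rw [hess_symm hℓ]
      have h0 : ((0, 0, 0) : TJ m N) = 0 := rfl
      simpa [vertInj_apply, h0] using this
    refine ⟨hF, fun b => ?_⟩
    have := h (0, b, 0) rfl
    rw [extDeriv_modelTheta_horizontal hℓ, hF, sub_self, map_zero, map_zero, zero_add,
      sub_eq_zero] at this
    exact this.symm
  · rintro ⟨hF, hE⟩ ⟨a, b, w⟩ hu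
    obtain rfl : a = 0 := hu
    rw [extDeriv_modelTheta_horizontal hℓ, hF, sub_self, map_zero, map_zero, zero_add, hE,
      sub_self]

/-- A vector in the kernel of the Hessian contracts dΘ to zero, so `1`-nondegeneracy of Ω implies
that of the Hessian. The contact form vanishes on fibre directions of the jet bundle; the remaining
two terms cancel by the trace identity `h3`. -/
theorem extDeriv_modelTheta_of_hess_eq_zero (hℓ : ContDiffAt ℝ 2 ℓ q) {t : Base m →L[ℝ] Fib N}
    (ht : ∀ w, fderiv ℝ (fderiv ℝ ℓ) q (vertInj m N t) (vertInj m N w) = 0)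
    (w : Fin m → TJ m N) : extDeriv (modelTheta ℓ) q (Fin.cons (vertInj m N t) w) = 0 := by
  rw [extDeriv_modelTheta_cons hℓ _ rfl]
  have h1 : ∀ u, dModelVert ℓ q u (vertInj m N t) = 0 := by
    intro u; funext ν
    have h0 : ((0, 0, 0) : TJ m N) = 0 := rfl
    simp [dModelVert, contactForm_apply, vertInj_apply, h0]
  let T : Base m →L[ℝ] Base m := ContinuousLinearMap.pi fun ν =>
    (fderiv ℝ ℓ q).comp ((vertInj m N).comp ((slot ν).comp t))
  have h2 : ∀ u, dModelVert ℓ q (vertInj m N t) u = - T u.1 := by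
    intro u; funext ν
    simp only [dModelVert, ht, zero_sub]
    rfl
  -- The determinant is acted on by `T`, slot by slot, through multiplication with the trace of `T`,
  -- and that trace is the derivative of ℓ along `t`.
  have h3 : ∑ i, stdVol m (Function.update (fun j => (w j).1) i (T (w i).1)) =
      fderiv ℝ ℓ q (vertInj m N t) * stdVol m (fun j => (w j).1) := by
    have h4 := congrArg (fun η => η (fun j => (w j).1))
      (eq_smul_stdVol (insertOne (stdVol m) (ContinuousLinearMap.id ℝ _) T))
    simp only [insertOne_apply, ContinuousAlternatingMap.smul_apply, smul_eq_mul] at h4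
    refine h4.trans ?_
    congr 1
    change ∑ i, stdVol m (Function.update (stdFrame m) i _) = _
    simp only [stdVol_update]
    change ∑ i, fderiv ℝ ℓ q (vertInj m N (slot i (t (stdFrame m i)))) = _
    rw [← map_sum, ← map_sum, sum_slot]
  have h5 : ∀ i, stdVol m (Function.update (fun j => (w j).1) i (- T (w i).1)) =
      - stdVol m (Function.update (fun j => (w j).1) i (T (w i).1)) := fun i =>
    (stdVol m).map_update_neg _ _ _
  have h6 : ∀ i, stdVol m (Function.update (fun j => (w j).1) i 0) = 0 := fun i =>
    (stdVol m).map_update_zero _ _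
  simp only [h1, h2, h5, h6, Finset.sum_neg_distrib, h3, Finset.sum_const_zero]
  ring

end Model

theorem two_le_infty : (2 : WithTop ℕ∞) ≤ ∞ := by
  exact (WithTop.coe_le_coe.2 le_top : ((2 : ℕ∞) : WithTop ℕ∞) ≤ ((⊤ : ℕ∞) : WithTop ℕ∞))

theorem hasFDerivAt_fderiv_of_contDiffAt {V G : Type*} [NormedAddCommGroup V] [NormedSpace ℝ V]
    [NormedAddCommGroup G] [NormedSpace ℝ G] {f : V → G} {q : V} (hf : ContDiffAt ℝ ∞ f q) :
    HasFDerivAt (fderiv ℝ f) (fderiv ℝ (fderiv ℝ f) q) q :=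
  (((hf.of_le two_le_infty).fderiv_right (m := 1) (by norm_num)).differentiableAt
    one_ne_zero).hasFDerivAt


/-! ### Tangent maps of adapted charts, evaluated on vectors. -/

section Coordinates

variable {B F : Type*} [NormedAddCommGroup B] [NormedSpace ℝ B]
  [NormedAddCommGroup F] [NormedSpace ℝ F]
  {M E : Type*} [TopologicalSpace M] [ChartedSpace B M]
  [TopologicalSpace E] [ChartedSpace (B × F) E] {π : E → M}

namespace AdaptedChart

theorem dbase_dbaseSymm_apply (c : AdaptedChart B F π) {x : M} (hx : x ∈ c.base.source) (a : B) :
    c.dbase x (c.dbaseSymm (c.base x) a) = a := by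
  have h := c.dbase_dbaseSymm (c.base.map_source hx)
  rw [c.base.left_inv hx] at h
  exact DFunLike.congr_fun h a

theorem dbaseSymm_dbase_apply (c : AdaptedChart B F π) {x : M} (hx : x ∈ c.base.source) (a : B) :
    c.dbaseSymm (c.base x) (c.dbase x a) = a :=
  DFunLike.congr_fun (c.dbaseSymm_dbase hx) a

theorem dtot_dtotSymm_apply (c : AdaptedChart B F π) {y : E} (hy : y ∈ c.tot.source) (a : B × F) :
    c.dtot y (c.dtotSymm (c.tot y) a) = a := by
  have h := c.dtot_dtotSymm (c.tot.map_source hy)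
  rw [c.tot.left_inv hy] at h
  exact DFunLike.congr_fun h a

theorem dtotSymm_dtot_apply (c : AdaptedChart B F π) {y : E} (hy : y ∈ c.tot.source) (a : B × F) :
    c.dtotSymm (c.tot y) (c.dtot y a) = a :=
  DFunLike.congr_fun (c.dtotSymm_dtot hy) a

theorem dtot_fst (c : AdaptedChart B F π) {y : E} (hy : y ∈ c.tot.source) (u : B × F) :
    (c.dtot y u).1 = c.dbase (π y) (dproj B F π y u) :=
  (DFunLike.congr_fun (c.dbase_comp_dproj hy) u).symm

theorem dtot_lin (c : AdaptedChart B F π) {z : J1 B F π} (hz : z.pt ∈ c.tot.source) (a : B) :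
    c.dtot z.pt (z.lin a) = (c.dbase (π z.pt) a, c.coordV z (c.dbase (π z.pt) a)) := by
  rw [← c.slope_coordV hz]
  exact c.dtot_dtotSymm_apply hz _

theorem coordV_injective (c : AdaptedChart B F π) {y : E} (hy : y ∈ c.tot.source)
    {j j' : JetAt B F π y} (h : c.coordV ⟨y, j⟩ = c.coordV ⟨y, j'⟩) : j = j' := by
  have h1 := c.slope_coordV (z := ⟨y, j⟩) hy
  have h2 := c.slope_coordV (z := ⟨y, j'⟩) hy
  rw [h] at h1
  exact JetAt.ext (h1.symm.trans h2)

end AdaptedChart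

end Coordinates

/-! ### The intrinsic objects of the jet bundle in natural coordinates. -/

section JetCoordinates

variable {m N : ℕ} {M E : Type*} [TopologicalSpace M] [ChartedSpace (Base m) M]
  [TopologicalSpace E] [ChartedSpace (Base m × Fib N) E]
  {π : E → M} [FibredManifold (Base m) (Fib N) π] (c : AdaptedChart (Base m) (Fib N) π)
  {z : J1 (Base m) (Fib N) π}

namespace AdaptedChart

theorem nat_apply (z : J1 (Base m) (Fib N) π) :
    c.nat z = ((c.tot z.pt).1, (c.tot z.pt).2, c.coordV z) := rfl

theorem mem_nat_source : z ∈ c.nat.source ↔ z.pt ∈ c.tot.source := Iff.rfl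

theorem dbase_dbar (hz : z ∈ c.nat.source) (u : TJ m N) :
    c.dbase (π z.pt) (dbar z u) = (c.prolong.dtot z u).1 :=
  (c.prolong.dtot_fst hz u).symm

theorem dtot_dpt (hz : z ∈ c.nat.source) (u : TJ m N) :
    c.dtot z.pt (dpt z u) = ((c.prolong.dtot z u).1, (c.prolong.dtot z u).2.1) := by
  have hpt : MDifferentiableAt 𝓘(ℝ, TJ m N) 𝓘(ℝ, Base m × Fib N)
      (J1.pt : J1 (Base m) (Fib N) π → E) z := contMDiff_pt.mdifferentiable (by simp) z
  have h1 := mfderiv_comp z (c.mdiff_tot hz) hpt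
  let T : TJ m N →L[ℝ] Base m × Fib N := (ContinuousLinearMap.fst ℝ _ _).prod
    ((ContinuousLinearMap.fst ℝ _ _).comp (ContinuousLinearMap.snd ℝ _ _))
  have h2 := mfderiv_comp (I := 𝓘(ℝ, TJ m N)) (I' := 𝓘(ℝ, TJ m N)) (I'' := 𝓘(ℝ, Base m × Fib N)) z
    (g := T) (f := c.nat) T.differentiableAt.mdifferentiableAt (c.prolong.mdiff_tot hz)
  have h3 : mfderiv 𝓘(ℝ, TJ m N) 𝓘(ℝ, Base m × Fib N) T (c.nat z) = T := by
    rw [mfderiv_eq_fderiv]; exact T.fderiv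
  rw [h3] at h2
  have h4 : (c.tot ∘ J1.pt) = (T ∘ c.nat) := rfl
  rw [h4] at h1
  exact DFunLike.congr_fun (h1.symm.trans h2) u

theorem dtot_theta (hz : z ∈ c.nat.source) (u : TJ m N) :
    c.dtot z.pt (theta z u) = (0, contactForm (c.nat z) (c.prolong.dtot z u)) := by
  change c.dtot z.pt (dpt z u - z.lin (dbar z u)) = _
  rw [map_sub, c.dtot_dpt hz, c.dtot_lin hz, c.dbase_dbar hz]
  simp [contactForm_apply, nat_apply]

/-- The coordinates of a vertical vector of `E`. -/
def vertCoord (y : E) : Vert m N π y →L[ℝ] Fib N :=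
  (ContinuousLinearMap.snd ℝ _ _).comp ((c.dtot y).comp (Vert.incl y))

/-- The coordinates of an element of `T*_x M ⊗ V_y(π)`. -/
def homCoord (y : E) : VertHom m N π y →L[ℝ] (Base m →L[ℝ] Fib N) :=
  (ContinuousLinearMap.compL ℝ (Base m) (Vert m N π y) (Fib N) (c.vertCoord y)).comp
    ((ContinuousLinearMap.compL ℝ (Base m) (Base m) (Vert m N π y)).flip
      (c.dbaseSymm (c.base (π y))))

theorem homCoord_apply (y : E) (t : VertHom m N π y) (a : Base m) :
    c.homCoord y t a = c.vertCoord y (t (c.dbaseSymm (c.base (π y)) a)) := rfl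

/-- Every coordinate variation of the slope comes from an intrinsic one. This allows nondegeneracy
of `fibreHessian` to be tested in coordinates. -/
theorem homCoord_surjective {y : E} (hy : y ∈ c.tot.source) (w : Base m →L[ℝ] Fib N) :
    ∃ t, c.homCoord y t = w := by
  have h1 : ∀ b : Fib N, dproj (Base m) (Fib N) π y (c.dtotSymm (c.tot y) (0, b)) = 0 := by
    intro b
    have h := c.dtot_fst hy (c.dtotSymm (c.tot y) (0, b))
    rw [c.dtot_dtotSymm_apply hy] at h
    have h2 := congrArg (c.dbaseSymm (c.base (π y))) h
    rw [c.dbaseSymm_dbase_apply (c.mapsTo y hy)] at h2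
    simpa using h2.symm
  let S : Fib N →L[ℝ] Vert m N π y :=
    ((c.dtotSymm (c.tot y)).comp (ContinuousLinearMap.inr ℝ (Base m) (Fib N))).codRestrict
      (LinearMap.ker (dproj (Base m) (Fib N) π y : Base m × Fib N →ₗ[ℝ] Base m)) h1
  refine ⟨S.comp (w.comp (c.dbase (π y))), ?_⟩
  ext1 a
  rw [homCoord_apply]
  change (c.dtot y (c.dtotSymm (c.tot y) (0, w (c.dbase (π y) _)))).2 = _
  rw [c.dtot_dtotSymm_apply hy, c.dbase_dbaseSymm_apply (c.mapsTo y hy)]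

/-- The slope coordinates are affine on the fibres of the jet bundle, which turns fibre derivatives
into ordinary derivatives in the v-directions. -/
theorem nat_translate (t : VertHom m N π z.pt) :
    c.nat (translate z t) = c.nat z + vertInj m N (c.homCoord z.pt t) := by
  refine Prod.ext ?_ (Prod.ext ?_ ?_)
  · simp [nat_apply, vertInj_apply, translate]
  · simp [nat_apply, vertInj_apply, translate]
  · change c.coordV (translate z t) = c.coordV z + c.homCoord z.pt t
    ext1 a
    have h : (translate z t).lin = z.lin + (Vert.incl z.pt).comp t := rfl
    simp only [coordV, h]
    simp [translate, homCoord, vertCoord, ContinuousLinearMap.compL]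

/-- The coordinate expression of a function on the jet bundle. -/
def coordFun (L : J1 (Base m) (Fib N) π → ℝ) : TJ m N → ℝ := L ∘ c.nat.symm

variable {L : J1 (Base m) (Fib N) π → ℝ}

theorem contDiffOn_coordFun (hL : ContMDiff 𝓘(ℝ, TJ m N) 𝓘(ℝ, ℝ) ∞ L) :
    ContDiffOn ℝ ∞ (c.coordFun L) c.nat.target := by
  rw [← contMDiffOn_iff_contDiffOn]
  exact hL.comp_contMDiffOn (contMDiffOn_symm_of_mem_maximalAtlas c.nat_mem)

theorem contDiffAt_coordFun (hL : ContMDiff 𝓘(ℝ, TJ m N) 𝓘(ℝ, ℝ) ∞ L) {q : TJ m N}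
    (hq : q ∈ c.nat.target) : ContDiffAt ℝ ∞ (c.coordFun L) q :=
  (c.contDiffOn_coordFun hL).contDiffAt (c.nat.open_target.mem_nhds hq)

/-- The equality holds for all translations and not only for small ones, because the domain of a
natural chart contains whole fibres. -/
theorem apply_translate (hz : z ∈ c.nat.source) :
    (fun t => L (translate z t)) =
      fun t => c.coordFun L (c.nat z + vertInj m N (c.homCoord z.pt t)) := by
  funext t
  rw [← c.nat_translate, coordFun, Function.comp, c.nat.left_inv]
  exact hz

theorem hasFDerivAt_apply_translate (hL : ContMDiff 𝓘(ℝ, TJ m N) 𝓘(ℝ, ℝ) ∞ L)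
    (hz : z ∈ c.nat.source) (t : VertHom m N π z.pt) :
    HasFDerivAt (fun t => L (translate z t))
      ((fderiv ℝ (c.coordFun L) (c.nat z + vertInj m N (c.homCoord z.pt t))).comp
        ((vertInj m N).comp (c.homCoord z.pt))) t := by
  rw [c.apply_translate hz]
  have hm : c.nat z + vertInj m N (c.homCoord z.pt t) ∈ c.nat.target := by
    rw [← c.nat_translate]
    exact c.nat.map_source hz
  have h1 := ((c.contDiffAt_coordFun hL hm).differentiableAt (by simp)).hasFDerivAt
  exact h1.comp t ((((vertInj m N).comp (c.homCoord z.pt)).hasFDerivAt).const_add _)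

theorem fibreDeriv_eq (hL : ContMDiff 𝓘(ℝ, TJ m N) 𝓘(ℝ, ℝ) ∞ L) (hz : z ∈ c.nat.source)
    (t : VertHom m N π z.pt) : fibreDeriv L z t =
      fderiv ℝ (c.coordFun L) (c.nat z) (vertInj m N (c.homCoord z.pt t)) := by
  have h := (c.hasFDerivAt_apply_translate hL hz 0).fderiv
  simp only [map_zero, add_zero] at h
  exact DFunLike.congr_fun h t

theorem fibreHessian_eq (hL : ContMDiff 𝓘(ℝ, TJ m N) 𝓘(ℝ, ℝ) ∞ L) (hz : z ∈ c.nat.source)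
    (t s : VertHom m N π z.pt) : fibreHessian L z t s =
      fderiv ℝ (fderiv ℝ (c.coordFun L)) (c.nat z) (vertInj m N (c.homCoord z.pt t))
        (vertInj m N (c.homCoord z.pt s)) := by
  let T := (vertInj m N).comp (c.homCoord z.pt)
  have h : fderiv ℝ (fun t => L (translate z t)) =
      fun t => (fderiv ℝ (c.coordFun L) (c.nat z + T t)).comp T :=
    funext fun t => (c.hasFDerivAt_apply_translate hL hz t).fderiv
  have h1 : HasFDerivAt (fderiv ℝ (c.coordFun L)) (fderiv ℝ (fderiv ℝ (c.coordFun L)) (c.nat z))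
      (c.nat z + T 0) := by
    rw [map_zero, add_zero]
    exact hasFDerivAt_fderiv_of_contDiffAt (c.contDiffAt_coordFun hL (c.nat.map_source hz))
  have h0 : HasFDerivAt (fun t => fderiv ℝ (c.coordFun L) (c.nat z + T t))
      ((fderiv ℝ (fderiv ℝ (c.coordFun L)) (c.nat z)).comp T) 0 :=
    HasFDerivAt.comp (𝕜 := ℝ) (g := fderiv ℝ (c.coordFun L)) 0 h1
      (T.hasFDerivAt.const_add (c.nat z))
  have h2 := h0.clm_comp (hasFDerivAt_const T _)
  have h3 : fibreHessian L z = _ := (congrArg (fun f => fderiv ℝ f 0) h).trans h2.fderiv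
  rw [h3]
  simp [T]

theorem dbase_vertEndL (hL : ContMDiff 𝓘(ℝ, TJ m N) 𝓘(ℝ, ℝ) ∞ L) (hz : z ∈ c.nat.source)
    (u : TJ m N) : c.dbase (π z.pt) (vertEndL L z u) =
      modelVert (c.coordFun L) (c.nat z) (c.prolong.dtot z u) := by
  funext μ
  rw [modelVert_apply]
  have h1 : ∀ ν, vertEndL L z u ν = fibreDeriv L z (slot ν (thetaVert z u)) := fun ν => rfl
  rw [base_eq_sum (vertEndL L z u), map_sum]
  simp only [map_smul, Finset.sum_apply, Pi.smul_apply, h1, smul_eq_mul]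
  -- `vertEndL` is written with the standard coordinates of the tangent space, not with those of the
  -- chart. The Jacobian entries combine its covectors into the `μ`-th coordinate covector of the
  -- chart.
  have h2 : ∑ ν, fibreDeriv L z (slot ν (thetaVert z u)) * c.dbase (π z.pt) (stdFrame m ν) μ =
      fibreDeriv L z (∑ ν, c.dbase (π z.pt) (stdFrame m ν) μ • slot ν (thetaVert z u)) := by
    rw [map_sum]
    exact Finset.sum_congr rfl fun ν _ => by rw [map_smul, smul_eq_mul, mul_comm]
  rw [h2, c.fibreDeriv_eq hL hz]
  congr 2
  ext1 a
  rw [homCoord_apply, slot_apply]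
  have h3 : c.vertCoord z.pt (thetaVert z u) =
      contactForm (c.nat z) (c.prolong.dtot z u) :=
    congrArg Prod.snd (c.dtot_theta hz u)
  set a' := c.dbaseSymm (c.base (π z.pt)) a with ha'
  have h4 : (∑ ν, c.dbase (π z.pt) (stdFrame m ν) μ • slot ν (thetaVert z u)) a' =
      (c.dbase (π z.pt) a') μ • thetaVert z u := by
    conv_rhs => rw [base_eq_sum a']
    simp [_root_.sum_apply, slot_apply, Finset.sum_smul, smul_smul, mul_comm]
  rw [h4, map_smul, h3, ha', c.dbase_dbaseSymm_apply (c.mapsTo _ hz)]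

/-- The density of a volume form in an adapted chart. -/
def density (vol : M → Base m [⋀^Fin m]→L[ℝ] ℝ) (x : Base m) : ℝ :=
  vol (c.base.symm x) (fun i => c.dbaseSymm x (stdFrame m i))

variable {vol : M → Base m [⋀^Fin m]→L[ℝ] ℝ}

theorem vol_apply {x : M} (hx : x ∈ c.base.source) (Z : Fin m → Base m) :
    vol x Z = c.density vol (c.base x) * stdVol m (fun i => c.dbase x (Z i)) := by
  have h := alternating_base_eq ((vol x).toAlternatingMap.compLinearMap
    (c.dbaseSymm (c.base x) : Base m →ₗ[ℝ] Base m)) (fun i => c.dbase x (Z i))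
  have h1 : vol x (fun i => c.dbaseSymm (c.base x) (c.dbase x (Z i))) =
      stdVol m (fun i => c.dbase x (Z i)) *
        vol x (fun i => c.dbaseSymm (c.base x) (stdFrame m i)) := h
  simp only [c.dbaseSymm_dbase_apply hx] at h1
  rw [density, c.base.left_inv hx, mul_comm]
  exact h1

theorem density_mul_ne_zero (hvol : ∀ x, vol x ≠ 0) {x : M} (hx : x ∈ c.base.source) :
    c.density vol (c.base x) * stdVol m (fun i => c.dbase x (stdFrame m i)) ≠ 0 := by
  rw [← c.vol_apply hx]
  exact apply_stdFrame_ne_zero (hvol x)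

theorem stdVol_dbase_ne_zero (hvol : ∀ x, vol x ≠ 0) {x : M} (hx : x ∈ c.base.source) :
    stdVol m (fun i => c.dbase x (stdFrame m i)) ≠ 0 :=
  right_ne_zero_of_mul (c.density_mul_ne_zero hvol hx)

theorem density_ne_zero (hvol : ∀ x, vol x ≠ 0) {q : Base m} (hq : q ∈ c.base.target) :
    c.density vol q ≠ 0 := by
  have h := left_ne_zero_of_mul (c.density_mul_ne_zero hvol (c.base.map_target hq))
  rwa [c.base.right_inv hq] at h

/-- `SmoothForm` speaks of preferred charts only, whereas the chart `c.base` is arbitrary. Near each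
point the density is the component in a preferred chart times the Jacobian determinant of the change
of charts. -/
theorem contDiffOn_density [IsManifold 𝓘(ℝ, Base m) ∞ M] (hvol : SmoothForm vol) :
    ContDiffOn ℝ ∞ (c.density vol) c.base.target := by
  intro b hb
  refine ContDiffAt.contDiffWithinAt ?_
  set e := chartAt (Base m) (c.base.symm b) with he
  have hemem : e ∈ IsManifold.maximalAtlas 𝓘(ℝ, Base m) ∞ M :=
    IsManifold.chart_mem_maximalAtlas _
  set g : Base m → Base m := e ∘ c.base.symm with hg
  have hO : IsOpen (c.base.symm.trans e).source := (c.base.symm.trans e).open_source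
  have hbO : b ∈ (c.base.symm.trans e).source := by
    rw [OpenPartialHomeomorph.trans_source]
    exact ⟨hb, mem_chart_source _ _⟩
  have hgs : ContDiffOn ℝ ∞ g (c.base.symm.trans e).source := by
    rw [← contMDiffOn_iff_contDiffOn]
    refine (contMDiffOn_of_mem_maximalAtlas hemem).comp
      ((contMDiffOn_symm_of_mem_maximalAtlas c.base_mem).mono ?_) ?_
    · intro q hq; rw [OpenPartialHomeomorph.trans_source] at hq; exact hq.1
    · intro q hq; rw [OpenPartialHomeomorph.trans_source] at hq; exact hq.2
  have hgat : ContDiffAt ℝ ∞ g b := hgs.contDiffAt (hO.mem_nhds hbO)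
  have hev : c.density vol =ᶠ[𝓝 b] fun b' =>
      formInChart vol (c.base.symm b) (g b') (stdFrame m) *
        stdVol m (fun i => fderiv ℝ g b' (stdFrame m i)) := by
    filter_upwards [hO.mem_nhds hbO] with b' hb'
    rw [OpenPartialHomeomorph.trans_source] at hb'
    have hs : c.base.symm b' ∈ e.source := hb'.2
    have h1 : c.dbaseSymm b' = (show Base m →L[ℝ] Base m from
        mfderiv 𝓘(ℝ, Base m) 𝓘(ℝ, Base m) e.symm (g b')).comp (fderiv ℝ g b') := by
      have hgd : MDifferentiableAt 𝓘(ℝ, Base m) 𝓘(ℝ, Base m) g b' :=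
        ((hgs.contDiffAt (hO.mem_nhds (by
          rw [OpenPartialHomeomorph.trans_source]; exact hb'))).differentiableAt
            (by simp)).mdifferentiableAt
      have hed : MDifferentiableAt 𝓘(ℝ, Base m) 𝓘(ℝ, Base m) e.symm (g b') :=
        (contMDiffAt_symm_of_mem_maximalAtlas hemem (e.map_source hs)).mdifferentiableAt (by simp)
      have h2 := mfderiv_comp b' hed hgd
      have h3 : (e.symm ∘ g) =ᶠ[𝓝 b'] c.base.symm := by
        filter_upwards [hO.mem_nhds (by
          rw [OpenPartialHomeomorph.trans_source]; exact hb' :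
            b' ∈ (c.base.symm.trans e).source)] with w hw
        rw [OpenPartialHomeomorph.trans_source] at hw
        exact e.left_inv hw.2
      rw [mfderiv_eq_fderiv (f := g)] at h2
      exact h3.mfderiv_eq.symm.trans h2
    have h4 := DFunLike.congr_fun (eq_smul_stdVol (formInChart vol (c.base.symm b) (g b')))
      (fun i => fderiv ℝ g b' (stdFrame m i))
    refine Eq.trans ?_ h4
    have h5 : e.symm (g b') = c.base.symm b' := e.left_inv hs
    change vol (c.base.symm b') (fun i => c.dbaseSymm b' (stdFrame m i)) =
      vol (e.symm (g b')) (fun i => (show Base m →L[ℝ] Base m from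
        mfderiv 𝓘(ℝ, Base m) 𝓘(ℝ, Base m) e.symm (g b')) (fderiv ℝ g b' (stdFrame m i)))
    rw [h5, h1]; rfl
  refine ContDiffAt.congr_of_eventuallyEq ?_ hev
  have h6 : ContDiffAt ℝ ∞ (formInChart vol (c.base.symm b)) (g b) :=
    (hvol (c.base.symm b)).contDiffAt (e.open_target.mem_nhds (e.map_source (mem_chart_source _ _)))
  have h7 : ContDiffAt ℝ ∞ (fun b' => formInChart vol (c.base.symm b) (g b') (stdFrame m)) b :=
    (ContinuousAlternatingMap.apply ℝ (Base m) ℝ (stdFrame m)).contDiff.contDiffAt.comp b (h6.comp b hgat)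
  have h8 : ContDiffAt ℝ ∞ (fderiv ℝ g) b := hgat.fderiv_right (by simp)
  have h9 : ContDiffAt ℝ ∞ (fun b' => fun i => fderiv ℝ g b' (stdFrame m i)) b :=
    contDiffAt_pi.2 fun i => h8.clm_apply contDiffAt_const
  exact h7.mul ((stdVol m).toContinuousMultilinearMap.contDiff.contDiffAt.comp b h9)

/-- The Lagrangian density in natural coordinates. -/
def lagr (vol : M → Base m [⋀^Fin m]→L[ℝ] ℝ) (L : J1 (Base m) (Fib N) π → ℝ) (q : TJ m N) : ℝ :=
  c.density vol q.1 * c.coordFun L q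

theorem fst_mem_target {q : TJ m N} (hq : q ∈ c.nat.target) : q.1 ∈ c.base.target := by
  have h := c.fst_mem (c.tot.map_target (show (q.1, q.2.1) ∈ c.tot.target from hq))
  rwa [c.tot.right_inv (show (q.1, q.2.1) ∈ c.tot.target from hq)] at h

theorem contDiffOn_lagr [IsManifold 𝓘(ℝ, Base m) ∞ M] (hvol : SmoothForm vol)
    (hL : ContMDiff 𝓘(ℝ, TJ m N) 𝓘(ℝ, ℝ) ∞ L) :
    ContDiffOn ℝ ∞ (c.lagr vol L) c.nat.target :=
  ((c.contDiffOn_density hvol).comp contDiff_fst.contDiffOn fun _ hq => c.fst_mem_target hq).mul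
    (c.contDiffOn_coordFun hL)

theorem contDiffAt_lagr [IsManifold 𝓘(ℝ, Base m) ∞ M] (hvol : SmoothForm vol)
    (hL : ContMDiff 𝓘(ℝ, TJ m N) 𝓘(ℝ, ℝ) ∞ L) {q : TJ m N} (hq : q ∈ c.nat.target) :
    ContDiffAt ℝ ∞ (c.lagr vol L) q :=
  (c.contDiffOn_lagr hvol hL).contDiffAt (c.nat.open_target.mem_nhds hq)

theorem fderiv_lagr_vert [IsManifold 𝓘(ℝ, Base m) ∞ M] (hvol : SmoothForm vol)
    (hL : ContMDiff 𝓘(ℝ, TJ m N) 𝓘(ℝ, ℝ) ∞ L) {q : TJ m N} (hq : q ∈ c.nat.target)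
    (w : Base m →L[ℝ] Fib N) :
    fderiv ℝ (c.lagr vol L) q (vertInj m N w) =
      c.density vol q.1 * fderiv ℝ (c.coordFun L) q (vertInj m N w) := by
  have h1 : DifferentiableAt ℝ (c.density vol) q.1 :=
    ((c.contDiffOn_density hvol).contDiffAt
      (c.base.open_target.mem_nhds (c.fst_mem_target hq))).differentiableAt (by simp)
  have h2 : HasFDerivAt (fun q : TJ m N => c.density vol q.1)
      ((fderiv ℝ (c.density vol) q.1).comp (ContinuousLinearMap.fst ℝ _ _)) q :=
    h1.hasFDerivAt.comp q hasFDerivAt_fst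
  have h3 := ((c.contDiffAt_coordFun hL hq).differentiableAt (by simp)).hasFDerivAt
  have h4 : fderiv ℝ (c.lagr vol L) q = _ := (h2.mul h3).fderiv
  rw [h4]
  simp [vertInj_apply]

/-- The density depends on x alone, so it is a constant factor for derivatives in v. The first order
identity `fderiv_lagr_vert` holds on a neighbourhood and can be differentiated once more. -/
theorem hess_lagr_vert [IsManifold 𝓘(ℝ, Base m) ∞ M] (hvol : SmoothForm vol)
    (hL : ContMDiff 𝓘(ℝ, TJ m N) 𝓘(ℝ, ℝ) ∞ L) {q : TJ m N} (hq : q ∈ c.nat.target)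
    (t w : Base m →L[ℝ] Fib N) :
    fderiv ℝ (fderiv ℝ (c.lagr vol L)) q (vertInj m N t) (vertInj m N w) =
      c.density vol q.1 *
        fderiv ℝ (fderiv ℝ (c.coordFun L)) q (vertInj m N t) (vertInj m N w) := by
  have hd : ∀ f : TJ m N → ℝ, ContDiffAt ℝ ∞ f q → HasFDerivAt (fun q => fderiv ℝ f q (vertInj m N w))
      ((fderiv ℝ (fderiv ℝ f) q).flip (vertInj m N w)) q := by
    intro f hf
    have h1 := hasFDerivAt_fderiv_of_contDiffAt hf
    exact (h1.clm_apply (hasFDerivAt_const (vertInj m N w) q)).congr_fderiv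
      (ContinuousLinearMap.ext fun u => by simp)
  have h1 : DifferentiableAt ℝ (c.density vol) q.1 :=
    ((c.contDiffOn_density hvol).contDiffAt
      (c.base.open_target.mem_nhds (c.fst_mem_target hq))).differentiableAt (by simp)
  have h2 : HasFDerivAt (fun q : TJ m N => c.density vol q.1)
      ((fderiv ℝ (c.density vol) q.1).comp (ContinuousLinearMap.fst ℝ _ _)) q :=
    h1.hasFDerivAt.comp q hasFDerivAt_fst
  have h3 := hd _ (c.contDiffAt_lagr hvol hL hq)
  have h4 := h2.mul (hd _ (c.contDiffAt_coordFun hL hq))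
  have hev : (fun q => fderiv ℝ (c.lagr vol L) q (vertInj m N w)) =ᶠ[𝓝 q]
      fun q => c.density vol q.1 * fderiv ℝ (c.coordFun L) q (vertInj m N w) := by
    filter_upwards [c.nat.open_target.mem_nhds hq] with q' hq'
    exact c.fderiv_lagr_vert hvol hL hq' w
  have h5 := h3.unique (h4.congr_of_eventuallyEq hev)
  have h6 := DFunLike.congr_fun h5 (vertInj m N t)
  simpa [vertInj_apply] using h6

theorem modelVert_lagr [IsManifold 𝓘(ℝ, Base m) ∞ M] (hvol : SmoothForm vol)
    (hL : ContMDiff 𝓘(ℝ, TJ m N) 𝓘(ℝ, ℝ) ∞ L) {q : TJ m N} (hq : q ∈ c.nat.target) :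
    modelVert (c.lagr vol L) q = c.density vol q.1 • modelVert (c.coordFun L) q := by
  refine ContinuousLinearMap.ext fun u => funext fun ν => ?_
  rw [modelVert_apply, c.fderiv_lagr_vert hvol hL hq, ← modelVert_apply]
  rfl

/-- Absorbing the density into the Lagrangian reduces an arbitrary volume form to the standard one.
-/
theorem poincareCartan_eq [IsManifold 𝓘(ℝ, Base m) ∞ M] (hvol : SmoothForm vol)
    (hL : ContMDiff 𝓘(ℝ, TJ m N) 𝓘(ℝ, ℝ) ∞ L) (hz : z ∈ c.nat.source) :
    poincareCartan vol L z =
      (modelTheta (c.lagr vol L) (c.nat z)).compContinuousLinearMap (c.prolong.dtot z) := by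
  have hx : π z.pt ∈ c.base.source := c.mapsTo _ hz
  have hb : c.base (π z.pt) = (c.nat z).1 := (c.fst_tot _ hz).symm
  ext u
  change insertOne (vol z.base) (dbar z) (vertEndL L z) u + L z * vol z.base (fun i => dbar z (u i))
    = modelTheta (c.lagr vol L) (c.nat z) (fun i => c.prolong.dtot z (u i))
  rw [insertOne_apply, modelTheta_apply, c.modelVert_lagr hvol hL (c.nat.map_source hz)]
  have hLz : c.coordFun L (c.nat z) = L z := by
    rw [coordFun, Function.comp, c.nat.left_inv hz]
  congr 1
  · refine Finset.sum_congr rfl fun i _ => ?_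
    have h1 := c.vol_apply (vol := vol) hx
      (Function.update (fun j => dbar z (u j)) i (vertEndL L z (u i)))
    refine h1.trans ?_
    have h2 : (fun k => c.dbase (π z.pt)
        (Function.update (fun j => dbar z (u j)) i (vertEndL L z (u i)) k)) =
        Function.update (fun j => (c.prolong.dtot z (u j)).1) i
          (modelVert (c.coordFun L) (c.nat z) (c.prolong.dtot z (u i))) := by
      funext k
      rcases eq_or_ne k i with rfl | hk
      · simp [c.dbase_vertEndL hL hz]
      · simp [hk, c.dbase_dbar hz]
    rw [h2, hb]
    have h3 := (stdVol m).map_update_smul (fun j => (c.prolong.dtot z (u j)).1) i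
      (c.density vol (c.nat z).1) (modelVert (c.coordFun L) (c.nat z) (c.prolong.dtot z (u i)))
    exact h3.symm
  · have h1 := c.vol_apply (vol := vol) hx (fun i => dbar z (u i))
    simp only [c.dbase_dbar hz] at h1
    rw [lagr, hLz, ← hb]
    change L z * vol (π z.pt) _ = _
    rw [h1]; ring

/-- `extD` is computed in the preferred chart at the point. The exterior derivative commutes with
pullback along the change of charts `g`, so the natural chart gives the same result. -/
theorem Omega_apply [IsManifold 𝓘(ℝ, Base m) ∞ M] (hvol : SmoothForm vol)
    (hL : ContMDiff 𝓘(ℝ, TJ m N) 𝓘(ℝ, ℝ) ∞ L) (hz : z ∈ c.nat.source)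
    (u : Fin (m + 1) → TJ m N) :
    Omega vol L z u =
      - extDeriv (modelTheta (c.lagr vol L)) (c.nat z) (fun i => c.prolong.dtot z (u i)) := by
  set e := chartAt (TJ m N) z with he
  have hemem : e ∈ IsManifold.maximalAtlas 𝓘(ℝ, TJ m N) ∞ (J1 (Base m) (Fib N) π) :=
    IsManifold.chart_mem_maximalAtlas _
  have hze : z ∈ e.source := mem_chart_source _ _
  set g : TJ m N → TJ m N := c.nat ∘ e.symm with hg
  have hO : IsOpen (e.symm.trans c.nat).source := (e.symm.trans c.nat).open_source
  have hbO : e z ∈ (e.symm.trans c.nat).source := by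
    rw [OpenPartialHomeomorph.trans_source]
    refine ⟨e.map_source hze, ?_⟩
    change e.symm (e z) ∈ c.nat.source
    rwa [e.left_inv hze]
  have hgs : ContDiffOn ℝ ∞ g (e.symm.trans c.nat).source := by
    rw [← contMDiffOn_iff_contDiffOn]
    refine (contMDiffOn_of_mem_maximalAtlas c.nat_mem).comp
      ((contMDiffOn_symm_of_mem_maximalAtlas hemem).mono ?_) ?_
    · intro q hq; rw [OpenPartialHomeomorph.trans_source] at hq; exact hq.1
    · intro q hq; rw [OpenPartialHomeomorph.trans_source] at hq; exact hq.2
  have hge : g (e z) = c.nat z := by simp only [hg, Function.comp, e.left_inv hze]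
  have hgd : ∀ q ∈ (e.symm.trans c.nat).source, fderiv ℝ g q =
      (c.prolong.dtot (e.symm q)).comp
        (show TJ m N →L[ℝ] TJ m N from mfderiv 𝓘(ℝ, TJ m N) 𝓘(ℝ, TJ m N) e.symm q) := by
    intro q hq
    rw [OpenPartialHomeomorph.trans_source] at hq
    rw [← mfderiv_eq_fderiv]
    exact mfderiv_comp (I := 𝓘(ℝ, TJ m N)) (I' := 𝓘(ℝ, TJ m N)) (I'' := 𝓘(ℝ, TJ m N)) q
      (g := c.nat) (f := e.symm) (c.prolong.mdiff_tot hq.2)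
      ((contMDiffAt_symm_of_mem_maximalAtlas hemem hq.1).mdifferentiableAt (by simp))
  have hev : formInChart (poincareCartan vol L) z =ᶠ[𝓝 (e z)] fun q =>
      (modelTheta (c.lagr vol L) (g q)).compContinuousLinearMap (fderiv ℝ g q) := by
    filter_upwards [hO.mem_nhds hbO] with q hq
    rw [hgd q hq]
    rw [OpenPartialHomeomorph.trans_source] at hq
    unfold formInChart
    rw [← he, c.poincareCartan_eq hvol hL hq.2]
    rfl
  have hat : ContDiffAt ℝ 2 (c.lagr vol L) (g (e z)) := by
    rw [hge]
    exact (c.contDiffAt_lagr hvol hL (c.nat.map_source hz)).of_le two_le_infty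
  have h1 : extDeriv (formInChart (poincareCartan vol L) z) (e z) =
      (extDeriv (modelTheta (c.lagr vol L)) (g (e z))).compContinuousLinearMap
        (fderiv ℝ g (e z)) := by
    rw [hev.extDeriv_eq]
    exact extDeriv_pullback (r := ∞) (differentiableAt_modelTheta hat)
      (hgs.contDiffAt (hO.mem_nhds hbO)) (by simpa using two_le_infty)
  have h2 : ∀ w : TJ m N, fderiv ℝ g (e z)
      ((show TJ m N →L[ℝ] TJ m N from mfderiv 𝓘(ℝ, TJ m N) 𝓘(ℝ, TJ m N) e z) w) =
        c.prolong.dtot z w := by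
    have h3 := mfderiv_comp (I := 𝓘(ℝ, TJ m N)) (I' := 𝓘(ℝ, TJ m N)) (I'' := 𝓘(ℝ, TJ m N)) z
      (g := g) (f := e)
      (((hgs.contDiffAt (hO.mem_nhds hbO)).differentiableAt (by simp)).mdifferentiableAt)
      ((contMDiffAt_of_mem_maximalAtlas hemem hze).mdifferentiableAt (by simp))
    have h4 : (g ∘ e) =ᶠ[𝓝 z] c.nat := by
      filter_upwards [e.open_source.mem_nhds hze] with w hw
      simp only [hg, Function.comp, e.left_inv hw]
    rw [mfderiv_eq_fderiv (f := g)] at h3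
    exact fun w => (DFunLike.congr_fun (h4.mfderiv_eq.symm.trans h3) w).symm
  change - extDeriv (formInChart (poincareCartan vol L) z) (e z) (fun i =>
    (show TJ m N →L[ℝ] TJ m N from mfderiv 𝓘(ℝ, TJ m N) 𝓘(ℝ, TJ m N) e z) (u i)) = _
  rw [h1]
  congr 1
  change extDeriv (modelTheta (c.lagr vol L)) (g (e z)) (fun i => fderiv ℝ g (e z) _) = _
  simp only [h2, hge]

end AdaptedChart

end JetCoordinates

/-! ### The jet field equation and the holonomy condition in natural coordinates. -/

section JetEquation

variable {m N : ℕ} {M E : Type*} [TopologicalSpace M] [ChartedSpace (Base m) M]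
  [IsManifold 𝓘(ℝ, Base m) ∞ M] [TopologicalSpace E] [ChartedSpace (Base m × Fib N) E]
  {π : E → M} [FibredManifold (Base m) (Fib N) π] (c : AdaptedChart (Base m) (Fib N) π)
  {z : J1 (Base m) (Fib N) π} {vol : M → Base m [⋀^Fin m]→L[ℝ] ℝ}
  {L : J1 (Base m) (Fib N) π → ℝ}

namespace AdaptedChart

theorem contDiffAt_two_lagr (hvol : SmoothForm vol) (hL : ContMDiff 𝓘(ℝ, TJ m N) 𝓘(ℝ, ℝ) ∞ L)
    (hz : z ∈ c.nat.source) : ContDiffAt ℝ 2 (c.lagr vol L) (c.nat z) :=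
  (c.contDiffAt_lagr hvol hL (c.nat.map_source hz)).of_le two_le_infty

theorem hessNondeg_lagr (hvol : IsVolumeForm vol) (hL : ContMDiff 𝓘(ℝ, TJ m N) 𝓘(ℝ, ℝ) ∞ L)
    (hreg : IsRegular vol L) (hz : z ∈ c.nat.source) : HessNondeg (c.lagr vol L) (c.nat z) := by
  have hq := c.nat.map_source hz
  intro t ht
  rcases hreg with h | h
  -- First alternative: the tangent vector with coordinates (0, 0, t) contracts Ω to zero, so it is
  -- zero by `1`-nondegeneracy.
  · have hu := c.prolong.dtot_dtotSymm_apply hz (vertInj m N t)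
    have h0 := h z (c.prolong.dtotSymm (c.nat z) (vertInj m N t)) fun w => by
      rw [c.Omega_apply hvol.1 hL hz, neg_eq_zero]
      have := extDeriv_modelTheta_of_hess_eq_zero (c.contDiffAt_two_lagr hvol.1 hL hz) ht
        (fun i => c.prolong.dtot z (w i))
      rw [← this]
      congr 1
      funext i
      refine Fin.cases hu (fun j => rfl) i
    rw [show c.prolong.tot z = c.nat z from rfl, h0, map_zero] at hu
    exact congrArg (fun p : TJ m N => p.2.2) hu.symm
  -- Second alternative: the two Hessians differ by the density, which has no zeros.
  · obtain ⟨t', rfl⟩ := c.homCoord_surjective hz t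
    rw [h z t', map_zero]
    ext s
    rw [c.fibreHessian_eq hL hz]
    have h1 := ht (c.homCoord z.pt s)
    rw [c.hess_lagr_vert hvol.1 hL hq] at h1
    exact (mul_eq_zero.1 h1).resolve_left (c.density_ne_zero hvol.2 (c.fst_mem_target hq))

theorem jetEq_iff (hvol : IsVolumeForm vol) (hL : ContMDiff 𝓘(ℝ, TJ m N) 𝓘(ℝ, ℝ) ∞ L)
    (hreg : IsRegular vol L) (hz : z ∈ c.nat.source)
    (j : JetAt (Base m) (Fib N × (Base m →L[ℝ] Fib N)) (J1.base : J1 (Base m) (Fib N) π → M) z) :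
    (∀ (Z : Fin m → Base m) (u : TJ m N),
      Omega vol L z (Fin.snoc (α := fun _ => TJ m N) (fun i => j.lin (Z i)) u) = 0) ↔
    EulerLagrange (c.lagr vol L) (c.nat z) (c.prolong.coordV ⟨z, j⟩) := by
  have hx : π z.pt ∈ c.base.source := c.mapsTo _ hz
  set K := c.prolong.coordV ⟨z, j⟩ with hK
  let A : Base m →L[ℝ] TJ m N := (ContinuousLinearMap.id ℝ _).prod K
  rw [horizontal_eq_iff (b := dbar z) j.dproj_comp,
    ← eulerLagrange_iff (c.contDiffAt_two_lagr hvol.1 hL hz) (c.hessNondeg_lagr hvol hL hreg hz)]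
  have hlin : ∀ a, c.prolong.dtot z (j.lin a) = A (c.dbase (π z.pt) a) := fun a =>
    c.prolong.dtot_lin (z := ⟨z, j⟩) hz a
  -- The lifts of the standard frame and those of the coordinate frame span the same horizontal
  -- space. The change between the frames contributes a determinant, which is nonzero and does not
  -- affect the equation.
  have key : ∀ u, Omega vol L z (Fin.cons u fun i => j.lin (stdFrame m i)) =
      - (stdVol m (fun i => c.dbase (π z.pt) (stdFrame m i)) *
        extDeriv (modelTheta (c.lagr vol L)) (c.nat z)
          (Fin.cons (c.prolong.dtot z u) fun i => A (stdFrame m i))) := by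
    intro u
    rw [c.Omega_apply hvol.1 hL hz, ← map_cons_horizontal]
    congr 2
    funext i
    refine Fin.cases rfl (fun j => ?_) i
    exact hlin _
  have hne := c.stdVol_dbase_ne_zero hvol.2 hx
  constructor
  · intro h u hu
    have h1 := c.prolong.dtot_dtotSymm_apply hz u
    have h2 := h (c.prolong.dtotSymm (c.prolong.tot z) u) (by
      have h3 := c.dbase_dbar hz (c.prolong.dtotSymm (c.prolong.tot z) u)
      rw [h1, hu] at h3
      rw [← c.dbaseSymm_dbase_apply hx (dbar z _), h3, map_zero])
    rw [key, h1, neg_eq_zero] at h2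
    exact (mul_eq_zero.1 h2).resolve_left hne
  · intro h u hu
    rw [key, neg_eq_zero]
    refine mul_eq_zero_of_right _ (h _ ?_)
    rw [← c.dbase_dbar hz, hu, map_zero]

theorem Omega_three_vertical (hvol : IsVolumeForm vol)
    (hL : ContMDiff 𝓘(ℝ, TJ m N) 𝓘(ℝ, ℝ) ∞ L) (hz : z ∈ c.nat.source)
    (w : Fin (m + 1) → TJ m N) {i j k : Fin (m + 1)} (hij : i ≠ j) (hik : i ≠ k) (hjk : j ≠ k)
    (hi : dbar z (w i) = 0) (hj : dbar z (w j) = 0) (hk : dbar z (w k) = 0) :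
    Omega vol L z w = 0 := by
  rw [c.Omega_apply hvol.1 hL hz, neg_eq_zero]
  refine extDeriv_modelTheta_three_vertical (c.contDiffAt_two_lagr hvol.1 hL hz) _ hij hik hjk
    ?_ ?_ ?_
  · rw [← c.dbase_dbar hz, hi, map_zero]
  · rw [← c.dbase_dbar hz, hj, map_zero]
  · rw [← c.dbase_dbar hz, hk, map_zero]

/-- This is the condition F = v, the first half of `EulerLagrange`, in intrinsic terms. -/
theorem dpt_comp_lin_iff (hz : z ∈ c.nat.source)
    (j : JetAt (Base m) (Fib N × (Base m →L[ℝ] Fib N)) (J1.base : J1 (Base m) (Fib N) π → M) z) :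
    (dpt z).comp j.lin = z.lin ↔
      (ContinuousLinearMap.fst ℝ _ _).comp (c.prolong.coordV ⟨z, j⟩) = (c.nat z).2.2 := by
  have hx : π z.pt ∈ c.base.source := c.mapsTo _ hz
  have h1 : ∀ a, c.dtot z.pt (dpt z (j.lin a)) =
      (c.dbase (π z.pt) a, (c.prolong.coordV ⟨z, j⟩ (c.dbase (π z.pt) a)).1) := by
    intro a
    rw [c.dtot_dpt hz]
    have h := c.prolong.dtot_lin (z := ⟨z, j⟩) hz a
    have h' : c.prolong.dtot z (j.lin a) = (c.dbase (π z.pt) a,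
      c.prolong.coordV ⟨z, j⟩ (c.dbase (π z.pt) a)) := h
    rw [h']
  constructor
  · intro h
    ext1 a
    have h2 := h1 (c.dbaseSymm (c.base (π z.pt)) a)
    rw [show dpt z (j.lin _) = z.lin _ from DFunLike.congr_fun h _, c.dtot_lin hz,
      c.dbase_dbaseSymm_apply hx] at h2
    exact (congrArg Prod.snd h2).symm
  · intro h
    ext1 a
    have h2 := h1 a
    rw [show (c.prolong.coordV ⟨z, j⟩ (c.dbase (π z.pt) a)).1 = c.coordV z (c.dbase (π z.pt) a)
      from DFunLike.congr_fun h _, ← c.dtot_lin hz] at h2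
    have h3 := congrArg (c.dtotSymm (c.tot z.pt)) h2
    rwa [c.dtotSymm_dtot_apply hz, c.dtotSymm_dtot_apply hz] at h3

end AdaptedChart

end JetEquation

/-! ### Smoothness of maps into jet bundles and of vector fields, read in natural coordinates. -/

section Smoothness

variable {B F : Type*} [NormedAddCommGroup B] [NormedSpace ℝ B]
  [NormedAddCommGroup F] [NormedSpace ℝ F]
  {M E : Type*} [TopologicalSpace M] [ChartedSpace B M]
  [TopologicalSpace E] [ChartedSpace (B × F) E] {π : E → M}

/-- The slope coordinates as a linear function of the differential. -/
def AdaptedChart.coordLin (c : AdaptedChart B F π) (y : E) : (B →L[ℝ] B × F) →L[ℝ] (B →L[ℝ] F) :=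
  (ContinuousLinearMap.compL ℝ B (B × F) F
      ((ContinuousLinearMap.snd ℝ B F).comp (c.dtot y))).comp
    ((ContinuousLinearMap.compL ℝ B B (B × F)).flip (c.dbaseSymm (c.base (π y))))

/-- Linearity in the differential is what makes averages of jets correspond to averages of slopes.
-/
theorem AdaptedChart.coordV_eq (c : AdaptedChart B F π) (z : J1 B F π) :
    c.coordV z = c.coordLin z.pt z.lin := rfl

variable [FibredManifold B F π]

theorem contMDiffAt_jet_iff {X : Type*} [TopologicalSpace X] {H : Type*} [TopologicalSpace H]
    {V : Type*} [NormedAddCommGroup V] [NormedSpace ℝ V] (I : ModelWithCorners ℝ V H)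
    [ChartedSpace H X] (c : AdaptedChart B F π) {f : X → J1 B F π} {x : X}
    (hs : ∀ᶠ x' in 𝓝 x, f x' ∈ c.nat.source)
    (hf : ContMDiffAt I 𝓘(ℝ, B × F) ∞ (fun x' => c.tot (f x').pt) x) :
    ContMDiffAt I 𝓘(ℝ, JetModel B F) ∞ f x ↔
      ContMDiffAt I 𝓘(ℝ, B →L[ℝ] F) ∞ (fun x' => c.coordV (f x')) x := by
  have hx : f x ∈ c.nat.source := hs.self_of_nhds
  constructor
  · intro h
    have h1 := (contMDiffAt_of_mem_maximalAtlas c.nat_mem hx).comp x h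
    exact (contDiff_snd.comp contDiff_snd).contMDiff.contMDiffAt.comp x h1
  · intro h
    have h1 : ContMDiffAt I 𝓘(ℝ, JetModel B F) ∞ (fun x' => c.nat (f x')) x :=
      ((contDiff_fst.contMDiff.contMDiffAt.comp x hf).prodMk_space
        ((contDiff_snd.contMDiff.contMDiffAt.comp x hf).prodMk_space h))
    have h2 := (contMDiffAt_symm_of_mem_maximalAtlas c.nat_mem (c.nat.map_source hx)).comp x h1
    refine h2.congr_of_eventuallyEq ?_
    filter_upwards [hs] with x' hx'
    exact (c.nat.left_inv hx').symm

end Smoothness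

section SmoothFields

variable {m N : ℕ} {M E : Type*} [TopologicalSpace M] [ChartedSpace (Base m) M]
  [TopologicalSpace E] [ChartedSpace (Base m × Fib N) E]
  {π : E → M} [FibredManifold (Base m) (Fib N) π] (c : AdaptedChart (Base m) (Fib N) π)
  {z : J1 (Base m) (Fib N) π}

theorem contMDiffAt_nat (hz : z ∈ c.nat.source) :
    ContMDiffAt 𝓘(ℝ, TJ m N) 𝓘(ℝ, TJ m N) ∞ c.nat z :=
  contMDiffAt_of_mem_maximalAtlas c.nat_mem hz

theorem contMDiffAt_jetSection_iff {Ψ : JetSection m N π} (hz : z ∈ c.nat.source) :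
    ContMDiffAt 𝓘(ℝ, TJ m N) 𝓘(ℝ, JetModel (Base m) (Fib N × (Base m →L[ℝ] Fib N))) ∞
      (fun z => (⟨z, Ψ z⟩ : J1 (Base m) (Fib N × (Base m →L[ℝ] Fib N))
        (J1.base : J1 (Base m) (Fib N) π → M))) z ↔
    ContMDiffAt 𝓘(ℝ, TJ m N) 𝓘(ℝ, Base m →L[ℝ] Fib N × (Base m →L[ℝ] Fib N)) ∞
      (fun z => c.prolong.coordV ⟨z, Ψ z⟩) z :=
  contMDiffAt_jet_iff _ c.prolong (c.nat.open_source.mem_nhds hz) (contMDiffAt_nat c hz)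

theorem isJetFieldOn_iff {U : Set (J1 (Base m) (Fib N) π)} (hU : IsOpen U)
    {Ψ : JetSection m N π} : IsJetFieldOn U Ψ ↔
      ∀ z ∈ U, ∃ c : AdaptedChart (Base m) (Fib N) π, z ∈ c.nat.source ∧
        ContMDiffAt 𝓘(ℝ, TJ m N) 𝓘(ℝ, Base m →L[ℝ] Fib N × (Base m →L[ℝ] Fib N)) ∞
          (fun z => c.prolong.coordV ⟨z, Ψ z⟩) z := by
  constructor
  · intro h z hz
    obtain ⟨c, hc⟩ := FibredManifold.exists_adapted (B := Base m) (F := Fib N) (π := π) z.pt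
    exact ⟨c, hc, (contMDiffAt_jetSection_iff c hc).1 (ContMDiffOn.contMDiffAt h (hU.mem_nhds hz))⟩
  · intro h z hz
    obtain ⟨c, hc, h1⟩ := h z hz
    exact ((contMDiffAt_jetSection_iff c hc).2 h1).contMDiffWithinAt

theorem IsJetFieldOn.contMDiffAt {U : Set (J1 (Base m) (Fib N) π)} (hU : IsOpen U)
    {Ψ : JetSection m N π} (h : IsJetFieldOn U Ψ) (hz : z ∈ U) (hc : z ∈ c.nat.source) :
    ContMDiffAt 𝓘(ℝ, TJ m N) 𝓘(ℝ, Base m →L[ℝ] Fib N × (Base m →L[ℝ] Fib N)) ∞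
      (fun z => c.prolong.coordV ⟨z, Ψ z⟩) z :=
  (contMDiffAt_jetSection_iff c hc).1 (ContMDiffOn.contMDiffAt h (hU.mem_nhds hz))

/-- The tangent maps of the natural chart and of its inverse are smooth, and the tangent bundle of
the model space is trivial. -/
theorem contMDiffAt_vectorField_iff {Y : J1 (Base m) (Fib N) π → TJ m N} (hz : z ∈ c.nat.source) :
    ContMDiffAt 𝓘(ℝ, TJ m N) 𝓘(ℝ, TJ m N).tangent ∞
        (fun w => (⟨w, Y w⟩ : TangentBundle 𝓘(ℝ, TJ m N) (J1 (Base m) (Fib N) π))) z ↔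
      ContMDiffAt 𝓘(ℝ, TJ m N) 𝓘(ℝ, TJ m N) ∞ (fun w => c.prolong.dtot w (Y w)) z := by
  constructor
  · intro h
    have h1 : ContMDiffOn 𝓘(ℝ, TJ m N) 𝓘(ℝ, TJ m N) ∞ c.nat c.nat.source :=
      contMDiffOn_of_mem_maximalAtlas c.nat_mem
    have h2 := h1.contMDiffOn_tangentMapWithin (m := ∞) (by simp) c.nat.open_source.uniqueMDiffOn
    have h3 := (h2.contMDiffAt (x := (⟨z, Y z⟩ : TangentBundle 𝓘(ℝ, TJ m N) _)) (by
      refine (c.nat.open_source.preimage ?_).mem_nhds hz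
      exact FiberBundle.continuous_proj _ _)).comp z h
    have h4 := (contMDiff_snd_tangentBundle_modelSpace (TJ m N) 𝓘(ℝ, TJ m N)
      (n := ∞)).contMDiffAt.comp z h3
    refine h4.congr_of_eventuallyEq ?_
    filter_upwards [c.nat.open_source.mem_nhds hz] with w hw
    change c.prolong.dtot w (Y w) = mfderivWithin _ _ _ _ _ _
    rw [mfderivWithin_of_isOpen c.nat.open_source hw]
    rfl
  · intro h
    have h1 : ContMDiffOn 𝓘(ℝ, TJ m N) 𝓘(ℝ, TJ m N) ∞ c.nat.symm c.nat.target :=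
      contMDiffOn_symm_of_mem_maximalAtlas c.nat_mem
    have h2 := h1.contMDiffOn_tangentMapWithin (m := ∞) (by simp) c.nat.open_target.uniqueMDiffOn
    have h0 : ContMDiffAt 𝓘(ℝ, TJ m N) 𝓘(ℝ, TJ m N).tangent ∞
        (fun w => (⟨c.nat w, c.prolong.dtot w (Y w)⟩ : TangentBundle 𝓘(ℝ, TJ m N) (TJ m N))) z := by
      rw [Bundle.contMDiffAt_totalSpace]
      refine ⟨contMDiffAt_nat c hz, ?_⟩
      simpa using h
    have h3 := (h2.contMDiffAt (x := (⟨c.nat z, c.prolong.dtot z (Y z)⟩ :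
      TangentBundle 𝓘(ℝ, TJ m N) (TJ m N))) (by
      refine (c.nat.open_target.preimage ?_).mem_nhds (c.nat.map_source hz)
      exact FiberBundle.continuous_proj _ _)).comp z h0
    refine h3.congr_of_eventuallyEq ?_
    filter_upwards [c.nat.open_source.mem_nhds hz] with w hw
    change _ = (⟨c.nat.symm (c.nat w), _⟩ : TangentBundle 𝓘(ℝ, TJ m N) _)
    have e1 : c.nat.symm (c.nat w) = w := c.nat.left_inv hw
    have e2 : (mfderivWithin 𝓘(ℝ, TJ m N) 𝓘(ℝ, TJ m N) c.nat.symm c.nat.target (c.nat w) :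
        TJ m N →L[ℝ] TJ m N) (c.prolong.dtot w (Y w)) = Y w := by
      rw [mfderivWithin_of_isOpen c.nat.open_target (c.nat.map_source hw)]
      exact c.prolong.dtotSymm_dtot_apply hw (Y w)
    change _ = (⟨c.nat.symm (c.nat w), (mfderivWithin 𝓘(ℝ, TJ m N) 𝓘(ℝ, TJ m N) c.nat.symm
      c.nat.target (c.nat w) : TJ m N →L[ℝ] TJ m N) (c.prolong.dtot w (Y w))⟩ :
        TangentBundle 𝓘(ℝ, TJ m N) _)
    rw [e2, e1]

end SmoothFields

/-! ### Topology of the jet bundle, as needed for partitions of unity. -/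

section Topology

variable {m N : ℕ} {M E : Type*} [TopologicalSpace M] [ChartedSpace (Base m) M]
  [TopologicalSpace E] [ChartedSpace (Base m × Fib N) E]
  (π : E → M) [FibredManifold (Base m) (Fib N) π]

/-- Jets over one point of `E` lie in a common natural chart; jets over distinct points are
separated by preimages of open sets of `E`. -/
theorem t2Space_J1 [T2Space E] : T2Space (J1 (Base m) (Fib N) π) := by
  refine ⟨fun z w hzw => ?_⟩
  by_cases h : z.pt = w.pt
  · obtain ⟨c, hc⟩ := FibredManifold.exists_adapted (B := Base m) (F := Fib N) (π := π) z.pt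
    have hz : z ∈ c.nat.source := hc
    have hw : w ∈ c.nat.source := by rw [c.mem_nat_source, ← h]; exact hc
    have hne : c.nat z ≠ c.nat w := fun h' => hzw (c.nat.injOn hz hw h')
    obtain ⟨u, v, hu, hv, hzu, hwv, huv⟩ := t2_separation hne
    exact ⟨_, _, c.nat.isOpen_inter_preimage hu, c.nat.isOpen_inter_preimage hv, ⟨hz, hzu⟩,
      ⟨hw, hwv⟩, (huv.preimage c.nat).mono inter_subset_right inter_subset_right⟩
  · obtain ⟨u, v, hu, hv, hzu, hwv, huv⟩ := t2_separation h
    have hc : Continuous (J1.pt : J1 (Base m) (Fib N) π → E) := contMDiff_pt.continuous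
    exact ⟨_, _, hu.preimage hc, hv.preimage hc, hzu, hwv, huv.preimage _⟩

/-- Countably many adapted charts cover `E`, and the induced natural charts cover the jet bundle. It
is therefore second countable, and it is locally compact because its model space is. -/
theorem sigmaCompactSpace_J1 [SigmaCompactSpace E] :
    SigmaCompactSpace (J1 (Base m) (Fib N) π) := by
  have : SecondCountableTopology E :=
    ChartedSpace.secondCountable_of_sigmaCompact (Base m × Fib N) E
  let f : E → Set E := fun y =>
    (FibredManifold.exists_adapted (B := Base m) (F := Fib N) (π := π) y).choose.tot.source
  obtain ⟨s, hs, hcov⟩ := TopologicalSpace.countable_cover_nhds (f := f) fun y =>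
    (AdaptedChart.tot _).open_source.mem_nhds
      (FibredManifold.exists_adapted (B := Base m) (F := Fib N) (π := π) y).choose_spec
  -- Any jet over `y` will do: its preferred natural chart is the one induced by the adapted chart
  -- chosen at `y`.
  let σ : E → J1 (Base m) (Fib N) π := fun y => ⟨y, Classical.choice (JetAt.nonempty π y)⟩
  have : SecondCountableTopology (J1 (Base m) (Fib N) π) := by
    refine ChartedSpace.secondCountable_of_countable_cover (TJ m N) (s := σ '' s) ?_ (hs.image σ)
    rw [eq_univ_iff_forall]
    intro z
    have hz : z.pt ∈ ⋃ y ∈ s, f y := by rw [hcov]; trivial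
    obtain ⟨y, hy, hzy⟩ := mem_iUnion₂.1 hz
    exact mem_iUnion₂.2 ⟨σ y, mem_image_of_mem _ hy, hzy⟩
  have : LocallyCompactSpace (J1 (Base m) (Fib N) π) := ChartedSpace.locallyCompactSpace (TJ m N) _
  infer_instance

end Topology

/-! ### Classes of multivector fields and jet fields. -/

section Correspondence

variable {m N : ℕ} {M E : Type*} [TopologicalSpace M] [ChartedSpace (Base m) M]
  [TopologicalSpace E] [ChartedSpace (Base m × Fib N) E]
  {π : E → M} [FibredManifold (Base m) (Fib N) π] {U : Set (J1 (Base m) (Fib N) π)}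
  {X X' : MultiField m N π} {Ψ : JetSection m N π} {z : J1 (Base m) (Fib N) π}

theorem stdVol_map (T : Base m →L[ℝ] Base m) (Z : Fin m → Base m) :
    stdVol m (fun i => T (Z i)) = stdVol m Z * stdVol m (fun i => T (stdFrame m i)) :=
  alternating_base_eq ((stdVol m).toAlternatingMap.compLinearMap (T : Base m →ₗ[ℝ] Base m)) Z

theorem AdaptedChart.stdVol_dbase_frame_ne_zero (c : AdaptedChart (Base m) (Fib N) π) {x : M}
    (hx : x ∈ c.base.source) : stdVol m (fun i => c.dbase x (stdFrame m i)) ≠ 0 := by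
  intro h
  have h1 := stdVol_map (c.dbaseSymm (c.base x)) (fun i => c.dbase x (stdFrame m i))
  simp only [c.dbaseSymm_dbase_apply hx] at h1
  rw [h, zero_mul] at h1
  exact one_ne_zero (stdVol_frame.symm.trans h1)

/-- Jets over `z ∈ J¹E` of sections of `J¹E → M`. -/
abbrev SecondJetAt (z : J1 (Base m) (Fib N) π) : Type :=
  JetAt (Base m) (Fib N × (Base m →L[ℝ] Fib N)) (J1.base : J1 (Base m) (Fib N) π → M) z

/-- The range of the differential of a section of `J¹E → M`. -/
abbrev SecondJetAt.hor (j : SecondJetAt z) : Submodule ℝ (TJ m N) :=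
  LinearMap.range (j.lin : Base m →ₗ[ℝ] TJ m N)

theorem dbar_lin (j : SecondJetAt z) (a : Base m) : dbar z (j.lin a) = a :=
  DFunLike.congr_fun j.dproj_comp a

theorem pair_frame (α : Base m [⋀^Fin m]→L[ℝ] ℝ) (j : SecondJetAt z) :
    pair (α.compContinuousLinearMap (dbar z))
      (exteriorPower.ιMulti ℝ m (fun i => j.lin (stdFrame m i))) = α (stdFrame m) := by
  rw [pair_ιMulti]
  change α (fun i => dbar z (j.lin (stdFrame m i))) = _
  simp only [dbar_lin]

theorem frame_ne_zero (j : SecondJetAt z) :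
    exteriorPower.ιMulti ℝ m (fun i => j.lin (stdFrame m i)) ≠ 0 := by
  intro h
  have h1 := pair_frame (stdVol m) j
  rw [h, map_zero, stdVol_frame] at h1
  exact one_ne_zero h1.symm

theorem associated_iff (j : SecondJetAt z) (Y : ⋀[ℝ]^m (TJ m N)) :
    (Y ≠ 0 ∧ Y ∈ LinearMap.range (exteriorPower.map m (SecondJetAt.hor j).subtype)) ↔
      ∃ r : ℝ, r ≠ 0 ∧ Y = r • exteriorPower.ιMulti ℝ m (fun i => j.lin (stdFrame m i)) := by
  refine (and_congr_right' (mem_range_map_iff _ Y)).trans ?_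
  constructor
  · rintro ⟨h0, r, hr⟩
    exact ⟨r, fun h => h0 (by rw [hr, h, zero_smul]), hr⟩
  · rintro ⟨r, hr, h⟩
    exact ⟨by rw [h]; exact smul_ne_zero hr (frame_ne_zero j), r, h⟩

theorem AssociatedOn.exists_smul (h : AssociatedOn U X Ψ) (hz : z ∈ U) :
    ∃ r : ℝ, r ≠ 0 ∧ X z = r • exteriorPower.ιMulti ℝ m (fun i => (Ψ z).lin (stdFrame m i)) :=
  (associated_iff (Ψ z) (X z)).1 (h z hz)

theorem AssociatedOn.eq {Ψ' : JetSection m N π} (h : AssociatedOn U X Ψ)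
    (h' : AssociatedOn U X Ψ') (hz : z ∈ U) : Ψ' z = Ψ z :=
  JetAt.ext (section_ext_of_mem_range (Ψ' z).dproj_comp (Ψ z).dproj_comp (h z hz).1
    (h' z hz).2 (h z hz).2)

theorem AssociatedOn.transverseOn (h : AssociatedOn U X Ψ) : TransverseOn U X := by
  intro z hz α hα
  obtain ⟨r, hr, hX⟩ := h.exists_smul hz
  rw [contractTop_ne_zero_iff, hX, map_smul, pair_frame]
  exact smul_ne_zero hr (apply_stdFrame_ne_zero hα)

theorem contMDiffAt_smul_vectorField {f : J1 (Base m) (Fib N) π → ℝ}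
    {Y : J1 (Base m) (Fib N) π → TJ m N} (hf : ContMDiffAt 𝓘(ℝ, TJ m N) 𝓘(ℝ, ℝ) ∞ f z)
    (hY : ContMDiffAt 𝓘(ℝ, TJ m N) 𝓘(ℝ, TJ m N).tangent ∞
      (fun w => (⟨w, Y w⟩ : TangentBundle 𝓘(ℝ, TJ m N) (J1 (Base m) (Fib N) π))) z) :
    ContMDiffAt 𝓘(ℝ, TJ m N) 𝓘(ℝ, TJ m N).tangent ∞
      (fun w => (⟨w, f w • Y w⟩ : TangentBundle 𝓘(ℝ, TJ m N) (J1 (Base m) (Fib N) π))) z := by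
  obtain ⟨c, hc⟩ : ∃ c : AdaptedChart (Base m) (Fib N) π, z ∈ c.nat.source :=
    FibredManifold.exists_adapted (B := Base m) (F := Fib N) (π := π) z.pt
  have h1 := (contMDiffAt_vectorField_iff c hc).1 hY
  refine (contMDiffAt_vectorField_iff c hc).2 ?_
  simp only [map_smul]
  exact hf.smul h1

/-- The scalar function is absorbed into the first factor, which exists since `1 ≤ m`. For `m = 0`
the empty wedge is constant and no scalar could be absorbed. -/
theorem locallyDecomposableOn_of_smul (hm : 1 ≤ m)
    (h : ∀ z ∈ U, ∃ V ⊆ U, IsOpen V ∧ z ∈ V ∧ ∃ (f : J1 (Base m) (Fib N) π → ℝ)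
      (Y : Fin m → J1 (Base m) (Fib N) π → TJ m N),
      (∀ w ∈ V, ContMDiffAt 𝓘(ℝ, TJ m N) 𝓘(ℝ, ℝ) ∞ f w) ∧
      (∀ i, ∀ w ∈ V, ContMDiffAt 𝓘(ℝ, TJ m N) 𝓘(ℝ, TJ m N).tangent ∞
        (fun w => (⟨w, Y i w⟩ : TangentBundle 𝓘(ℝ, TJ m N) (J1 (Base m) (Fib N) π))) w) ∧
      ∀ w ∈ V, X w = f w • exteriorPower.ιMulti ℝ m (fun i => Y i w)) :
    LocallyDecomposableOn U X := by
  intro z hz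
  obtain ⟨V, hVU, hV, hzV, f, Y, hf, hY, hX⟩ := h z hz
  let i₀ : Fin m := ⟨0, hm⟩
  refine ⟨V, hVU, hV, hzV, Function.update Y i₀ (fun w => f w • Y i₀ w), ?_, ?_⟩
  · intro i w hw
    refine ContMDiffAt.contMDiffWithinAt ?_
    rcases eq_or_ne i i₀ with rfl | hi
    · simp only [Function.update_self]
      exact contMDiffAt_smul_vectorField (hf w hw) (hY _ w hw)
    · simp only [Function.update_of_ne hi]
      exact hY i w hw
  · intro w hw
    have h1 : (fun i => Function.update Y i₀ (fun w => f w • Y i₀ w) i w) =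
        Function.update (fun i => Y i w) i₀ (f w • Y i₀ w) := by
      funext i
      rcases eq_or_ne i i₀ with rfl | hi
      · simp
      · simp [hi]
    rw [h1, AlternatingMap.map_update_smul, hX w hw]
    congr 2
    exact (Function.update_eq_self i₀ (fun i => Y i w)).symm

variable (vol : M → Base m [⋀^Fin m]→L[ℝ] ℝ)

variable (Ψ) in
/-- The section of `Λᵐ H(J¹E)` on which the volume form takes the value `1`. -/
def unitMultiField : MultiField m N π := fun z =>
  (vol z.base (stdFrame m))⁻¹ • exteriorPower.ιMulti ℝ m (fun i => (Ψ z).lin (stdFrame m i))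

variable {vol}

theorem associatedOn_unitMultiField (hvol : ∀ x, vol x ≠ 0) :
    AssociatedOn U (unitMultiField Ψ vol) Ψ := fun z _ =>
  (associated_iff (Ψ z) _).2 ⟨_, inv_ne_zero (apply_stdFrame_ne_zero (hvol _)), rfl⟩

/-- It is the chart's coordinate vector fields that have to be lifted. A fixed vector of the model
space need not be a smooth field, as its meaning depends on the preferred chart at each point. -/
theorem contMDiffAt_horizontalLift (c : AdaptedChart (Base m) (Fib N) π) (hU : IsOpen U)
    (hΨ : IsJetFieldOn U Ψ) (hz : z ∈ U) (hc : z ∈ c.nat.source) (a : Base m) :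
    ContMDiffAt 𝓘(ℝ, TJ m N) 𝓘(ℝ, TJ m N).tangent ∞
      (fun w => (⟨w, (Ψ w).lin (c.dbaseSymm (c.base (π w.pt)) a)⟩ :
        TangentBundle 𝓘(ℝ, TJ m N) (J1 (Base m) (Fib N) π))) z := by
  refine (contMDiffAt_vectorField_iff c hc).2 ?_
  have hK := hΨ.contMDiffAt c hU hz hc
  have h1 : ContMDiffAt 𝓘(ℝ, TJ m N) 𝓘(ℝ, TJ m N) ∞
      (fun w => (a, c.prolong.coordV ⟨w, Ψ w⟩ a)) z :=
    contMDiffAt_const.prodMk_space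
      ((ContinuousLinearMap.apply ℝ (Fib N × (Base m →L[ℝ] Fib N)) a).contDiff.contMDiff.contMDiffAt.comp
        z hK)
  refine h1.congr_of_eventuallyEq ?_
  filter_upwards [c.nat.open_source.mem_nhds hc] with w hw
  have h2 := c.prolong.dtot_lin (z := ⟨w, Ψ w⟩) hw (c.dbaseSymm (c.base (π w.pt)) a)
  have h3 : c.prolong.dbase (J1.base w) (c.dbaseSymm (c.base (π w.pt)) a) = a :=
    c.dbase_dbaseSymm_apply (c.mapsTo _ hw) a
  rw [h3] at h2
  exact h2

/-- The frame in `unitMultiField` need not be smooth, but normalising by the volume form makes the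
wedge independent of the frame. With the coordinate frame of a chart it becomes the inverse density
times a wedge of smooth lifts. -/
theorem locallyDecomposableOn_unitMultiField [IsManifold 𝓘(ℝ, Base m) ∞ M] (hm : 1 ≤ m)
    (hvol : IsVolumeForm vol) (hU : IsOpen U) (hΨ : IsJetFieldOn U Ψ) :
    LocallyDecomposableOn U (unitMultiField Ψ vol) := by
  refine locallyDecomposableOn_of_smul hm fun z hz => ?_
  obtain ⟨c, hc⟩ : ∃ c : AdaptedChart (Base m) (Fib N) π, z ∈ c.nat.source :=
    FibredManifold.exists_adapted (B := Base m) (F := Fib N) (π := π) z.pt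
  refine ⟨U ∩ c.nat.source, inter_subset_left, hU.inter c.nat.open_source, ⟨hz, hc⟩,
    fun w => (c.density vol (c.nat w).1)⁻¹,
    fun i w => (Ψ w).lin (c.dbaseSymm (c.base (π w.pt)) (stdFrame m i)), ?_, ?_, ?_⟩
  · rintro w ⟨-, hw⟩
    have hw1 : (c.nat w).1 ∈ c.base.target := c.fst_mem_target (c.nat.map_source hw)
    have h1 : ContDiffAt ℝ ∞ (fun x => (c.density vol x)⁻¹) (c.nat w).1 :=
      ((c.contDiffOn_density hvol.1).contDiffAt (c.base.open_target.mem_nhds hw1)).inv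
        (c.density_ne_zero hvol.2 hw1)
    have h2 : ContMDiffAt 𝓘(ℝ, TJ m N) 𝓘(ℝ, Base m) ∞ (fun w => (c.nat w).1) w :=
      contDiff_fst.contMDiff.contMDiffAt.comp w (contMDiffAt_nat c hw)
    exact ContMDiffAt.comp (g := fun x => (c.density vol x)⁻¹) w h1.contMDiffAt h2
  · rintro i w ⟨hwU, hw⟩
    exact contMDiffAt_horizontalLift c hU hΨ hwU hw _
  · rintro w ⟨-, hw⟩
    have hx := c.mapsTo _ hw
    have h1 := alternating_base_eq ((exteriorPower.ιMulti ℝ m).compLinearMap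
      ((Ψ w).lin : Base m →ₗ[ℝ] TJ m N))
      (fun i => c.dbaseSymm (c.base (π w.pt)) (stdFrame m i))
    have h2 : exteriorPower.ιMulti ℝ m
        (fun i => (Ψ w).lin (c.dbaseSymm (c.base (π w.pt)) (stdFrame m i))) =
        stdVol m (fun i => c.dbaseSymm (c.base (π w.pt)) (stdFrame m i)) •
          exteriorPower.ιMulti ℝ m (fun i => (Ψ w).lin (stdFrame m i)) := h1
    rw [h2, smul_smul, unitMultiField]
    congr 1
    have h3 := c.vol_apply (vol := vol) hx (fun i => c.dbaseSymm (c.base (π w.pt)) (stdFrame m i))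
    simp only [c.dbase_dbaseSymm_apply hx] at h3
    have h4 : stdVol m (fun i => stdFrame m i) = 1 := stdVol_frame
    have h5 := DFunLike.congr_fun (eq_smul_stdVol (vol (π w.pt)))
      (fun i => c.dbaseSymm (c.base (π w.pt)) (stdFrame m i))
    rw [h3, h4, mul_one] at h5
    have hb : (c.nat w).1 = c.base (π w.pt) := c.fst_tot _ hw
    have hne := c.density_ne_zero hvol.2 (c.base.map_source hx)
    change (vol (π w.pt) (stdFrame m))⁻¹ = (c.density vol (c.nat w).1)⁻¹ * _
    rw [hb]
    have h6 : c.density vol (c.base (π w.pt)) = vol (π w.pt) (stdFrame m) *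
      stdVol m (fun i => c.dbaseSymm (c.base (π w.pt)) (stdFrame m i)) := h5
    have hv := apply_stdFrame_ne_zero (hvol.2 (π w.pt))
    rw [h6] at hne ⊢
    have hs := right_ne_zero_of_mul hne
    field_simp

/-- The linear map with prescribed values on the standard frame. -/
def ofFrame {G : Type*} [NormedAddCommGroup G] [NormedSpace ℝ G] (v : Fin m → G) :
    Base m →L[ℝ] G :=
  ∑ i, slot i (v i)

theorem ofFrame_stdFrame {G : Type*} [NormedAddCommGroup G] [NormedSpace ℝ G] (v : Fin m → G)
    (i : Fin m) : ofFrame v (stdFrame m i) = v i := by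
  simp [ofFrame, _root_.sum_apply, slot_apply, stdFrame, Pi.single_apply]

theorem contMDiffAt_ofFrame {G : Type*} [NormedAddCommGroup G] [NormedSpace ℝ G]
    {v : Fin m → J1 (Base m) (Fib N) π → G}
    (hv : ∀ i, ContMDiffAt 𝓘(ℝ, TJ m N) 𝓘(ℝ, G) ∞ (v i) z) :
    ContMDiffAt 𝓘(ℝ, TJ m N) 𝓘(ℝ, Base m →L[ℝ] G) ∞ (fun w => ofFrame fun i => v i w) z := by
  unfold ofFrame
  refine ContMDiffAt.sum fun i _ => ?_
  exact (slot i).contDiff.contMDiff.contMDiffAt.comp z (hv i)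

theorem exists_equiv_of_stdVol_ne_zero {T : Base m →L[ℝ] Base m}
    (h : stdVol m (fun i => T (stdFrame m i)) ≠ 0) :
    ∃ e : Base m ≃L[ℝ] Base m, (e : Base m →L[ℝ] Base m) = T := by
  have hdet : LinearMap.det (T : Base m →ₗ[ℝ] Base m) ≠ 0 := by
    rw [← LinearMap.det_toMatrix']
    rw [stdVol_apply, ← Matrix.det_transpose] at h
    convert h using 2
    ext i j
    simp [LinearMap.toMatrix'_apply, stdFrame, Matrix.transpose_apply]
  exact ⟨(LinearEquiv.ofIsUnitDet (f := (T : Base m →ₗ[ℝ] Base m))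
    (v := Pi.basisFun ℝ (Fin m)) (v' := Pi.basisFun ℝ (Fin m))
    (by simpa using hdet)).toContinuousLinearEquiv, by ext; rfl⟩

theorem TransverseOn.stdVol_ne_zero (h : TransverseOn U X) (hz : z ∈ U) {Y : Fin m → TJ m N}
    (hY : X z = exteriorPower.ιMulti ℝ m Y) : stdVol m (fun i => dbar z (Y i)) ≠ 0 := by
  have h0 : stdVol m ≠ 0 := by
    intro h0
    have := stdVol_frame (m := m)
    rw [h0] at this
    exact zero_ne_one this
  have h1 := h z hz (stdVol m) h0
  rw [contractTop_ne_zero_iff, hY, pair_ιMulti] at h1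
  exact h1

/-- Under the hypothesis the projections of the `Y i` form a basis of the tangent space of the base,
and the section is the inverse of the projection on their span. -/
theorem exists_jet_of_frame {Y : Fin m → TJ m N} (h : stdVol m (fun i => dbar z (Y i)) ≠ 0) :
    ∃ j : SecondJetAt z, (∀ i, j.lin (dbar z (Y i)) = Y i) ∧
      ∃ r : ℝ, r ≠ 0 ∧ exteriorPower.ιMulti ℝ m Y =
        r • exteriorPower.ιMulti ℝ m (fun i => j.lin (stdFrame m i)) := by
  obtain ⟨e, he⟩ := exists_equiv_of_stdVol_ne_zero (T := ofFrame fun i => dbar z (Y i)) (by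
    simpa only [ofFrame_stdFrame] using h)
  have h1 : (dbar z).comp (ofFrame Y) = e := by
    rw [he]
    exact clm_base_ext fun i => by simp [ofFrame_stdFrame]
  have h2 : ∀ i, e (stdFrame m i) = dbar z (Y i) := fun i => by
    have := DFunLike.congr_fun h1 (stdFrame m i)
    simpa [ofFrame_stdFrame] using this.symm
  let j : SecondJetAt z := ⟨(ofFrame Y).comp (e.symm : Base m →L[ℝ] Base m), by
    change (dbar z).comp _ = _
    rw [← ContinuousLinearMap.comp_assoc, h1]
    ext1 a
    simp⟩
  have h3 : ∀ i, j.lin (dbar z (Y i)) = Y i := by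
    intro i
    change ofFrame Y (e.symm (dbar z (Y i))) = _
    rw [← h2, e.symm_apply_apply, ofFrame_stdFrame]
  refine ⟨j, h3, _, h, ?_⟩
  have h4 := alternating_base_eq ((exteriorPower.ιMulti ℝ m).compLinearMap
    (j.lin : Base m →ₗ[ℝ] TJ m N)) (fun i => dbar z (Y i))
  have h5 : exteriorPower.ιMulti ℝ m (fun i => j.lin (dbar z (Y i))) = _ := h4
  simp only [h3] at h5
  exact h5

/-- The slope K satisfies K ∘ T = S, where T and S collect the base and fibre components of the
frame. For invertible T this is a formula for K, which yields its smoothness. -/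
theorem coordV_comp_of_frame (c : AdaptedChart (Base m) (Fib N) π) (hc : z ∈ c.nat.source)
    {Y : Fin m → TJ m N} {j : SecondJetAt z} (hj : ∀ i, j.lin (dbar z (Y i)) = Y i) :
    (c.prolong.coordV ⟨z, j⟩).comp (ofFrame fun i => (c.prolong.dtot z (Y i)).1) =
      ofFrame fun i => (c.prolong.dtot z (Y i)).2 := by
  refine clm_base_ext fun i => ?_
  simp only [ContinuousLinearMap.comp_apply, ofFrame_stdFrame]
  have h := c.prolong.dtot_lin (z := ⟨z, j⟩) hc (dbar z (Y i))
  have h' : c.prolong.dtot z (j.lin (dbar z (Y i))) =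
    (c.dbase (π z.pt) (dbar z (Y i)),
      c.prolong.coordV ⟨z, j⟩ (c.dbase (π z.pt) (dbar z (Y i)))) := h
  rw [hj, c.dbase_dbar hc] at h'
  exact (congrArg Prod.snd h').symm

theorem AdaptedChart.stdVol_dtot (c : AdaptedChart (Base m) (Fib N) π) (hc : z ∈ c.nat.source)
    (Y : Fin m → TJ m N) : stdVol m (fun i => (c.prolong.dtot z (Y i)).1) =
      stdVol m (fun i => dbar z (Y i)) *
        stdVol m (fun i => c.dbase (π z.pt) (stdFrame m i)) := by
  simp only [← c.dbase_dbar hc]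
  exact stdVol_map _ _

theorem exists_jetField (hU : IsOpen U) (hX : LocallyDecomposableOn U X) (hT : TransverseOn U X) :
    ∃ Ψ : JetSection m N π, IsJetFieldOn U Ψ ∧ AssociatedOn U X Ψ := by
  have hex : ∀ z : J1 (Base m) (Fib N) π, ∃ j : SecondJetAt z, z ∈ U → ∃ r : ℝ, r ≠ 0 ∧
      X z = r • exteriorPower.ιMulti ℝ m (fun i => j.lin (stdFrame m i)) := by
    intro z
    by_cases hz : z ∈ U
    · obtain ⟨V, -, -, hzV, Y, -, hXY⟩ := hX z hz
      obtain ⟨j, -, r, hr, h⟩ := exists_jet_of_frame (hT.stdVol_ne_zero hz (hXY z hzV))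
      exact ⟨j, fun _ => ⟨r, hr, (hXY z hzV).trans h⟩⟩
    -- Outside of `U` the value is irrelevant, and an arbitrary jet is taken.
    · obtain ⟨j⟩ := JetAt.nonempty (B := Base m) (F := Fib N × (Base m →L[ℝ] Fib N))
        (J1.base : J1 (Base m) (Fib N) π → M) z
      exact ⟨j, fun h => absurd h hz⟩
  choose Ψ hΨ using hex
  have hass : AssociatedOn U X Ψ := fun z hz => (associated_iff (Ψ z) (X z)).2 (hΨ z hz)
  refine ⟨Ψ, (isJetFieldOn_iff hU).2 fun z hz => ?_, hass⟩
  obtain ⟨c, hc⟩ : ∃ c : AdaptedChart (Base m) (Fib N) π, z ∈ c.nat.source :=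
    FibredManifold.exists_adapted (B := Base m) (F := Fib N) (π := π) z.pt
  refine ⟨c, hc, ?_⟩
  obtain ⟨V, hVU, hV, hzV, Y, hY, hXY⟩ := hX z hz
  have hYz : ∀ i, ContMDiffAt 𝓘(ℝ, TJ m N) 𝓘(ℝ, TJ m N) ∞
      (fun w => c.prolong.dtot w (Y i w)) z := fun i =>
    (contMDiffAt_vectorField_iff c hc).1 ((hY i).contMDiffAt (hV.mem_nhds hzV))
  -- The jets were chosen pointwise, possibly from other decompositions. By uniqueness of the
  -- section they also fit the smooth frame `Y` on all of `V`.
  have hlin : ∀ w ∈ V, ∀ i, (Ψ w).lin (dbar w (Y i w)) = Y i w := by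
    intro w hw
    obtain ⟨j, hj, r, hr, h⟩ := exists_jet_of_frame (hT.stdVol_ne_zero (hVU hw) (hXY w hw))
    have h1 := (associated_iff j (X w)).2 ⟨r, hr, (hXY w hw).trans h⟩
    have h2 : (Ψ w).lin = j.lin := section_ext_of_mem_range (Ψ w).dproj_comp j.dproj_comp h1.1
      (hass w (hVU hw)).2 h1.2
    rwa [h2]
  let T : J1 (Base m) (Fib N) π → Base m →L[ℝ] Base m := fun w =>
    ofFrame fun i => (c.prolong.dtot w (Y i w)).1
  have hTe : ∀ w ∈ V ∩ c.nat.source, ∃ e : Base m ≃L[ℝ] Base m,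
      (e : Base m →L[ℝ] Base m) = T w := by
    rintro w ⟨hwV, hwc⟩
    refine exists_equiv_of_stdVol_ne_zero ?_
    simp only [T, ofFrame_stdFrame]
    rw [c.stdVol_dtot hwc]
    exact mul_ne_zero (hT.stdVol_ne_zero (hVU hwV) (hXY w hwV))
      (c.stdVol_dbase_frame_ne_zero (c.mapsTo _ hwc))
  have hTs : ContMDiffAt 𝓘(ℝ, TJ m N) 𝓘(ℝ, Base m →L[ℝ] Base m) ∞ T z :=
    contMDiffAt_ofFrame fun i => contDiff_fst.contMDiff.contMDiffAt.comp z (hYz i)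
  have hSs : ContMDiffAt 𝓘(ℝ, TJ m N) 𝓘(ℝ, Base m →L[ℝ] Fib N × (Base m →L[ℝ] Fib N)) ∞
      (fun w => ofFrame fun i => (c.prolong.dtot w (Y i w)).2) z :=
    contMDiffAt_ofFrame fun i => contDiff_snd.contMDiff.contMDiffAt.comp z (hYz i)
  -- Inversion of operators is smooth at an invertible one, and transversality makes `T` invertible.
  have hInv : ContMDiffAt 𝓘(ℝ, TJ m N) 𝓘(ℝ, Base m →L[ℝ] Base m) ∞
      (fun w => ContinuousLinearMap.inverse (T w)) z := by
    obtain ⟨e, he⟩ := hTe z ⟨hzV, hc⟩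
    have h1 : ContDiffAt ℝ ∞ (ContinuousLinearMap.inverse :
        (Base m →L[ℝ] Base m) → (Base m →L[ℝ] Base m)) (T z) := by
      rw [← he]; exact contDiffAt_map_inverse e
    exact h1.contMDiffAt.comp z hTs
  refine (hSs.clm_comp hInv).congr_of_eventuallyEq ?_
  filter_upwards [hV.mem_nhds hzV, c.nat.open_source.mem_nhds hc] with w hwV hwc
  rw [← coordV_comp_of_frame c hwc (hlin w hwV)]
  obtain ⟨e, he⟩ := hTe w ⟨hwV, hwc⟩
  change _ = (ContinuousLinearMap.comp _ (T w)).comp (ContinuousLinearMap.inverse (T w))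
  rw [← he, ContinuousLinearMap.inverse_equiv]
  ext1 a
  simp

-- Both fields are sections of one line bundle, so `f` is the quotient of their pairings with the
-- pulled back `stdVol`. The pairings need not be smooth, as they depend on preferred charts of the
-- base. In a natural chart both change by the same Jacobian factor, which cancels in the quotient.
set_option maxHeartbeats 1000000 in
theorem sameClassOn_of_associatedOn (hX : LocallyDecomposableOn U X)
    (hX' : LocallyDecomposableOn U X') (h : AssociatedOn U X Ψ) (h' : AssociatedOn U X' Ψ) :
    SameClassOn U X X' := by
  have hp : ∀ (X : MultiField m N π) {z}, z ∈ U → AssociatedOn U X Ψ →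
      pair ((stdVol m).compContinuousLinearMap (dbar z)) (X z) ≠ 0 ∧
      X z = pair ((stdVol m).compContinuousLinearMap (dbar z)) (X z) •
        exteriorPower.ιMulti ℝ m (fun i => (Ψ z).lin (stdFrame m i)) := by
    intro X z hz h
    obtain ⟨r, hr, hX⟩ := h.exists_smul hz
    have : pair ((stdVol m).compContinuousLinearMap (dbar z)) (X z) = r := by
      rw [hX, map_smul, pair_frame, stdVol_frame]; simp
    rw [this]
    exact ⟨hr, hX⟩
  refine ⟨fun z => pair ((stdVol m).compContinuousLinearMap (dbar z)) (X' z) /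
    pair ((stdVol m).compContinuousLinearMap (dbar z)) (X z), ?_, ?_⟩
  · intro z hz
    refine ContMDiffAt.contMDiffWithinAt ?_
    obtain ⟨c, hc⟩ : ∃ c : AdaptedChart (Base m) (Fib N) π, z ∈ c.nat.source :=
      FibredManifold.exists_adapted (B := Base m) (F := Fib N) (π := π) z.pt
    obtain ⟨V, hVU, hV, hzV, Y, hY, hXY⟩ := hX z hz
    obtain ⟨V', hVU', hV', hzV', Y', hY', hXY'⟩ := hX' z hz
    have hsm : ∀ {Y : Fin m → J1 (Base m) (Fib N) π → TJ m N},
        (∀ i, ContMDiffAt 𝓘(ℝ, TJ m N) 𝓘(ℝ, TJ m N).tangent ∞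
          (fun w => (⟨w, Y i w⟩ : TangentBundle 𝓘(ℝ, TJ m N) (J1 (Base m) (Fib N) π))) z) →
        ContMDiffAt 𝓘(ℝ, TJ m N) 𝓘(ℝ, ℝ) ∞
          (fun w => stdVol m (fun i => (c.prolong.dtot w (Y i w)).1)) z := by
      intro Y hY
      have h1 : ContMDiffAt 𝓘(ℝ, TJ m N) 𝓘(ℝ, Fin m → Base m) ∞
          (fun w => fun i => (c.prolong.dtot w (Y i w)).1) z :=
        contMDiffAt_pi_space.2 fun i => contDiff_fst.contMDiff.contMDiffAt.comp z
          ((contMDiffAt_vectorField_iff c hc).1 (hY i))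
      exact (stdVol m).toContinuousMultilinearMap.contDiff.contMDiff.contMDiffAt.comp z h1
    have hne : stdVol m (fun i => (c.prolong.dtot z (Y i z)).1) ≠ 0 := by
      rw [c.stdVol_dtot hc]
      exact mul_ne_zero (h.transverseOn.stdVol_ne_zero hz (hXY z hzV))
        (c.stdVol_dbase_frame_ne_zero (c.mapsTo _ hc))
    have h1 := (hsm fun i => (hY' i).contMDiffAt (hV'.mem_nhds hzV')).div₀
      (hsm fun i => (hY i).contMDiffAt (hV.mem_nhds hzV)) hne
    refine h1.congr_of_eventuallyEq ?_
    filter_upwards [hV.mem_nhds hzV, hV'.mem_nhds hzV', c.nat.open_source.mem_nhds hc]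
      with w hw hw' hwc
    rw [hXY w hw, hXY' w hw', pair_ιMulti, pair_ιMulti]
    have hne' := c.stdVol_dbase_frame_ne_zero (c.mapsTo _ hwc)
    change _ = stdVol m (fun i => (c.prolong.dtot w (Y' i w)).1) /
      stdVol m (fun i => (c.prolong.dtot w (Y i w)).1)
    rw [c.stdVol_dtot hwc, c.stdVol_dtot hwc, mul_div_mul_right _ _ hne']
    rfl
  · intro z hz
    beta_reduce
    have h12 := hp X hz h
    have h34 := hp X' hz h'
    have h1 := h12.1
    have h2 := h12.2
    have h3 := h34.1
    have h4 := h34.2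
    clear h12 h34 hp
    generalize pair ((stdVol m).compContinuousLinearMap (dbar z)) (X z) = p at h1 h2 ⊢
    generalize pair ((stdVol m).compContinuousLinearMap (dbar z)) (X' z) = p' at h3 h4 ⊢
    refine ⟨div_ne_zero h3 h1, ?_⟩
    rw [h2, h4, smul_smul, div_mul_cancel₀ _ h1]

theorem SameClassOn.locallyDecomposableOn (hm : 1 ≤ m) (hX : LocallyDecomposableOn U X)
    (h : SameClassOn U X X') : LocallyDecomposableOn U X' := by
  obtain ⟨f, hf, hfX⟩ := h
  refine locallyDecomposableOn_of_smul hm fun z hz => ?_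
  obtain ⟨V, hVU, hV, hzV, Y, hY, hXY⟩ := hX z hz
  refine ⟨V, hVU, hV, hzV, f, Y, fun w hw => (hf.mono hVU).contMDiffAt (hV.mem_nhds hw),
    fun i w hw => (hY i).contMDiffAt (hV.mem_nhds hw), fun w hw => ?_⟩
  rw [(hfX w (hVU hw)).2, hXY w hw]

theorem SameClassOn.associatedOn (hX : AssociatedOn U X Ψ) (h : SameClassOn U X X') :
    AssociatedOn U X' Ψ := by
  obtain ⟨f, -, hfX⟩ := h
  intro z hz
  obtain ⟨hf, hz'⟩ := hfX z hz
  rw [hz']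
  exact ⟨smul_ne_zero hf (hX z hz).1, Submodule.smul_mem _ _ (hX z hz).2⟩

/-! ### Equivalence of the three equations, and the SOPDE property of their solutions. -/

section Equations

variable [IsManifold 𝓘(ℝ, Base m) ∞ M] {L : J1 (Base m) (Fib N) π → ℝ}

theorem AssociatedOn.multiEqOn_iff (h : AssociatedOn U X Ψ) :
    MultiEqOn U vol L X ↔ JetEqOn U vol L Ψ := by
  refine forall₂_congr fun z hz => ?_
  obtain ⟨r, hr, hX⟩ := h.exists_smul hz
  rw [horizontal_eq_iff_all (b := dbar z) (Ψ z).dproj_comp]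
  simp only [hX]
  exact forall_congr' fun u => contract_eq_zero_iff _ _ hr u

theorem jetEqOn_iff_connEqOn (hvol : IsVolumeForm vol)
    (hL : ContMDiff 𝓘(ℝ, TJ m N) 𝓘(ℝ, ℝ) ∞ L) : JetEqOn U vol L Ψ ↔ ConnEqOn U vol L Ψ := by
  refine forall₂_congr fun z hz => ?_
  obtain ⟨c, hc⟩ : ∃ c : AdaptedChart (Base m) (Fib N) π, z ∈ c.nat.source :=
    FibredManifold.exists_adapted (B := Base m) (F := Fib N) (π := π) z.pt
  exact connection_eq_iff (b := dbar z) (Ψ z).dproj_comp fun w i j k hij hik hjk hi hj hk =>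
    c.Omega_three_vertical hvol hL hc w hij hik hjk hi hj hk

theorem JetEqOn.dpt_comp_lin (hvol : IsVolumeForm vol)
    (hL : ContMDiff 𝓘(ℝ, TJ m N) 𝓘(ℝ, ℝ) ∞ L) (hreg : IsRegular vol L)
    (h : JetEqOn U vol L Ψ) (hz : z ∈ U) : (dpt z).comp (Ψ z).lin = z.lin := by
  obtain ⟨c, hc⟩ : ∃ c : AdaptedChart (Base m) (Fib N) π, z ∈ c.nat.source :=
    FibredManifold.exists_adapted (B := Base m) (F := Fib N) (π := π) z.pt
  exact (c.dpt_comp_lin_iff hc (Ψ z)).2 ((c.jetEq_iff hvol hL hreg hc (Ψ z)).1 (h z hz)).1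

theorem JetEqOn.jetSopdeOn (hvol : IsVolumeForm vol)
    (hL : ContMDiff 𝓘(ℝ, TJ m N) 𝓘(ℝ, ℝ) ∞ L) (hreg : IsRegular vol L)
    (h : JetEqOn U vol L Ψ) : JetSopdeOn U Ψ := fun _ hz =>
  J1.ext' rfl (h.dpt_comp_lin hvol hL hreg hz)

theorem JetEqOn.sopdeOn (hvol : IsVolumeForm vol)
    (hL : ContMDiff 𝓘(ℝ, TJ m N) 𝓘(ℝ, ℝ) ∞ L) (hreg : IsRegular vol L)
    (h : JetEqOn U vol L Ψ) (hX : AssociatedOn U X Ψ) : SopdeOn U X := by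
  intro z hz
  obtain ⟨r, hr, hXz⟩ := hX.exists_smul hz
  have h1 := h.dpt_comp_lin hvol hL hreg hz
  rw [hXz, map_smul, map_smul, exteriorPower.map_apply_ιMulti, exteriorPower.map_apply_ιMulti]
  congr 2
  funext i
  change z.lin (dbar z ((Ψ z).lin (stdFrame m i))) = dpt z ((Ψ z).lin (stdFrame m i))
  rw [dbar_lin, ← h1]
  rfl

end Equations

end Correspondence

/-! ### Underdetermined linear systems with smooth coefficients, solved by Cramer's rule. -/

section LinearAlgebra

/-- Independent rows give rank `N`, so the columns span the whole space and `N` of them form a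
basis. -/
theorem exists_submatrix_det_ne_zero {N : ℕ} {J : Type} [Fintype J] [DecidableEq J]
    (W : Matrix (Fin N) J ℝ) (hW : ∀ y, Matrix.vecMul y W = 0 → y = 0) :
    ∃ f : Fin N → J, Function.Injective f ∧ (W.submatrix id f).det ≠ 0 := by
  have hli : LinearIndependent ℝ W.row := by
    rw [← Matrix.vecMul_injective_iff]
    intro y y' h
    have h0 := hW (y - y') (by rw [Matrix.sub_vecMul]; exact sub_eq_zero.2 h)
    exact sub_eq_zero.1 h0
  have hr : Module.finrank ℝ (Submodule.span ℝ (Set.range W.col)) = N := by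
    rw [← Matrix.rank_eq_finrank_span_cols, hli.rank_matrix, Fintype.card_fin]
  have htop : Submodule.span ℝ (Set.range W.col) = ⊤ :=
    Submodule.eq_top_of_finrank_eq (by rw [hr]; simp)
  obtain ⟨κ, a, ha, hspan, hind⟩ := exists_linearIndependent' ℝ W.col
  have : Fintype κ := Fintype.ofInjective a ha
  have hcard : Fintype.card κ = N := by
    have h1 := finrank_span_eq_card hind
    rw [hspan, hr] at h1
    exact h1.symm
  let e : Fin N ≃ κ := (Fintype.equivFinOfCardEq hcard).symm
  refine ⟨a ∘ e, ha.comp e.injective, ?_⟩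
  have h1 : LinearIndependent ℝ (W.submatrix id (a ∘ e)).col := hind.comp e e.injective
  rw [Matrix.linearIndependent_cols_iff_isUnit, Matrix.isUnit_iff_isUnit_det] at h1
  exact h1.ne_zero

variable {N : ℕ} {J : Type} [Fintype J] [DecidableEq J] (W : Matrix (Fin N) J ℝ) (f : Fin N → J)

/-- The right hand side that remains for the unknowns in the range of `f`. -/
def reducedRhs (r : Fin N → ℝ) (g : J → ℝ) : Fin N → ℝ := fun B =>
  r B - ∑ s ∈ Finset.univ \ Finset.univ.image f, W B s * g s

open Classical in
/-- The solution of `W G = r` with `G = g` outside of the range of `f`, by Cramer's rule. -/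
def partialSolve (r : Fin N → ℝ) (g : J → ℝ) : J → ℝ := fun s =>
  if h : ∃ i, f i = s then
    ((W.submatrix id f).updateCol h.choose (reducedRhs W f r g)).det / (W.submatrix id f).det
  else g s

variable {W f}

theorem partialSolve_apply (hf : Function.Injective f) (r : Fin N → ℝ) (g : J → ℝ) (i : Fin N) :
    partialSolve W f r g (f i) =
      ((W.submatrix id f).updateCol i (reducedRhs W f r g)).det / (W.submatrix id f).det := by
  have h : ∃ i', f i' = f i := ⟨i, rfl⟩
  unfold partialSolve
  rw [dif_pos h, hf h.choose_spec]

theorem partialSolve_of_mem (r : Fin N → ℝ) (g : J → ℝ) {s : J}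
    (hs : s ∈ Finset.univ \ Finset.univ.image f) : partialSolve W f r g s = g s := by
  unfold partialSolve
  rw [dif_neg]
  rintro ⟨i, rfl⟩
  simp at hs

theorem sum_eq_sum_sdiff_add (hf : Function.Injective f) (F : J → ℝ) :
    ∑ s, F s = ∑ s ∈ Finset.univ \ Finset.univ.image f, F s + ∑ i, F (f i) := by
  rw [← Finset.sum_sdiff (Finset.subset_univ (Finset.univ.image f)),
    Finset.sum_image fun i _ j _ h => hf h]

theorem sum_mul_partialSolve (hf : Function.Injective f) (hd : (W.submatrix id f).det ≠ 0)
    (r : Fin N → ℝ) (g : J → ℝ) (B : Fin N) : ∑ s, W B s * partialSolve W f r g s = r B := by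
  rw [sum_eq_sum_sdiff_add hf]
  have h1 : ∑ s ∈ Finset.univ \ Finset.univ.image f, W B s * partialSolve W f r g s =
      ∑ s ∈ Finset.univ \ Finset.univ.image f, W B s * g s :=
    Finset.sum_congr rfl fun s hs => by rw [partialSolve_of_mem r g hs]
  have h2 := congrFun (Matrix.mulVec_cramer (W.submatrix id f) (reducedRhs W f r g)) B
  have h3 : ∑ i, W B (f i) * ((W.submatrix id f).updateCol i (reducedRhs W f r g)).det =
      (W.submatrix id f).det * reducedRhs W f r g B := by
    simpa [Matrix.mulVec, dotProduct, Matrix.cramer_apply] using h2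
  have h4 : ∑ i, W B (f i) * partialSolve W f r g (f i) = reducedRhs W f r g B := by
    simp only [partialSolve_apply hf, ← mul_div_assoc]
    rw [← Finset.sum_div, h3, mul_div_cancel_left₀ _ hd]
  rw [h1, h4, reducedRhs]
  ring

/-- The difference of the two solutions is supported on the range of `f`, where the invertible minor
kills it. -/
theorem eq_of_sum_mul_eq (hf : Function.Injective f) (hd : (W.submatrix id f).det ≠ 0)
    {G G' : J → ℝ} (h : ∀ B, ∑ s, W B s * G s = ∑ s, W B s * G' s)
    (hs : ∀ s ∈ Finset.univ \ Finset.univ.image f, G s = G' s) : G = G' := by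
  have h1 : (W.submatrix id f).mulVec (fun i => G (f i) - G' (f i)) = 0 := by
    funext B
    have h2 := h B
    rw [sum_eq_sum_sdiff_add hf, sum_eq_sum_sdiff_add hf,
      Finset.sum_congr rfl fun s hs' => by rw [hs s hs'], add_right_inj] at h2
    simp only [Matrix.mulVec, dotProduct, Matrix.submatrix_apply, id, mul_sub,
      Finset.sum_sub_distrib, h2, sub_self, Pi.zero_apply]
  have h2 := Matrix.eq_zero_of_mulVec_eq_zero hd h1
  funext s
  by_cases hs' : s ∈ Finset.univ.image f
  · obtain ⟨i, -, rfl⟩ := Finset.mem_image.1 hs'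
    exact sub_eq_zero.1 (congrFun h2 i)
  · exact hs s (by simpa using hs')

variable {X V H : Type*} [TopologicalSpace X] [TopologicalSpace H] [ChartedSpace H X]
  [NormedAddCommGroup V] [NormedSpace ℝ V] {I : ModelWithCorners ℝ V H} {x : X}

theorem contMDiffAt_det {n : Type*} [Fintype n] [DecidableEq n] {A : X → Matrix n n ℝ}
    (hA : ∀ i j, ContMDiffAt I 𝓘(ℝ, ℝ) ∞ (fun x => A x i j) x) :
    ContMDiffAt I 𝓘(ℝ, ℝ) ∞ (fun x => (A x).det) x := by
  simp only [Matrix.det_apply']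
  refine ContMDiffAt.sum fun σ _ => ?_
  exact contMDiffAt_const.mul (contMDiffAt_finsetProd fun i _ => hA _ _)

/-- The solution is a quotient of determinants with nonzero denominator at the point. Smoothness of
`g` is asked for the free indices only, as the others never enter. -/
theorem contMDiffAt_partialSolve (hf : Function.Injective f) {W : X → Matrix (Fin N) J ℝ}
    {r : X → Fin N → ℝ} {g : X → J → ℝ} (hd : ((W x).submatrix id f).det ≠ 0)
    (hW : ∀ B s, ContMDiffAt I 𝓘(ℝ, ℝ) ∞ (fun x => W x B s) x)
    (hr : ∀ B, ContMDiffAt I 𝓘(ℝ, ℝ) ∞ (fun x => r x B) x)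
    (hg : ∀ s ∈ Finset.univ \ Finset.univ.image f, ContMDiffAt I 𝓘(ℝ, ℝ) ∞ (fun x => g x s) x)
    (s : J) : ContMDiffAt I 𝓘(ℝ, ℝ) ∞ (fun x => partialSolve (W x) f (r x) (g x) s) x := by
  by_cases hs : s ∈ Finset.univ.image f
  · obtain ⟨i, -, rfl⟩ := Finset.mem_image.1 hs
    simp only [partialSolve_apply hf]
    refine (contMDiffAt_det fun B k => ?_).div₀ (contMDiffAt_det fun B k => hW _ _) hd
    rcases eq_or_ne k i with rfl | hk
    · simp only [Matrix.updateCol_self, reducedRhs]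
      exact (hr B).sub (ContMDiffAt.sum fun s hs => (hW B s).mul (hg s hs))
    · simp only [Matrix.updateCol_ne hk, Matrix.submatrix_apply]
      exact hW _ _
  · have hs' : s ∈ Finset.univ \ Finset.univ.image f := by simpa using hs
    simp only [partialSolve_of_mem _ _ hs']
    exact hg s hs'

end LinearAlgebra

/-! ### The Euler–Lagrange equations as a linear system for the coefficients G. -/

section ModelEquation

variable {m N : ℕ} (ℓ : TJ m N → ℝ) (q : TJ m N)

/-- The coefficients of the second order derivatives in the Euler-Lagrange equations. -/
def elMatrix : Matrix (Fin N) (Fin N × Fin m × Fin m) ℝ := fun B s =>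
  fderiv ℝ (fderiv ℝ ℓ) q (vertInj m N (slot s.2.2 (stdFrame N s.1)))
    (vertInj m N (slot s.2.1 (stdFrame N B)))

/-- The terms of lower order in the Euler-Lagrange equations. -/
def elRhs : Fin N → ℝ := fun B =>
  fderiv ℝ ℓ q (0, stdFrame N B, 0) -
    ∑ μ, fderiv ℝ (fderiv ℝ ℓ) q (stdFrame m μ, q.2.2 (stdFrame m μ), 0)
      (vertInj m N (slot μ (stdFrame N B)))

/-- The coefficient `G^A_{μρ}`, for `s = (A, μ, ρ)`. -/
def slopeCoef (K : Base m →L[ℝ] Fib N × (Base m →L[ℝ] Fib N)) (s : Fin N × Fin m × Fin m) : ℝ :=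
  (K (stdFrame m s.2.1)).2 (stdFrame m s.2.2) s.1

/-- The slope with given coefficients. -/
def mkSlope (v : Base m →L[ℝ] Fib N) (G : Fin N × Fin m × Fin m → ℝ) :
    Base m →L[ℝ] Fib N × (Base m →L[ℝ] Fib N) :=
  ofFrame fun μ => (v (stdFrame m μ), ofFrame fun ρ => fun A => G (A, μ, ρ))

theorem fst_mkSlope (v : Base m →L[ℝ] Fib N) (G : Fin N × Fin m × Fin m → ℝ) :
    (ContinuousLinearMap.fst ℝ _ _).comp (mkSlope v G) = v :=
  clm_base_ext fun i => by simp [mkSlope, ofFrame_stdFrame]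

theorem slopeCoef_mkSlope (v : Base m →L[ℝ] Fib N) (G : Fin N × Fin m × Fin m → ℝ) :
    slopeCoef (mkSlope v G) = G := by
  funext s
  simp [slopeCoef, mkSlope, ofFrame_stdFrame]

theorem slope_ext {K K' : Base m →L[ℝ] Fib N × (Base m →L[ℝ] Fib N)}
    (h : (ContinuousLinearMap.fst ℝ _ _).comp K = (ContinuousLinearMap.fst ℝ _ _).comp K')
    (h' : slopeCoef K = slopeCoef K') : K = K' := by
  refine clm_base_ext fun μ => Prod.ext (DFunLike.congr_fun h _) (clm_base_ext fun ρ => ?_)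
  funext A
  exact congrFun h' (A, μ, ρ)

variable {ℓ q}

theorem vertInj_snd_slope (K : Base m →L[ℝ] Fib N × (Base m →L[ℝ] Fib N)) (μ : Fin m) :
    vertInj m N (K (stdFrame m μ)).2 =
      ∑ A, ∑ ρ, slopeCoef K (A, μ, ρ) • vertInj m N (slot ρ (stdFrame N A)) := by
  rw [Finset.sum_comm]
  conv_lhs => rw [← sum_slot (K (stdFrame m μ)).2, map_sum]
  refine Finset.sum_congr rfl fun ρ _ => ?_
  conv_lhs => rw [base_eq_sum ((K (stdFrame m μ)).2 (stdFrame m ρ))]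
  rw [map_sum, map_sum]
  refine Finset.sum_congr rfl fun A _ => ?_
  rw [map_smul, map_smul]
  rfl

/-- Once F = v, the lift of a coordinate vector is a known vector plus a fibre vector that is linear
in G. The known part goes to the right hand side. By linearity in `b` it suffices to test basis
vectors. -/
theorem eulerLagrange_iff_coef (K : Base m →L[ℝ] Fib N × (Base m →L[ℝ] Fib N)) :
    EulerLagrange ℓ q K ↔ (ContinuousLinearMap.fst ℝ _ _).comp K = q.2.2 ∧
      ∀ B, ∑ s, elMatrix ℓ q B s * slopeCoef K s = elRhs ℓ q B := by
  refine and_congr_right fun hF => ?_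
  have hF' : ∀ a, (K a).1 = q.2.2 a := fun a => DFunLike.congr_fun hF a
  have key : ∀ B, ∑ μ, fderiv ℝ (fderiv ℝ ℓ) q (stdFrame m μ, K (stdFrame m μ))
      (vertInj m N (slot μ (stdFrame N B))) =
      ∑ μ, fderiv ℝ (fderiv ℝ ℓ) q (stdFrame m μ, q.2.2 (stdFrame m μ), 0)
        (vertInj m N (slot μ (stdFrame N B))) + ∑ s, elMatrix ℓ q B s * slopeCoef K s := by
    intro B
    rw [Fintype.sum_prod_type]
    simp only [Fintype.sum_prod_type]
    rw [Finset.sum_comm (s := (Finset.univ : Finset (Fin N))), ← Finset.sum_add_distrib]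
    refine Finset.sum_congr rfl fun μ _ => ?_
    have h1 : ((stdFrame m μ, K (stdFrame m μ)) : TJ m N) =
        (stdFrame m μ, q.2.2 (stdFrame m μ), 0) + vertInj m N (K (stdFrame m μ)).2 := by
      rw [vertInj_apply, ← hF']
      simp
    rw [h1, map_add, _root_.add_apply, vertInj_snd_slope]
    simp only [map_sum, _root_.sum_apply, map_smul, _root_.smul_apply, smul_eq_mul, elMatrix,
      mul_comm]
  constructor
  · intro h B
    rw [elRhs, ← h, key]
    ring
  · intro h b
    let T : Fib N →L[ℝ] ℝ := ∑ μ, (fderiv ℝ (fderiv ℝ ℓ) q (stdFrame m μ, K (stdFrame m μ))).comp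
      ((vertInj m N).comp (slot μ))
    let T' : Fib N →L[ℝ] ℝ := (fderiv ℝ ℓ q).comp ((ContinuousLinearMap.inr ℝ _ _).comp
      (ContinuousLinearMap.inl ℝ _ _))
    have hT : T = T' := by
      refine clm_base_ext fun B => ?_
      have h1 : T (stdFrame N B) = ∑ μ, fderiv ℝ (fderiv ℝ ℓ) q (stdFrame m μ, K (stdFrame m μ))
          (vertInj m N (slot μ (stdFrame N B))) := by
        simp [T, _root_.sum_apply]
      rw [h1, key, h B, elRhs]
      change _ = fderiv ℝ ℓ q (0, stdFrame N B, 0)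
      ring
    have h2 := DFunLike.congr_fun hT b
    simpa [T, T', _root_.sum_apply] using h2

/-- The columns with one fixed index `μ` suffice: if the combination `y` of the rows vanishes there,
then dx^μ ⊗ y lies in the kernel of the Hessian. An index `μ` exists since `1 ≤ m`. -/
theorem elMatrix_rows (hm : 1 ≤ m) (hℓ : ContDiffAt ℝ 2 ℓ q) (hn : HessNondeg ℓ q)
    (y : Fin N → ℝ) (hy : Matrix.vecMul y (elMatrix ℓ q) = 0) : y = 0 := by
  let μ : Fin m := ⟨0, hm⟩
  have h1 : ∀ w, fderiv ℝ (fderiv ℝ ℓ) q (vertInj m N w) (vertInj m N (slot μ y)) = 0 := by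
    have h2 : ∀ A ρ, fderiv ℝ (fderiv ℝ ℓ) q (vertInj m N (slot ρ (stdFrame N A)))
        (vertInj m N (slot μ y)) = 0 := by
      intro A ρ
      have h3 := congrFun hy (A, μ, ρ)
      conv_lhs => rw [base_eq_sum y]
      simp only [map_sum, map_smul]
      simpa [Matrix.vecMul, dotProduct, elMatrix] using h3
    intro w
    have h4 : vertInj m N w =
        ∑ ρ, ∑ A, w (stdFrame m ρ) A • vertInj m N (slot ρ (stdFrame N A)) := by
      conv_lhs => rw [← sum_slot w, map_sum]
      refine Finset.sum_congr rfl fun ρ _ => ?_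
      conv_lhs => rw [base_eq_sum (w (stdFrame m ρ))]
      simp only [map_sum, map_smul]
    rw [h4]
    simp [map_sum, _root_.sum_apply, h2]
  have h2 := hn (slot μ y) fun w => by rw [hess_symm hℓ]; exact h1 w
  have h3 := DFunLike.congr_fun h2 (stdFrame m μ)
  simpa [slot_apply, stdFrame] using h3

theorem convex_eulerLagrange (ℓ : TJ m N → ℝ) (q : TJ m N) : Convex ℝ {K | EulerLagrange ℓ q K} := by
  rintro K hK K' hK' a b - - hab
  rw [Set.mem_ofPred_eq, eulerLagrange_iff_coef] at *
  have h1 : ∀ s, slopeCoef (a • K + b • K') s = a * slopeCoef K s + b * slopeCoef K' s := by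
    intro s; simp [slopeCoef]
  refine ⟨?_, fun B => ?_⟩
  · rw [ContinuousLinearMap.comp_add, ContinuousLinearMap.comp_smul, ContinuousLinearMap.comp_smul,
      hK.1, hK'.1, ← add_smul, hab, one_smul]
  · simp only [h1, mul_add, Finset.sum_add_distrib, mul_left_comm _ a, mul_left_comm _ b]
    rw [← Finset.mul_sum, ← Finset.mul_sum, hK.2, hK'.2, ← add_mul, hab, one_mul]

end ModelEquation

/-! ### Local solutions with prescribed free coefficients, and global solutions. -/

section Solutions

variable {m N : ℕ} {M E : Type*} [TopologicalSpace M] [ChartedSpace (Base m) M]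
  [IsManifold 𝓘(ℝ, Base m) ∞ M] [TopologicalSpace E] [ChartedSpace (Base m × Fib N) E]
  {π : E → M} [FibredManifold (Base m) (Fib N) π]
  {z : J1 (Base m) (Fib N) π} {vol : M → Base m [⋀^Fin m]→L[ℝ] ℝ}
  {L : J1 (Base m) (Fib N) π → ℝ} {U : Set (J1 (Base m) (Fib N) π)}

theorem contDiffAt_fderiv_infty {V W : Type*} [NormedAddCommGroup V] [NormedSpace ℝ V]
    [NormedAddCommGroup W] [NormedSpace ℝ W] {f : V → W} {x : V} (hf : ContDiffAt ℝ ∞ f x) :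
    ContDiffAt ℝ ∞ (fderiv ℝ f) x :=
  hf.fderiv_right (by simp)

theorem contDiffAt_elMatrix {ℓ : TJ m N → ℝ} {q : TJ m N} (hℓ : ContDiffAt ℝ ∞ ℓ q) (B : Fin N)
    (s : Fin N × Fin m × Fin m) : ContDiffAt ℝ ∞ (fun q => elMatrix ℓ q B s) q :=
  ((contDiffAt_fderiv_infty (contDiffAt_fderiv_infty hℓ)).clm_apply contDiffAt_const).clm_apply
    contDiffAt_const

theorem contDiffAt_elRhs {ℓ : TJ m N → ℝ} {q : TJ m N} (hℓ : ContDiffAt ℝ ∞ ℓ q) (B : Fin N) :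
    ContDiffAt ℝ ∞ (fun q => elRhs ℓ q B) q := by
  refine ContDiffAt.sub ((contDiffAt_fderiv_infty hℓ).clm_apply contDiffAt_const)
    (ContDiffAt.sum fun μ _ => ?_)
  refine ContDiffAt.clm_apply ((contDiffAt_fderiv_infty (contDiffAt_fderiv_infty hℓ)).clm_apply ?_)
    contDiffAt_const
  have h : ContDiff ℝ ∞ fun q : TJ m N => q.2.2 (stdFrame m μ) :=
    (contDiff_snd.comp contDiff_snd).clm_apply contDiff_const
  exact (contDiff_const.prodMk (h.prodMk contDiff_const)).contDiffAt

namespace AdaptedChart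

variable (c : AdaptedChart (Base m) (Fib N) π)

theorem contMDiffAt_comp_nat {G : Type*} [NormedAddCommGroup G] [NormedSpace ℝ G]
    (hz : z ∈ c.nat.source) {h : TJ m N → G} (hh : ContDiffAt ℝ ∞ h (c.nat z)) :
    ContMDiffAt 𝓘(ℝ, TJ m N) 𝓘(ℝ, G) ∞ (fun w => h (c.nat w)) z :=
  hh.contMDiffAt.comp z (contMDiffAt_nat c hz)

theorem coordV_jetOfSlope (hz : z ∈ c.nat.source)
    (K : Base m →L[ℝ] Fib N × (Base m →L[ℝ] Fib N)) :
    c.prolong.coordV ⟨z, c.prolong.jetOfSlope z K⟩ = K :=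
  c.prolong.coordV_slope hz K _ (c.prolong.jetOfSlope_lin hz K)

theorem jetEqOn_iff (hvol : IsVolumeForm vol) (hL : ContMDiff 𝓘(ℝ, TJ m N) 𝓘(ℝ, ℝ) ∞ L)
    (hreg : IsRegular vol L) (hU : U ⊆ c.nat.source) {Ψ : JetSection m N π} :
    JetEqOn U vol L Ψ ↔
      ∀ z ∈ U, EulerLagrange (c.lagr vol L) (c.nat z) (c.prolong.coordV ⟨z, Ψ z⟩) :=
  forall₂_congr fun _ hz => c.jetEq_iff hvol hL hreg (hU hz) _

/-- The jet field whose slope solves the Euler-Lagrange equations, with given values of the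
coefficients outside of the range of `f`. -/
def localSolution (vol : M → Base m [⋀^Fin m]→L[ℝ] ℝ) (L : J1 (Base m) (Fib N) π → ℝ)
    (f : Fin N → Fin N × Fin m × Fin m)
    (g : Fin N × Fin m × Fin m → J1 (Base m) (Fib N) π → ℝ) : JetSection m N π := fun z =>
  c.prolong.jetOfSlope z (mkSlope (c.nat z).2.2
    (partialSolve (elMatrix (c.lagr vol L) (c.nat z)) f (elRhs (c.lagr vol L) (c.nat z))
      fun s => g s z))

variable {f : Fin N → Fin N × Fin m × Fin m}
  {g : Fin N × Fin m × Fin m → J1 (Base m) (Fib N) π → ℝ}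

theorem isJetFieldOn_localSolution (hvol : IsVolumeForm vol)
    (hL : ContMDiff 𝓘(ℝ, TJ m N) 𝓘(ℝ, ℝ) ∞ L) (hf : Function.Injective f) (hU : IsOpen U)
    (hUc : U ⊆ c.nat.source)
    (hd : ∀ z ∈ U, ((elMatrix (c.lagr vol L) (c.nat z)).submatrix id f).det ≠ 0)
    (hg : ∀ s ∈ Finset.univ \ Finset.univ.image f, ContMDiffOn 𝓘(ℝ, TJ m N) 𝓘(ℝ, ℝ) ∞ (g s) U) :
    IsJetFieldOn U (c.localSolution vol L f g) := by
  refine (isJetFieldOn_iff hU).2 fun z hz => ⟨c, hUc hz, ?_⟩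
  have hℓ := c.contDiffAt_lagr hvol.1 hL (c.nat.map_source (hUc hz))
  have hG := contMDiffAt_partialSolve (I := 𝓘(ℝ, TJ m N)) (x := z)
    (W := fun w => elMatrix (c.lagr vol L) (c.nat w))
    (r := fun w => elRhs (c.lagr vol L) (c.nat w)) (g := fun w s => g s w) hf (hd z hz)
    (fun B s => c.contMDiffAt_comp_nat (hUc hz) (contDiffAt_elMatrix hℓ B s))
    (fun B => c.contMDiffAt_comp_nat (hUc hz) (contDiffAt_elRhs hℓ B))
    fun s hs => (hg s hs).contMDiffAt (hU.mem_nhds hz)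
  have hv : ∀ μ, ContMDiffAt 𝓘(ℝ, TJ m N) 𝓘(ℝ, Fib N) ∞
      (fun w => (c.nat w).2.2 (stdFrame m μ)) z := fun μ =>
    c.contMDiffAt_comp_nat (h := fun q : TJ m N => q.2.2 (stdFrame m μ)) (hUc hz)
      ((contDiff_snd.comp contDiff_snd).clm_apply contDiff_const).contDiffAt
  have hK : ContMDiffAt 𝓘(ℝ, TJ m N) 𝓘(ℝ, Base m →L[ℝ] Fib N × (Base m →L[ℝ] Fib N)) ∞
      (fun w => mkSlope (c.nat w).2.2
        (partialSolve (elMatrix (c.lagr vol L) (c.nat w)) f (elRhs (c.lagr vol L) (c.nat w))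
          fun s => g s w)) z := by
    refine contMDiffAt_ofFrame fun μ => (hv μ).prodMk_space
      (contMDiffAt_ofFrame fun ρ => contMDiffAt_pi_space.2 fun A => hG (A, μ, ρ))
  refine hK.congr_of_eventuallyEq ?_
  filter_upwards [c.nat.open_source.mem_nhds (hUc hz)] with w hw
  exact c.coordV_jetOfSlope hw _

theorem jetEqOn_localSolution (hvol : IsVolumeForm vol)
    (hL : ContMDiff 𝓘(ℝ, TJ m N) 𝓘(ℝ, ℝ) ∞ L) (hreg : IsRegular vol L)
    (hf : Function.Injective f) (hUc : U ⊆ c.nat.source)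
    (hd : ∀ z ∈ U, ((elMatrix (c.lagr vol L) (c.nat z)).submatrix id f).det ≠ 0) :
    JetEqOn U vol L (c.localSolution vol L f g) := by
  refine (c.jetEqOn_iff hvol hL hreg hUc).2 fun z hz => ?_
  rw [localSolution, c.coordV_jetOfSlope (hUc hz), eulerLagrange_iff_coef, slopeCoef_mkSlope]
  exact ⟨fst_mkSlope _ _, sum_mul_partialSolve hf (hd z hz) _ _⟩

theorem coefG_localSolution (hz : z ∈ c.nat.source) {s : Fin N × Fin m × Fin m}
    (hs : s ∈ Finset.univ \ Finset.univ.image f) :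
    coefG c (c.localSolution vol L f g) s z = g s z := by
  change slopeCoef (c.prolong.coordV ⟨z, c.prolong.jetOfSlope z _⟩) s = _
  rw [c.coordV_jetOfSlope hz, slopeCoef_mkSlope, partialSolve_of_mem _ _ hs]

theorem jetEqOn_unique (hvol : IsVolumeForm vol)
    (hL : ContMDiff 𝓘(ℝ, TJ m N) 𝓘(ℝ, ℝ) ∞ L) (hreg : IsRegular vol L)
    (hf : Function.Injective f) (hUc : U ⊆ c.nat.source)
    (hd : ∀ z ∈ U, ((elMatrix (c.lagr vol L) (c.nat z)).submatrix id f).det ≠ 0)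
    {Ψ Ψ' : JetSection m N π} (hΨ : JetEqOn U vol L Ψ) (hΨ' : JetEqOn U vol L Ψ')
    (h : ∀ s ∈ Finset.univ \ Finset.univ.image f, ∀ z ∈ U, coefG c Ψ' s z = coefG c Ψ s z) :
    ∀ z ∈ U, Ψ' z = Ψ z := by
  intro z hz
  have h1 := (eulerLagrange_iff_coef _).1 ((c.jetEqOn_iff hvol hL hreg hUc).1 hΨ z hz)
  have h2 := (eulerLagrange_iff_coef _).1 ((c.jetEqOn_iff hvol hL hreg hUc).1 hΨ' z hz)
  refine c.prolong.coordV_injective (hUc hz) (slope_ext (h2.1.trans h1.1.symm) ?_)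
  exact eq_of_sum_mul_eq hf (hd z hz) (fun B => (h2.2 B).trans (h1.2 B).symm)
    fun s hs => h s hs z hz

/-- A minor that is nonzero at `z` stays nonzero nearby by continuity, so one choice of solved
unknowns serves a whole neighbourhood. -/
theorem exists_nondegenerate_minor (hm : 1 ≤ m) (hvol : IsVolumeForm vol)
    (hL : ContMDiff 𝓘(ℝ, TJ m N) 𝓘(ℝ, ℝ) ∞ L) (hreg : IsRegular vol L) (hz : z ∈ c.nat.source) :
    ∃ f : Fin N → Fin N × Fin m × Fin m, Function.Injective f ∧
      ∃ U ⊆ c.nat.source, IsOpen U ∧ z ∈ U ∧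
        ∀ w ∈ U, ((elMatrix (c.lagr vol L) (c.nat w)).submatrix id f).det ≠ 0 := by
  obtain ⟨f, hf, hd⟩ := exists_submatrix_det_ne_zero (elMatrix (c.lagr vol L) (c.nat z))
    (elMatrix_rows hm (c.contDiffAt_two_lagr hvol.1 hL hz) (c.hessNondeg_lagr hvol hL hreg hz))
  refine ⟨f, hf, c.nat.source ∩ {w | ((elMatrix (c.lagr vol L) (c.nat w)).submatrix id f).det ≠ 0},
    inter_subset_left, ?_, ⟨hz, hd⟩, fun w hw => hw.2⟩
  have hc : ContinuousOn
      (fun w => ((elMatrix (c.lagr vol L) (c.nat w)).submatrix id f).det) c.nat.source := by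
    intro w hw
    have hℓ := c.contDiffAt_lagr hvol.1 hL (c.nat.map_source hw)
    exact (contMDiffAt_det (I := 𝓘(ℝ, TJ m N)) fun B k => c.contMDiffAt_comp_nat hw
      (contDiffAt_elMatrix hℓ B (f k))).continuousAt.continuousWithinAt
  exact hc.isOpen_inter_preimage c.nat.open_source isOpen_ne

end AdaptedChart

theorem card_sdiff_image {f : Fin N → Fin N × Fin m × Fin m} (hf : Function.Injective f) :
    (Finset.univ \ Finset.univ.image f).card = N * (m ^ 2 - 1) := by
  rw [Finset.card_sdiff_of_subset (Finset.subset_univ _), Finset.card_image_of_injective _ hf]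
  simp [Nat.mul_sub, sq]

theorem exists_jetEqOn_nhds (hm : 1 ≤ m) (hvol : IsVolumeForm vol)
    (hL : ContMDiff 𝓘(ℝ, TJ m N) 𝓘(ℝ, ℝ) ∞ L) (hreg : IsRegular vol L)
    (z : J1 (Base m) (Fib N) π) : ∃ U : Set (J1 (Base m) (Fib N) π), IsOpen U ∧ z ∈ U ∧
      ∃ Ψ : JetSection m N π, IsJetFieldOn U Ψ ∧ JetEqOn U vol L Ψ := by
  obtain ⟨c, hc⟩ := FibredManifold.exists_adapted (B := Base m) (F := Fib N) (π := π) z.pt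
  obtain ⟨f, hf, U, hUc, hU, hzU, hd⟩ := c.exists_nondegenerate_minor hm hvol hL hreg (z := z) hc
  -- All free coefficients are set to zero.
  exact ⟨U, hU, hzU, c.localSolution vol L f 0,
    c.isJetFieldOn_localSolution hvol hL hf hU hUc hd fun s _ => contMDiffOn_const,
    c.jetEqOn_localSolution hvol hL hreg hf hUc hd⟩

/-- The differentials of the solutions at a point form a convex set. -/
theorem convex_solutions (hvol : IsVolumeForm vol)
    (hL : ContMDiff 𝓘(ℝ, TJ m N) 𝓘(ℝ, ℝ) ∞ L) (hreg : IsRegular vol L)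
    (z : J1 (Base m) (Fib N) π) :
    Convex ℝ {A : Base m →L[ℝ] TJ m N | ∃ j : SecondJetAt z, j.lin = A ∧
      ∀ (Z : Fin m → Base m) (u : TJ m N),
        Omega vol L z (Fin.snoc (α := fun _ => TJ m N) (fun i => j.lin (Z i)) u) = 0} := by
  obtain ⟨c, hc⟩ := FibredManifold.exists_adapted (B := Base m) (F := Fib N) (π := π) z.pt
  have hz : z ∈ c.nat.source := hc
  rintro _ ⟨j, rfl, hj⟩ _ ⟨j', rfl, hj'⟩ a b ha hb hab
  have h1 := convex_eulerLagrange (c.lagr vol L) (c.nat z)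
    ((c.jetEq_iff hvol hL hreg hz j).1 hj) ((c.jetEq_iff hvol hL hreg hz j').1 hj') ha hb hab
  have h2 : (dproj (Base m) (Fib N × (Base m →L[ℝ] Fib N)) J1.base z).comp
      (a • j.lin + b • j'.lin) = ContinuousLinearMap.id ℝ (Base m) := by
    rw [ContinuousLinearMap.comp_add, ContinuousLinearMap.comp_smul, ContinuousLinearMap.comp_smul,
      j.dproj_comp, j'.dproj_comp, ← add_smul, hab, one_smul]
  refine ⟨⟨a • j.lin + b • j'.lin, h2⟩, rfl, (c.jetEq_iff hvol hL hreg hz _).2 ?_⟩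
  change EulerLagrange _ _ (c.prolong.coordLin z (a • j.lin + b • j'.lin))
  rw [map_add, map_smul, map_smul]
  exact h1

/-- Local solutions are averaged with a partition of unity. Jets do not form a vector space, so the
average is taken of their differentials, and `convex_solutions` ensures that it is again the
differential of a solution. -/
theorem exists_jetEqOn_univ [T2Space E] [SigmaCompactSpace E] (hm : 1 ≤ m)
    (hvol : IsVolumeForm vol) (hL : ContMDiff 𝓘(ℝ, TJ m N) 𝓘(ℝ, ℝ) ∞ L)
    (hreg : IsRegular vol L) :
    ∃ Ψ : JetSection m N π, IsJetFieldOn univ Ψ ∧ JetEqOn univ vol L Ψ := by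
  have := t2Space_J1 (m := m) (N := N) π
  have := sigmaCompactSpace_J1 (m := m) (N := N) π
  choose U hU hzU Φ hΦ hΦL using exists_jetEqOn_nhds (π := π) hm hvol hL hreg
  obtain ⟨f, hf⟩ := SmoothPartitionOfUnity.exists_isSubordinate 𝓘(ℝ, TJ m N)
    (isClosed_univ (X := J1 (Base m) (Fib N) π)) U hU fun z _ => mem_iUnion.2 ⟨z, hzU z⟩
  have hmem : ∀ {i z}, f i z ≠ 0 → z ∈ U i := fun {i z} h => hf i (subset_tsupport _ h)
  have hsol : ∀ z, ∃ j : SecondJetAt z, j.lin = ∑ᶠ i, f i z • (Φ i z).lin ∧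
      ∀ (Z : Fin m → Base m) (u : TJ m N),
        Omega vol L z (Fin.snoc (α := fun _ => TJ m N) (fun i => j.lin (Z i)) u) = 0 := by
    intro z
    have hconv := convex_solutions hvol hL hreg z
    exact f.finsum_smul_mem_convex (g := fun i z => (Φ i z).lin) (mem_univ z)
      (fun i hi => Exists.intro (Φ i z) ⟨rfl, hΦL i z (hmem hi)⟩) hconv
  choose Ψ hΨ hΨL using hsol
  refine ⟨Ψ, (isJetFieldOn_iff isOpen_univ).2 fun z _ => ?_, fun z _ => hΨL z⟩
  obtain ⟨c, hc⟩ := FibredManifold.exists_adapted (B := Base m) (F := Fib N) (π := π) z.pt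
  refine ⟨c, hc, ?_⟩
  -- The slope is linear in the differential, so the slope of the average is the locally finite sum
  -- of smooth slopes.
  have h1 : (fun z => c.prolong.coordV ⟨z, Ψ z⟩) =
      fun z => ∑ᶠ i, f i z • c.prolong.coordV ⟨z, Φ i z⟩ := by
    funext z
    rw [c.prolong.coordV_eq]
    change c.prolong.coordLin z (Ψ z).lin = _
    rw [hΨ, map_finsum]
    · exact finsum_congr fun i => map_smul _ _ _
    · refine (f.locallyFinite.point_finite z).subset fun i hi => ?_
      exact fun h => hi (by simp [h])
  rw [h1]
  exact f.contMDiffAt_finsum fun i hi => (hΦ i).contMDiffAt c (hU i) (hf i hi) hc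

end Solutions

end FieldTheory

end

/-! ### Assembly of the theorem. -/

open FieldTheory in
theorem mainTheorem3 {m N : ℕ} (hm : 1 ≤ m) {M E : Type*}
    [TopologicalSpace M] [T2Space M] [SigmaCompactSpace M]
    [ChartedSpace (Base m) M] [IsManifold 𝓘(ℝ, Base m) ∞ M]
    [TopologicalSpace E] [T2Space E] [SigmaCompactSpace E]
    [ChartedSpace (Base m × Fib N) E] [IsManifold 𝓘(ℝ, Base m × Fib N) ∞ E]
    (π : E → M) [FibredManifold (Base m) (Fib N) π]
    (vol : M → Base m [⋀^Fin m]→L[ℝ] ℝ) (hvol : IsVolumeForm vol)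
    (L : J1 (Base m) (Fib N) π → ℝ) (hL : ContMDiff 𝓘(ℝ, TJ m N) 𝓘(ℝ, ℝ) ∞ L)
    (hreg : IsRegular vol L) :
    -- global existence
    (∃ (X : MultiField m N π) (Ψ : JetSection m N π),
      LocallyDecomposableOn univ X ∧ TransverseOn univ X ∧
      IsJetFieldOn univ Ψ ∧ AssociatedOn univ X Ψ ∧
      (∀ X', SameClassOn univ X X' → MultiEqOn univ vol L X' ∧ SopdeOn univ X') ∧
      JetEqOn univ vol L Ψ ∧ ConnEqOn univ vol L Ψ ∧ JetSopdeOn univ Ψ) ∧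
    -- classes of multivector fields and jet fields correspond to each other, the three equations
    -- are equivalent, and their solutions are SOPDE
    (∀ U : Set (J1 (Base m) (Fib N) π), IsOpen U →
      (∀ X, LocallyDecomposableOn U X → TransverseOn U X →
        ∃ Ψ, IsJetFieldOn U Ψ ∧ AssociatedOn U X Ψ ∧
          ∀ Ψ', IsJetFieldOn U Ψ' → AssociatedOn U X Ψ' → ∀ z ∈ U, Ψ' z = Ψ z) ∧
      (∀ Ψ, IsJetFieldOn U Ψ →
        ∃ X, LocallyDecomposableOn U X ∧ TransverseOn U X ∧ AssociatedOn U X Ψ ∧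
          ∀ X', (LocallyDecomposableOn U X' ∧ TransverseOn U X' ∧ AssociatedOn U X' Ψ) ↔
            SameClassOn U X X') ∧
      (∀ X Ψ, LocallyDecomposableOn U X → TransverseOn U X → IsJetFieldOn U Ψ →
        AssociatedOn U X Ψ →
          (MultiEqOn U vol L X ↔ JetEqOn U vol L Ψ) ∧ (JetEqOn U vol L Ψ ↔ ConnEqOn U vol L Ψ) ∧
          (MultiEqOn U vol L X → SopdeOn U X ∧ JetSopdeOn U Ψ))) ∧
    -- in local natural coordinates the solutions depend on `N (m² - 1)` arbitrary functions
    (∀ (c : AdaptedChart (Base m) (Fib N) π) (z₀ : J1 (Base m) (Fib N) π), z₀ ∈ c.nat.source →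
      ∃ U ⊆ c.nat.source, IsOpen U ∧ z₀ ∈ U ∧
        ∃ S : Finset (Fin N × Fin m × Fin m), S.card = N * (m ^ 2 - 1) ∧
          ∀ g : Fin N × Fin m × Fin m → J1 (Base m) (Fib N) π → ℝ,
            (∀ s ∈ S, ContMDiffOn 𝓘(ℝ, TJ m N) 𝓘(ℝ, ℝ) ∞ (g s) U) →
            ∃ (X : MultiField m N π) (Ψ : JetSection m N π),
              (LocallyDecomposableOn U X ∧ TransverseOn U X ∧ IsJetFieldOn U Ψ ∧
                AssociatedOn U X Ψ ∧ MultiEqOn U vol L X ∧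
                ∀ s ∈ S, ∀ z ∈ U, coefG c Ψ s z = g s z) ∧
              ∀ X' Ψ', LocallyDecomposableOn U X' → TransverseOn U X' → IsJetFieldOn U Ψ' →
                AssociatedOn U X' Ψ' → MultiEqOn U vol L X' →
                (∀ s ∈ S, ∀ z ∈ U, coefG c Ψ' s z = g s z) →
                SameClassOn U X X' ∧ ∀ z ∈ U, Ψ' z = Ψ z) := by
  refine ⟨?_, fun U hU => ⟨fun X hX hT => ?_, fun Ψ hΨ => ?_, fun X Ψ _ _ _ h => ?_⟩,
    fun c z₀ hz₀ => ?_⟩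
  · obtain ⟨Ψ, hΨ, hΨL⟩ := exists_jetEqOn_univ (π := π) hm hvol hL hreg
    have hA : AssociatedOn univ (unitMultiField Ψ vol) Ψ := associatedOn_unitMultiField hvol.2
    refine ⟨unitMultiField Ψ vol, Ψ,
      locallyDecomposableOn_unitMultiField hm hvol isOpen_univ hΨ, hA.transverseOn, hΨ, hA,
      fun X' hX' => ?_, hΨL, (jetEqOn_iff_connEqOn hvol hL).1 hΨL, hΨL.jetSopdeOn hvol hL hreg⟩
    have hA' := hX'.associatedOn hA
    exact ⟨hA'.multiEqOn_iff.2 hΨL, hΨL.sopdeOn hvol hL hreg hA'⟩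
  · obtain ⟨Ψ, hΨ, h⟩ := exists_jetField hU hX hT
    exact ⟨Ψ, hΨ, h, fun Ψ' _ h' z hz => h.eq h' hz⟩
  · have hX : LocallyDecomposableOn U (unitMultiField Ψ vol) :=
      locallyDecomposableOn_unitMultiField hm hvol hU hΨ
    have hA : AssociatedOn U (unitMultiField Ψ vol) Ψ := associatedOn_unitMultiField hvol.2
    refine ⟨unitMultiField Ψ vol, hX, hA.transverseOn, hA, fun X' => ⟨fun ⟨hX', _, hA'⟩ =>
      sameClassOn_of_associatedOn hX hX' hA hA', fun h => ?_⟩⟩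
    have hA' := h.associatedOn hA
    exact ⟨h.locallyDecomposableOn hm hX, hA'.transverseOn, hA'⟩
  · refine ⟨h.multiEqOn_iff, jetEqOn_iff_connEqOn hvol hL, fun hXL => ?_⟩
    have hΨL := h.multiEqOn_iff.1 hXL
    exact ⟨hΨL.sopdeOn hvol hL hreg h, hΨL.jetSopdeOn hvol hL hreg⟩
  · obtain ⟨f, hf, U, hUc, hU, hzU, hd⟩ := c.exists_nondegenerate_minor hm hvol hL hreg hz₀
    refine ⟨U, hUc, hU, hzU, Finset.univ \ Finset.univ.image f, card_sdiff_image hf,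
      fun g hg => ?_⟩
    have hΨ := c.isJetFieldOn_localSolution hvol hL hf hU hUc hd hg
    have hΨL := c.jetEqOn_localSolution (g := g) hvol hL hreg hf hUc hd
    have hX := locallyDecomposableOn_unitMultiField hm hvol hU hΨ
    have hA : AssociatedOn U (unitMultiField (c.localSolution vol L f g) vol) _ :=
      associatedOn_unitMultiField hvol.2
    refine ⟨unitMultiField (c.localSolution vol L f g) vol, c.localSolution vol L f g,
      ⟨hX, hA.transverseOn, hΨ, hA, hA.multiEqOn_iff.2 hΨL,
        fun s hs z hz => c.coefG_localSolution (hUc hz) hs⟩,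
      fun X' Ψ' hX' _ _ hA' hXL' hg' => ?_⟩
    have heq : ∀ z ∈ U, Ψ' z = c.localSolution vol L f g z :=
      c.jetEqOn_unique hvol hL hreg hf hUc hd hΨL (hA'.multiEqOn_iff.1 hXL') fun s hs z hz => by
        rw [hg' s hs z hz, c.coefG_localSolution (hUc hz) hs]
    -- Uniqueness of the class follows from that of the jet field: since the jet fields agree on
    -- `U`, both multivector fields are associated with the same one.
    refine ⟨sameClassOn_of_associatedOn hX hX' hA fun z hz => ?_, heq⟩
    have h := hA' z hz
    rwa [horizontal, heq z hz] at h
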